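/- **Theorem 1 (critical case).** Let $d\ge 1$ be an integer, $s>\frac d2$ a real number and $p=\frac{4s}{d}+2$. All functions are complex-valued. *Euclidean notions.* On $\mathbb R^d$ use $\widehat f(\xi)=\int f(x)e^{-2\pi i x\cdot\xi}\,dx$, let $D^s$ be the Fourier multiplier with symbol $(2\pi|\xi|)^s$, put $\|f\|_{\dot H^s}=\|D^sf\|_{L^2}$, let $\mathbf P$ be the Fourier multiplier with symbol $\mathbf 1_{\{|\xi|\le 1\}}$, and set $$H_{\mathbb R^d}(u)=\frac12\int_{\mathbb R^d}|D^su|^2\,dx-\frac1p\int_{\mathbb R^d}|u|^p\,dx .$$ Let $Q\in H^s(\mathbb R^d)\setminus\{0\}$ be an optimizer of the fractional Gagliardo–Nirenberg–Sobolev inequality, i.e. a minimizer over $H^s(\mathbb R^d)\setminus\{0\}$ of $$J(u)=\frac{\|u\|_{\dot H^s}^{\frac{(p-2)d}{2s}}\,\|u\|_{L^2}^{2+\frac{p-2}{2s}(2s-d)}}{\|u\|_{L^p}^p},$$ normalized (by scaling) so that $\|Q\|_{L^2}=\|Q\|_{\dot H^s}$ and $\|Q\|_{\dot H^s}^2=\frac2p\|Q\|_{L^p}^p$.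 *The measure.* On $\mathbb T^d=(\mathbb R/\mathbb Z)^d$ let $\mu$ be the massless fractional Gaussian free field $$d\mu(u)=Z^{-1}e^{-\frac12\|u\|_{\dot H^s(\mathbb T^d)}^2}du=Z^{-1}\prod_{n\in\mathbb Z^d\setminus\{0\}}e^{-\frac12(2\pi|n|)^{2s}|\widehat u(n)|^2}\,d\widehat u(n)$$ on mean-zero functions; that is, the Fourier coefficients $\widehat u(n)$, $n\neq0$, are independent, with independent real and imaginary parts that are centered Gaussian of variance $(2\pi|n|)^{-2s}$, and $\widehat u(0)=0$. For $N\in\mathbb N$ let $\mathbf P_Nu=\sum_{|n|\le N}\widehat u(n)e^{2\pi i n\cdot x}$ ($|n|$ the Euclidean length), and for $K>0$ let $$Z_{K,N}=\mathbb E_\mu\Big[\mathbf 1_{\{\|\mathbf P_Nu\|_{L^2(\mathbb T^d)}\le K\}}\exp\Big(\frac1p\int_{\mathbb T^d}|\mathbf P_Nu|^p\,dx\Big)\Big].$$ *Claim.* Let $K>\|Q\|_{L^2(\mathbb R^d)}$ and $$\mathcal C_K=-\inf\big\{H_{\mathbb R^d}(u):\ u\in L^2(\mathbb R^d),\ \|u\|_{L^2(\mathbb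 R^d)}=K,\ u=\mathbf Pu\big\}.$$ Then $\mathcal C_K>0$. If $s$ is an integer, then, as $N\to\infty$, $$\log Z_{K,N}=\mathcal C_KN^{2s}+o(N^{2s})=\mathcal C_KN^{\frac{dp}2-d}+o\big(N^{\frac{dp}2-d}\big).$$ For every real $s>\frac d2$ (integer or not) the lower bound $\liminf_{N\to\infty}N^{-2s}\log Z_{K,N}\ge\mathcal C_K$ holds. -/

import Mathlib

open MeasureTheory ProbabilityTheory Filter Asymptotics
open scoped FourierTransform Topology ENNReal NNReal

noncomputable section

namespace FocusingGibbs

/-! ### The Euclidean side: functionals on `L²(ℝᵈ; ℂ)` -/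

/-- The space `L²(ℝᵈ; ℂ)`. -/
abbrev SpaceL2 (d : ℕ) : Type :=
  Lp ℂ 2 (volume : Measure (EuclideanSpace ℝ (Fin d)))

/-- `u ∈ L²` belongs to `Hˢ(ℝᵈ)` (for `s ≥ 0`): the function `(2π|ξ|)ˢ û(ξ)` is in `L²`. -/
def MemHs {d : ℕ} (s : ℝ) (u : SpaceL2 d) : Prop :=
  MemLp (fun ξ : EuclideanSpace ℝ (Fin d) =>
    (((2 * Real.pi * ‖ξ‖) ^ s : ℝ) : ℂ) * (𝓕 u : SpaceL2 d) ξ) 2 volume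

open Classical in
/-- The fractional derivative `Dˢ u = 𝓕⁻¹ ((2π|ξ|)ˢ û(ξ))` of `u ∈ Hˢ(ℝᵈ)`
(the value `0` outside `Hˢ` is never used). -/
def rieszD {d : ℕ} (s : ℝ) (u : SpaceL2 d) : SpaceL2 d :=
  if h : MemHs s u then 𝓕⁻ (MemLp.toLp _ h : SpaceL2 d) else 0

/-- The ball multiplier `𝐏` on `L²(ℝᵈ)`: the Fourier transform is multiplied by the indicator
function of the closed unit ball. -/
def ballMultiplier {d : ℕ} (u : SpaceL2 d) : SpaceL2 d :=
  𝓕⁻ ((MemLp.indicator (s := Metric.closedBall (0 : EuclideanSpace ℝ (Fin d)) 1)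
    measurableSet_closedBall (Lp.memLp (𝓕 u : SpaceL2 d))).toLp : SpaceL2 d)

/-- `‖u‖_{Lᵖ(ℝᵈ)}ᵖ = ∫ |u|ᵖ dx`. -/
def intPow {d : ℕ} (p : ℝ) (u : SpaceL2 d) : ℝ :=
  ∫ x : EuclideanSpace ℝ (Fin d), ‖u x‖ ^ p

/-- The Hamiltonian `H(u) = ½ ∫ |Dˢu|² dx - (1/p) ∫ |u|ᵖ dx` on `ℝᵈ`. -/
def hamiltonian {d : ℕ} (s p : ℝ) (u : SpaceL2 d) : ℝ :=
  1 / 2 * ‖rieszD s u‖ ^ 2 - 1 / p * intPow p u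

/-- The constant `𝒞_K`: minus the infimum of the Hamiltonian over all `u ∈ L²(ℝᵈ)` with
`‖u‖_{L²} = K` and `u = 𝐏 u`. -/
def critConst (d : ℕ) (s p K : ℝ) : ℝ :=
  -sInf (hamiltonian s p '' {u : SpaceL2 d | ‖u‖ = K ∧ u = ballMultiplier u})

/-- The Gagliardo-Nirenberg-Sobolev quotient
`‖u‖_{Ḣˢ}^{(p-2)d/(2s)} ‖u‖_{L²}^{2 + (p-2)(2s-d)/(2s)} / ‖u‖_{Lᵖ}ᵖ`. -/
def gnsQuotient {d : ℕ} (s p : ℝ) (u : SpaceL2 d) : ℝ :=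
  ‖rieszD s u‖ ^ ((p - 2) * d / (2 * s)) * ‖u‖ ^ (2 + (p - 2) / (2 * s) * (2 * s - d)) /
    intPow p u

/-- `Q` is an optimizer of the fractional Gagliardo-Nirenberg-Sobolev inequality: it minimizes the
quotient over all nonzero elements of `Hˢ(ℝᵈ)`. -/
def IsGNSOptimizer {d : ℕ} (s p : ℝ) (Q : SpaceL2 d) : Prop :=
  MemHs s Q ∧ Q ≠ 0 ∧
    ∀ u : SpaceL2 d, MemHs s u → u ≠ 0 → gnsQuotient s p Q ≤ gnsQuotient s p u

/-- The normalization of the optimizer (possible by scaling):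
`‖Q‖_{L²} = ‖Q‖_{Ḣˢ}` and `‖Q‖_{Ḣˢ}² = (2/p) ‖Q‖_{Lᵖ}ᵖ`. -/
def IsGNSNormalized {d : ℕ} (s p : ℝ) (Q : SpaceL2 d) : Prop :=
  ‖Q‖ = ‖rieszD s Q‖ ∧ ‖rieszD s Q‖ ^ 2 = 2 / p * intPow p Q

/-! ### The torus side: the Gaussian free field and the truncated partition function -/

/-- The Lebesgue (= Haar) probability measure on `𝕋ᵈ = (ℝ/ℤ)ᵈ`. -/
abbrev torusMeasure (d : ℕ) : Measure (UnitAddTorus (Fin d)) :=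
  Measure.pi fun _ => AddCircle.haarAddCircle

/-- The space `L²(𝕋ᵈ; ℂ)`, with its Borel σ-algebra. -/
abbrev TorusL2 (d : ℕ) : Type := Lp ℂ 2 (torusMeasure d)

instance instMeasurableSpaceTorusL2 (d : ℕ) : MeasurableSpace (TorusL2 d) := borel _

instance instBorelSpaceTorusL2 (d : ℕ) : BorelSpace (TorusL2 d) := ⟨rfl⟩

/-- The Euclidean length `|n|` of a frequency `n ∈ ℤᵈ`. -/
def freqNorm {d : ℕ} (n : Fin d → ℤ) : ℝ := Real.sqrt (∑ i, (n i : ℝ) ^ 2)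

/-- The nonzero frequencies `ℤᵈ \ {0}`. -/
abbrev NonzeroFreq (d : ℕ) : Type := {n : Fin d → ℤ // n ≠ 0}

/-- The law of the Fourier coefficient `û(n)`, `n ≠ 0`: the probability measure on `ℂ` with density
proportional to `exp (-½ (2π|n|)^{2s} |z|²)`, that is, the real and the imaginary part are
independent centered Gaussians of variance `(2π|n|)^{-2s}`. -/
def coeffLaw {d : ℕ} (s : ℝ) (n : NonzeroFreq d) : Measure ℂ :=
  ((gaussianReal 0 (Real.toNNReal ((2 * Real.pi * freqNorm n.1) ^ (-(2 * s))))).prod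
    (gaussianReal 0 (Real.toNNReal ((2 * Real.pi * freqNorm n.1) ^ (-(2 * s)))))).map
      Complex.measurableEquivRealProd.symm

instance instIsProbabilityMeasureCoeffLaw {d : ℕ} (s : ℝ) (n : NonzeroFreq d) :
    IsProbabilityMeasure (coeffLaw s n) :=
  Measure.isProbabilityMeasure_map Complex.measurableEquivRealProd.symm.measurable.aemeasurable

/-- The mean-zero Fourier series `∑_{n ≠ 0} c_n e^{2πi n·x}`, summed in `L²(𝕋ᵈ)`. -/
def fourierSeries {d : ℕ} (c : NonzeroFreq d → ℂ) : TorusL2 d :=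
  ∑' n : NonzeroFreq d,
    c n • ContinuousMap.toLp (E := ℂ) 2 (torusMeasure d) ℂ (UnitAddTorus.mFourier n.1)

theorem measurable_fourierSeries (d : ℕ) : Measurable (fourierSeries (d := d)) := by
  have : SecondCountableTopology UnitAddCircle := inferInstance
  have : MeasurableSpace.CountablyGenerated (UnitAddTorus (Fin d)) := inferInstance
  have : IsSeparable (torusMeasure d) := inferInstance
  have : Fact ((2 : ℝ≥0∞) ≠ ∞) := ⟨by simp⟩
  have : SecondCountableTopology (TorusL2 d) := inferInstance
  unfold fourierSeries
  exact Measurable.tsum fun n => (measurable_pi_apply n).smul_const _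

/-- The massless fractional Gaussian free field
`dμ = Z⁻¹ ∏_{n ≠ 0} exp (-½ (2π|n|)^{2s} |û(n)|²) dû(n)`, as a probability measure on `L²(𝕋ᵈ)`:
the law of the Fourier series with independent coefficients of law `coeffLaw s n`. For `s > d/2`
the series converges almost surely. -/
def gaussianField (d : ℕ) (s : ℝ) : Measure (TorusL2 d) :=
  (Measure.infinitePi fun n : NonzeroFreq d => coeffLaw s n).map fourierSeries

instance instIsProbabilityMeasureGaussianField (d : ℕ) (s : ℝ) :
    IsProbabilityMeasure (gaussianField d s) :=
  Measure.isProbabilityMeasure_map (measurable_fourierSeries d).aemeasurable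

/-- The finite set of frequencies `{n ∈ ℤᵈ : |n| ≤ N}` (Euclidean length). -/
def freqBall (d N : ℕ) : Finset (Fin d → ℤ) :=
  (Fintype.piFinset fun _ : Fin d => Finset.Icc (-(N : ℤ)) N).filter
    fun n => ∑ i, n i ^ 2 ≤ (N : ℤ) ^ 2

theorem mem_freqBall {d N : ℕ} {n : Fin d → ℤ} : n ∈ freqBall d N ↔ freqNorm n ≤ N := by
  have h : freqNorm n ≤ N ↔ ∑ i, n i ^ 2 ≤ (N : ℤ) ^ 2 := by
    unfold freqNorm
    rw [Real.sqrt_le_left (Nat.cast_nonneg N)]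
    exact_mod_cast Iff.rfl
  rw [h]
  simp only [freqBall, Finset.mem_filter, Fintype.mem_piFinset, Finset.mem_Icc,
    and_iff_right_iff_imp]
  intro hn i
  have h1 : n i ^ 2 ≤ (N : ℤ) ^ 2 :=
    (Finset.single_le_sum (f := fun i => n i ^ 2) (fun j _ => sq_nonneg (n j))
      (Finset.mem_univ i)).trans hn
  exact abs_le.mp (abs_le_of_sq_le_sq h1 (Int.natCast_nonneg N))

/-- The frequency projector `𝐏_N u = ∑_{|n| ≤ N} û(n) e^{2πi n·x}`. -/
def freqProj {d : ℕ} (N : ℕ) (u : TorusL2 d) : C(UnitAddTorus (Fin d), ℂ) :=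
  ∑ n ∈ freqBall d N, UnitAddTorus.mFourierCoeff u n • UnitAddTorus.mFourier n

/-- The partition function
`Z_{K,N} = 𝔼_μ [ 𝟏_{‖𝐏_N u‖_{L²} ≤ K} exp ((1/p) ∫ |𝐏_N u|ᵖ dx) ]`. -/
def partitionFn (d : ℕ) (s p K : ℝ) (N : ℕ) : ℝ :=
  ∫ u : TorusL2 d,
    Set.indicator {u : TorusL2 d | lpNorm (freqProj N u) 2 (torusMeasure d) ≤ K}
      (fun u => Real.exp (1 / p * ∫ x, ‖freqProj N u x‖ ^ p ∂torusMeasure d)) u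
    ∂gaussianField d s

end FocusingGibbs

end

open FocusingGibbs

/-!
The partition function is a finite-dimensional Gaussian integral, and Laplace's method reduces its
logarithm to a maximization problem on the torus, whose value is computed by comparison with the
Euclidean problem defining `critConst`. The argument works for every real `s > d/2`.

*Reduction.* Almost surely the Fourier coefficients of the field are square-summable, so that the
projected field is the trigonometric polynomial with the prescribed independent Gaussian
coefficients. Inserting the Gaussian density writes the partition function as the integral of
`exp (torusNegHam)` times `∏ (λ_n / 2π)`, where `λ_n = (2π|n|)^{2s}`, over the coefficients of mass
at most `K²` (`partitionFn_eq_toReal_lintegral`).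

*Laplace's method.* From above, the integral is at most the maximum of the integrand times the
volume of a polydisc (`lintegral_exp_torusNegHam_le`). From below, one integrates over a small
polydisc around a good competitor; symmetrization and convexity of `|·|ᵖ` make the first-order
variation harmless (`le_lintegral_exp_torusNegHam`). There are `O(N^d)` frequencies, each
contributing a volume factor that is polynomial in `N`, so that these factors change the logarithm
only by `O(N^d log N) = o(N^{2s})`.

*Upper bound for the energy* (`eventually_torusNegHam_le`). A trigonometric polynomial of degree
`N` is multiplied by a smoothed indicator of the unit cube with compactly supported Fourier
transform. The product is a function on `ℝᵈ` of frequency at most `N + O(1)`, of no larger mass,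
and after a suitable translation it keeps almost all of the `Lᵖ` norm. Its kinetic energy is controlled
since the symbol `(2π|ξ|)ˢ` varies by `o(Nˢ)` over bounded distances (`kinetic_shiftSum_le`). The Euclidean bound at
frequency scale `N` follows from scaling, as kinetic and potential energy both scale like `N^{2s}`
at the critical exponent (`negHam_le`).

*Lower bound for the energy* (`eventually_exists_le_torusNegHam`). The Fourier transform of a
Euclidean competitor is integrated over the cells of the lattice `ℤᵈ / N`; the resulting
trigonometric polynomials recover its kinetic energy by dominated convergence and its potential
energy by Fatou's lemma.

*Positivity* (`critConst_pos`). The normalized optimizer has zero energy. Raising its amplitude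
makes the energy negative, and a Fourier truncation followed by a dilation makes it admissible.
-/

noncomputable section

namespace FocusingGibbs

/-! ### Fourier inversion for integrable square-integrable functions -/

section FourierInversion

variable {d : ℕ}

local notation "𝔼" => EuclideanSpace ℝ (Fin d)

theorem norm_fourierInv_le (g : 𝔼 → ℂ) (x : 𝔼) : ‖𝓕⁻ g x‖ ≤ ∫ ξ, ‖g ξ‖ := by
  rw [Real.fourierInv_eq]
  refine (norm_integral_le_integral_norm _).trans (le_of_eq ?_)
  simp

theorem continuous_fourierInv {g : 𝔼 → ℂ} (hg : Integrable g) : Continuous (𝓕⁻ g : 𝔼 → ℂ) := by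
  have : (𝓕⁻ g : 𝔼 → ℂ) = fun x => 𝓕 g (-x) := by
    ext x
    exact Real.fourierInv_eq_fourier_neg g x
  rw [this]
  have h : Continuous (𝓕 g : 𝔼 → ℂ) :=
    VectorFourier.fourierIntegral_continuous Real.continuous_fourierChar
      (innerSL ℝ).continuous₂ hg
  exact h.comp continuous_neg

/-- On `L¹ ∩ L²` the `L²` inverse Fourier transform is given by the absolutely convergent
integral. -/
theorem coeFn_fourierInv_toLp {g : 𝔼 → ℂ} (h1 : Integrable g) (h2 : MemLp g 2 volume) :
    ((𝓕⁻ (h2.toLp g : SpaceL2 d) : SpaceL2 d) : 𝔼 → ℂ) =ᵐ[volume] 𝓕⁻ g := by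
  refine ae_eq_of_integral_contDiff_smul_eq
    ((Lp.memLp _).locallyIntegrable (by norm_num)) ?_ ?_
  · exact (continuous_fourierInv h1).locallyIntegrable
  intro φ hφ hφc
  have hg₁ : HasCompactSupport (Complex.ofRealCLM ∘ φ) := hφc.comp_left rfl
  have hg₂ : ContDiff ℝ (⊤ : ℕ∞) (Complex.ofRealCLM ∘ φ) := by fun_prop
  set φ' := hg₁.toSchwartzMap hg₂ with hφ'
  have e1 : ∀ x, (φ' x : ℂ) = (φ x : ℂ) := fun x => by simp [hφ']
  have e2 : ∀ f : 𝔼 → ℂ, ∫ x, φ x • f x = ∫ x, φ' x • f x := fun f => by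
    refine integral_congr_ae (Eventually.of_forall fun x => ?_)
    simp [e1]
  rw [e2, e2]
  have h3 := congrArg (fun T => T φ')
    (Lp.fourierInv_toTemperedDistribution_eq (h2.toLp g : SpaceL2 d))
  simp only [TemperedDistribution.fourierInv_apply, Lp.toTemperedDistribution_apply] at h3
  rw [← h3]
  have h4 : ∫ x, (𝓕⁻ φ') x • (h2.toLp g : SpaceL2 d) x = ∫ x, (𝓕⁻ φ') x • g x := by
    refine integral_congr_ae ?_
    filter_upwards [h2.coeFn_toLp] with x hx
    rw [hx]
  rw [h4, SchwartzMap.fourierInv_coe]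
  have hL : Continuous fun p : 𝔼 × 𝔼 ↦ (-innerₗ 𝔼) p.1 p.2 := by
    have : (fun p : 𝔼 × 𝔼 ↦ (-innerₗ 𝔼) p.1 p.2) = fun p => -(inner ℝ p.1 p.2) := by
      ext p; simp
    rw [this]
    fun_prop
  have hflip : (-innerₗ 𝔼).flip = -innerₗ 𝔼 := by
    ext x y
    simp [real_inner_comm]
  have h5 := VectorFourier.integral_fourierIntegral_smul_eq_flip (μ := volume) (ν := volume)
    (L := -innerₗ 𝔼) (f := φ') (g := g) Real.continuous_fourierChar hL φ'.integrable h1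
  rw [hflip] at h5
  exact h5

theorem memLp_fourierInv {g : 𝔼 → ℂ} (h1 : Integrable g) (h2 : MemLp g 2 volume) :
    MemLp (𝓕⁻ g : 𝔼 → ℂ) 2 volume :=
  (memLp_congr_ae (coeFn_fourierInv_toLp h1 h2)).mp (Lp.memLp _)

theorem norm_sq_eq_integral {u : SpaceL2 d} : ‖u‖ ^ 2 = ∫ x, ‖u x‖ ^ 2 := by
  have h := L2.inner_def (𝕜 := ℂ) u u
  rw [inner_self_eq_norm_sq_to_K] at h
  have h2 : ∫ x, inner ℂ (u x) (u x) = ((∫ x, ‖u x‖ ^ 2 : ℝ) : ℂ) := by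
    rw [← integral_complex_ofReal]
    refine integral_congr_ae (Eventually.of_forall fun x => ?_)
    simp only [inner_self_eq_norm_sq_to_K]
    push_cast
    rfl
  rw [h2] at h
  exact Complex.ofReal_injective (by simpa using h)

theorem norm_sq_toLp {g : 𝔼 → ℂ} (h2 : MemLp g 2 volume) :
    ‖(h2.toLp g : SpaceL2 d)‖ ^ 2 = ∫ x, ‖g x‖ ^ 2 := by
  rw [norm_sq_eq_integral]
  refine integral_congr_ae ?_
  filter_upwards [h2.coeFn_toLp] with x hx
  rw [hx]

theorem norm_fourierInv_Lp (u : SpaceL2 d) : ‖(𝓕⁻ u : SpaceL2 d)‖ = ‖u‖ := by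
  rw [← Lp.norm_fourier_eq, FourierTransform.fourier_fourierInv_eq]

/-- Plancherel's theorem on `L¹ ∩ L²`, for the pointwise inverse Fourier transform. -/
theorem integral_norm_sq_fourierInv {g : 𝔼 → ℂ} (h1 : Integrable g) (h2 : MemLp g 2 volume) :
    ∫ x, ‖𝓕⁻ g x‖ ^ 2 = ∫ ξ, ‖g ξ‖ ^ 2 := by
  rw [← norm_sq_toLp h2, ← norm_fourierInv_Lp, norm_sq_eq_integral]
  refine integral_congr_ae ?_
  filter_upwards [coeFn_fourierInv_toLp h1 h2] with x hx
  rw [hx]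

end FourierInversion

/-! ### Band-limited functions and their energies -/

section BandLimited

variable {d : ℕ}

local notation "𝔼" => EuclideanSpace ℝ (Fin d)

/-- `g` is the Fourier transform of an `L²` function whose spectrum lies in the closed ball of
radius `R`. The vanishing is required everywhere, not just almost everywhere. -/
structure BandLimited (R : ℝ) (g : 𝔼 → ℂ) : Prop where
  memLp : MemLp g 2 volume
  zero : ∀ ξ, R < ‖ξ‖ → g ξ = 0

/-- The mass `‖u‖²_{L²}`, expressed through `g = û`. -/
def mass (g : 𝔼 → ℂ) : ℝ := ∫ ξ, ‖g ξ‖ ^ 2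

/-- The kinetic energy `‖u‖²_{Ḣˢ}`, expressed through `g = û`. -/
def kinetic (s : ℝ) (g : 𝔼 → ℂ) : ℝ := ∫ ξ, (2 * Real.pi * ‖ξ‖) ^ (2 * s) * ‖g ξ‖ ^ 2

/-- The potential `‖u‖ᵖ_{Lᵖ}`, expressed through `g = û`. -/
def potential (p : ℝ) (g : 𝔼 → ℂ) : ℝ := ∫ x, ‖𝓕⁻ g x‖ ^ p

/-- Minus the Hamiltonian of `u`, expressed through `g = û`. -/
def negHam (s p : ℝ) (g : 𝔼 → ℂ) : ℝ := 1 / p * potential p g - 1 / 2 * kinetic s g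

theorem mass_nonneg (g : 𝔼 → ℂ) : 0 ≤ mass g := integral_nonneg fun _ => by positivity

theorem kinetic_nonneg (s : ℝ) (g : 𝔼 → ℂ) : 0 ≤ kinetic s g :=
  integral_nonneg fun _ => by positivity

theorem potential_nonneg (p : ℝ) (g : 𝔼 → ℂ) : 0 ≤ potential p g :=
  integral_nonneg fun _ => by positivity

theorem memLp_two_integrable_sq {g : 𝔼 → ℂ} (h : MemLp g 2 volume) :
    Integrable fun ξ => ‖g ξ‖ ^ 2 := by
  simpa using h.integrable_norm_pow (p := 2) (by norm_num)

theorem BandLimited.eq_indicator {R : ℝ} {g : 𝔼 → ℂ} (hg : BandLimited R g) :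
    (Metric.closedBall (0 : 𝔼) R).indicator g = g := by
  ext ξ
  by_cases h : ξ ∈ Metric.closedBall (0 : 𝔼) R
  · rw [Set.indicator_of_mem h]
  · rw [Set.indicator_of_notMem h, hg.zero]
    simpa using h

theorem BandLimited.const_smul {R : ℝ} {g : 𝔼 → ℂ} (hg : BandLimited R g) (c : ℂ) :
    BandLimited R (fun ξ => c * g ξ) :=
  ⟨hg.memLp.const_mul c, fun ξ h => by simp [hg.zero ξ h]⟩

theorem BandLimited.integrable {R : ℝ} {g : 𝔼 → ℂ} (hg : BandLimited R g) : Integrable g := by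
  rw [← hg.eq_indicator, integrable_indicator_iff measurableSet_closedBall]
  have : IsFiniteMeasure (volume.restrict (Metric.closedBall (0 : 𝔼) R)) :=
    ⟨by simpa using measure_closedBall_lt_top⟩
  exact (hg.memLp.restrict _).integrable (by norm_num)

theorem BandLimited.integrable_kinetic {R s : ℝ} (hs : 0 ≤ s) {g : 𝔼 → ℂ}
    (hg : BandLimited R g) :
    Integrable fun ξ => (2 * Real.pi * ‖ξ‖) ^ (2 * s) * ‖g ξ‖ ^ 2 := by
  have h1 := (memLp_two_integrable_sq hg.memLp).const_mul ((2 * Real.pi * |R|) ^ (2 * s))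
  have hm : Measurable fun ξ : 𝔼 => (2 * Real.pi * ‖ξ‖) ^ (2 * s) := by fun_prop
  refine h1.mono' (hm.aestronglyMeasurable.mul
    (memLp_two_integrable_sq hg.memLp).aestronglyMeasurable) (Eventually.of_forall fun ξ => ?_)
  rw [Real.norm_of_nonneg (by positivity)]
  by_cases h : R < ‖ξ‖
  · simp [hg.zero ξ h]
  · have : ‖ξ‖ ≤ |R| := (not_lt.mp h).trans (le_abs_self R)
    gcongr

/-- The Cauchy-Schwarz inequality bounds a band-limited function by its mass. -/
theorem BandLimited.integral_norm_le {R : ℝ} {g : 𝔼 → ℂ} (hg : BandLimited R g) :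
    ∫ ξ, ‖g ξ‖ ≤ Real.sqrt (volume.real (Metric.closedBall (0 : 𝔼) R)) * Real.sqrt (mass g) := by
  set B := Metric.closedBall (0 : 𝔼) R
  have h1 : ∫ ξ, ‖g ξ‖ = ∫ ξ, B.indicator (fun _ => (1 : ℝ)) ξ * ‖g ξ‖ := by
    refine integral_congr_ae (Eventually.of_forall fun ξ => ?_)
    by_cases h : ξ ∈ B
    · simp [h]
    · have : g ξ = 0 := hg.zero _ (by simpa [B] using h)
      simp [this]
  have hB : MemLp (B.indicator (fun _ => (1 : ℝ))) 2 volume :=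
    memLp_indicator_const 2 measurableSet_closedBall 1 (Or.inr measure_closedBall_lt_top.ne)
  have h2 := integral_mul_le_Lp_mul_Lq_of_nonneg (μ := (volume : Measure 𝔼))
    (p := 2) (q := 2) Real.HolderConjugate.two_two
    (f := B.indicator (fun _ => (1 : ℝ))) (g := fun ξ => ‖g ξ‖)
    (Eventually.of_forall fun ξ => Set.indicator_nonneg (fun _ _ => zero_le_one) _)
    (Eventually.of_forall fun ξ => norm_nonneg _) (by simpa using hB) (by simpa using hg.memLp.norm)
  rw [h1]
  refine h2.trans (le_of_eq ?_)
  rw [Real.sqrt_eq_rpow, Real.sqrt_eq_rpow, mass]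
  congr 2
  · have : ∀ ξ, B.indicator (fun _ => (1 : ℝ)) ξ ^ (2 : ℝ) = B.indicator (fun _ => (1 : ℝ)) ξ := by
      intro ξ
      by_cases h : ξ ∈ B <;> simp [h]
    simp_rw [this]
    rw [integral_indicator measurableSet_closedBall]
    simp [Measure.real, B]
  · simp

/-- The bound `‖u‖_p^p ≤ ‖û‖_1^{p-2} ‖u‖_2²`, obtained by interpolating with the sup norm. -/
theorem BandLimited.integrable_potential {R p : ℝ} (hp : 2 ≤ p) {g : 𝔼 → ℂ}
    (hg : BandLimited R g) :
    Integrable (fun x => ‖𝓕⁻ g x‖ ^ p) ∧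
      potential p g ≤ (∫ ξ, ‖g ξ‖) ^ (p - 2) * mass g := by
  have h2 := memLp_two_integrable_sq (memLp_fourierInv hg.integrable hg.memLp)
  have h0 : 0 ≤ ∫ ξ, ‖g ξ‖ := integral_nonneg fun _ => norm_nonneg _
  have hle : ∀ x, ‖𝓕⁻ g x‖ ^ p ≤ (∫ ξ, ‖g ξ‖) ^ (p - 2) * ‖𝓕⁻ g x‖ ^ 2 := fun x => by
    have : ‖𝓕⁻ g x‖ ^ p = ‖𝓕⁻ g x‖ ^ (p - 2) * ‖𝓕⁻ g x‖ ^ 2 := by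
      rw [← Real.rpow_natCast ‖𝓕⁻ g x‖ 2, ← Real.rpow_add_of_nonneg (norm_nonneg _)
        (by linarith) (by norm_num)]
      congr 1
      push_cast
      ring
    rw [this]
    gcongr
    exact norm_fourierInv_le g x
  have hc := continuous_fourierInv hg.integrable
  have hi : Integrable (fun x => ‖𝓕⁻ g x‖ ^ p) := by
    refine (h2.const_mul ((∫ ξ, ‖g ξ‖) ^ (p - 2))).mono' ?_ (Eventually.of_forall fun x => ?_)
    · exact (hc.norm.rpow_const fun x => Or.inr (by linarith)).aestronglyMeasurable
    · rw [Real.norm_of_nonneg (by positivity)]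
      exact hle x
  refine ⟨hi, ?_⟩
  calc potential p g ≤ ∫ x, (∫ ξ, ‖g ξ‖) ^ (p - 2) * ‖𝓕⁻ g x‖ ^ 2 :=
        integral_mono hi (h2.const_mul _) hle
    _ = _ := by rw [integral_const_mul, integral_norm_sq_fourierInv hg.integrable hg.memLp, mass]

theorem sq_rpow_mul (a s : ℝ) (ha : 0 ≤ a) (z : ℂ) :
    ‖((a ^ s : ℝ) : ℂ) * z‖ ^ 2 = a ^ (2 * s) * ‖z‖ ^ 2 := by
  rw [norm_mul, mul_pow, Complex.norm_real, Real.norm_of_nonneg (by positivity), mul_comm 2 s,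
    Real.rpow_mul ha, Real.rpow_two]

theorem norm_rieszD_sq {s : ℝ} {u : SpaceL2 d} (h : MemHs s u) :
    ‖rieszD s u‖ ^ 2 = kinetic s ((𝓕 u : SpaceL2 d) : 𝔼 → ℂ) := by
  rw [rieszD, dif_pos h, norm_fourierInv_Lp]
  refine (norm_sq_toLp (show MemLp _ 2 volume from h)).trans ?_
  refine integral_congr_ae (Eventually.of_forall fun ξ => ?_)
  exact sq_rpow_mul _ _ (by positivity) _

theorem kinetic_congr {s : ℝ} {g h : 𝔼 → ℂ} (e : g =ᵐ[volume] h) : kinetic s g = kinetic s h := by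
  refine integral_congr_ae ?_
  filter_upwards [e] with ξ hξ
  rw [hξ]

theorem BandLimited.memLp_mul {R s : ℝ} (hs : 0 ≤ s) {g : 𝔼 → ℂ} (hg : BandLimited R g) :
    MemLp (fun ξ : 𝔼 => (((2 * Real.pi * ‖ξ‖) ^ s : ℝ) : ℂ) * g ξ) 2 volume := by
  have hm : Measurable fun ξ : 𝔼 => (((2 * Real.pi * ‖ξ‖) ^ s : ℝ) : ℂ) := by fun_prop
  have hm' : AEStronglyMeasurable
      (fun ξ : 𝔼 => (((2 * Real.pi * ‖ξ‖) ^ s : ℝ) : ℂ) * g ξ) volume :=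
    hm.aestronglyMeasurable.mul hg.memLp.1
  rw [memLp_two_iff_integrable_sq_norm hm']
  refine (hg.integrable_kinetic hs).congr (Eventually.of_forall fun ξ => ?_)
  exact (sq_rpow_mul _ _ (by positivity) _).symm

/-- Every band-limited `g` is the Fourier transform of an admissible competitor in the variational
problem defining `critConst`. -/
theorem BandLimited.exists_competitor {s p : ℝ} (hs : 0 ≤ s) {g : 𝔼 → ℂ}
    (hg : BandLimited 1 g) :
    ∃ u : SpaceL2 d, ‖u‖ ^ 2 = mass g ∧ u = ballMultiplier u ∧
      hamiltonian s p u = -negHam s p g := by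
  have hF : (𝓕 (𝓕⁻ (hg.memLp.toLp g : SpaceL2 d) : SpaceL2 d) : SpaceL2 d) =
      hg.memLp.toLp g := FourierTransform.fourier_fourierInv_eq _
  have hmem : MemHs s (𝓕⁻ (hg.memLp.toLp g : SpaceL2 d) : SpaceL2 d) := by
    rw [MemHs, hF]
    refine (memLp_congr_ae ?_).mpr (hg.memLp_mul hs)
    filter_upwards [hg.memLp.coeFn_toLp] with ξ hξ
    rw [hξ]
  refine ⟨𝓕⁻ (hg.memLp.toLp g : SpaceL2 d), ?_, ?_, ?_⟩
  · rw [norm_fourierInv_Lp, norm_sq_toLp, mass]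
  · rw [ballMultiplier]
    congr 1
    refine (MemLp.toLp_eq_toLp_iff _ _).mpr ?_
    rw [hF]
    filter_upwards [hg.memLp.coeFn_toLp] with ξ hξ
    by_cases h : ξ ∈ Metric.closedBall (0 : 𝔼) 1
    · rw [Set.indicator_of_mem h, hξ]
    · rw [Set.indicator_of_notMem h, hg.zero ξ (by simpa using h)]
  · rw [hamiltonian, norm_rieszD_sq hmem, hF, kinetic_congr hg.memLp.coeFn_toLp, negHam, intPow,
      potential]
    have : ∫ x, ‖(𝓕⁻ (hg.memLp.toLp g : SpaceL2 d) : SpaceL2 d) x‖ ^ p =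
        ∫ x, ‖𝓕⁻ g x‖ ^ p := by
      refine integral_congr_ae ?_
      filter_upwards [coeFn_fourierInv_toLp hg.integrable hg.memLp] with x hx
      rw [hx]
    rw [this]
    ring

/-- Conversely, every admissible competitor comes from a band-limited `g`. -/
theorem exists_bandLimited_of_eq_ballMultiplier {s p : ℝ} (hs : 0 ≤ s) {u : SpaceL2 d}
    (hu : u = ballMultiplier u) :
    ∃ g : 𝔼 → ℂ, BandLimited 1 g ∧ mass g = ‖u‖ ^ 2 ∧ hamiltonian s p u = -negHam s p g := by
  have hm : MemLp ((Metric.closedBall (0 : 𝔼) 1).indicator ((𝓕 u : SpaceL2 d) : 𝔼 → ℂ)) 2 volume :=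
    (Lp.memLp (𝓕 u : SpaceL2 d)).indicator measurableSet_closedBall
  have hg : BandLimited 1 ((Metric.closedBall (0 : 𝔼) 1).indicator ((𝓕 u : SpaceL2 d) : 𝔼 → ℂ)) :=
    ⟨hm, fun ξ h => Set.indicator_of_notMem (by simpa using h) _⟩
  have hu' : u = 𝓕⁻ (hm.toLp _ : SpaceL2 d) := hu
  have hF : (𝓕 u : SpaceL2 d) = hm.toLp _ := by
    conv_lhs => rw [hu']
    exact FourierTransform.fourier_fourierInv_eq _
  refine ⟨_, hg, ?_, ?_⟩
  · conv_rhs => rw [hu', norm_fourierInv_Lp, norm_sq_toLp]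
    rfl
  · have hae : ((𝓕 u : SpaceL2 d) : 𝔼 → ℂ) =ᵐ[volume]
        (Metric.closedBall (0 : 𝔼) 1).indicator ((𝓕 u : SpaceL2 d) : 𝔼 → ℂ) := by
      have := hm.coeFn_toLp
      rwa [← hF] at this
    have hmem : MemHs s u := by
      rw [MemHs]
      refine (memLp_congr_ae ?_).mpr (hg.memLp_mul hs)
      filter_upwards [hae] with ξ hξ
      rw [← hξ]
    rw [hamiltonian, norm_rieszD_sq hmem, kinetic_congr hae, negHam, intPow, potential]
    have : ∫ x, ‖u x‖ ^ p = ∫ x, ‖𝓕⁻ ((Metric.closedBall (0 : 𝔼) 1).indicator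
        ((𝓕 u : SpaceL2 d) : 𝔼 → ℂ)) x‖ ^ p := by
      refine integral_congr_ae ?_
      have := coeFn_fourierInv_toLp hg.integrable hm
      rw [← hu'] at this
      filter_upwards [this] with x hx
      rw [hx]
    rw [this]
    ring

end BandLimited

/-! ### Scaling -/

section Variational

variable {d : ℕ}

local notation "𝔼" => EuclideanSpace ℝ (Fin d)

theorem mass_const_mul (c : ℂ) (g : 𝔼 → ℂ) : mass (fun ξ => c * g ξ) = ‖c‖ ^ 2 * mass g := by
  simp only [mass, norm_mul, mul_pow]
  exact integral_const_mul _ _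

theorem kinetic_const_mul (s : ℝ) (c : ℂ) (g : 𝔼 → ℂ) :
    kinetic s (fun ξ => c * g ξ) = ‖c‖ ^ 2 * kinetic s g := by
  simp only [kinetic, norm_mul, mul_pow]
  rw [← integral_const_mul]
  congr 1 with ξ
  ring

theorem fourierInv_const_mul (c : ℂ) (g : 𝔼 → ℂ) (x : 𝔼) :
    𝓕⁻ (fun ξ => c * g ξ) x = c * 𝓕⁻ g x := by
  rw [Real.fourierInv_eq, Real.fourierInv_eq, ← integral_const_mul]
  congr 1 with ξ
  simp only [Circle.smul_def, smul_eq_mul]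
  ring

theorem potential_const_mul (p : ℝ) (c : ℂ) (g : 𝔼 → ℂ) :
    potential p (fun ξ => c * g ξ) = ‖c‖ ^ p * potential p g := by
  simp only [potential, fourierInv_const_mul, norm_mul]
  rw [← integral_const_mul]
  congr 1 with x
  exact Real.mul_rpow (norm_nonneg _) (norm_nonneg _)

/-- The `L²`-normalized dilation `û ↦ R^{d/2} û(R ·)`, which maps functions of frequency at most
`R` to functions of frequency at most `1`. -/
def dilate (R : ℝ) (g : 𝔼 → ℂ) (ξ : 𝔼) : ℂ := ((R ^ ((d : ℝ) / 2) : ℝ) : ℂ) * g (R • ξ)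

theorem integral_comp_smul_pos {F : Type*} [NormedAddCommGroup F] [NormedSpace ℝ F]
    (f : 𝔼 → F) {R : ℝ} (hR : 0 < R) :
    ∫ x, f (R • x) = (R ^ (-(d : ℝ))) • ∫ x, f x := by
  rw [Measure.integral_comp_smul, abs_of_nonneg (by positivity), finrank_euclideanSpace_fin,
    Real.rpow_neg hR.le, Real.rpow_natCast]

theorem norm_dilate_sq {R : ℝ} (hR : 0 < R) (g : 𝔼 → ℂ) (ξ : 𝔼) :
    ‖dilate R g ξ‖ ^ 2 = R ^ (d : ℝ) * ‖g (R • ξ)‖ ^ 2 := by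
  rw [dilate, sq_rpow_mul _ _ hR.le]
  congr 2
  ring

theorem mass_dilate {R : ℝ} (hR : 0 < R) (g : 𝔼 → ℂ) : mass (dilate R g) = mass g := by
  simp only [mass, norm_dilate_sq hR]
  rw [integral_const_mul, integral_comp_smul_pos (fun ξ => ‖g ξ‖ ^ 2) hR, smul_eq_mul, ← mul_assoc,
    ← Real.rpow_add hR]
  simp

theorem kinetic_dilate {s R : ℝ} (hR : 0 < R) (g : 𝔼 → ℂ) :
    kinetic s (dilate R g) = R ^ (-(2 * s)) * kinetic s g := by
  simp only [kinetic, norm_dilate_sq hR]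
  have : ∀ ξ : 𝔼, (2 * Real.pi * ‖ξ‖) ^ (2 * s) * (R ^ (d : ℝ) * ‖g (R • ξ)‖ ^ 2) =
      (R ^ (d : ℝ) * R ^ (-(2 * s))) *
        ((2 * Real.pi * ‖R • ξ‖) ^ (2 * s) * ‖g (R • ξ)‖ ^ 2) := fun ξ => by
    rw [norm_smul, Real.norm_of_nonneg hR.le,
      show 2 * Real.pi * (R * ‖ξ‖) = R * (2 * Real.pi * ‖ξ‖) by ring,
      Real.mul_rpow hR.le (by positivity), Real.rpow_neg hR.le]
    field_simp
  simp_rw [this]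
  rw [integral_const_mul,
    integral_comp_smul_pos (fun ξ : 𝔼 => (2 * Real.pi * ‖ξ‖) ^ (2 * s) * ‖g ξ‖ ^ 2) hR,
    smul_eq_mul, ← mul_assoc]
  congr 1
  rw [mul_right_comm, ← Real.rpow_add hR]
  simp

theorem fourierInv_dilate {R : ℝ} (hR : 0 < R) (g : 𝔼 → ℂ) (x : 𝔼) :
    𝓕⁻ (dilate R g) x = ((R ^ (-((d : ℝ) / 2)) : ℝ) : ℂ) * 𝓕⁻ g (R⁻¹ • x) := by
  rw [show dilate R g = fun ξ => ((R ^ ((d : ℝ) / 2) : ℝ) : ℂ) * g (R • ξ) from rfl,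
    fourierInv_const_mul, Real.fourierInv_eq, Real.fourierInv_eq]
  have : ∀ v : 𝔼, (Real.fourierChar (inner ℝ v x)) • g (R • v) =
      (fun w : 𝔼 => (Real.fourierChar (inner ℝ w (R⁻¹ • x))) • g w) (R • v) := fun v => by
    simp only [inner_smul_left, inner_smul_right, RCLike.conj_to_real]
    rw [inv_mul_cancel_left₀ hR.ne']
  simp_rw [this]
  rw [integral_comp_smul_pos (fun w : 𝔼 => (Real.fourierChar (inner ℝ w (R⁻¹ • x))) • g w) hR,
    Complex.real_smul, ← mul_assoc, ← Complex.ofReal_mul,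
    ← Real.rpow_add hR]
  congr 3
  ring

/-- At the critical exponent the potential scales like the kinetic energy. -/
theorem potential_dilate {s p R : ℝ} (hd : 0 < d) (hp : p = 4 * s / d + 2) (hR : 0 < R)
    (g : 𝔼 → ℂ) : potential p (dilate R g) = R ^ (-(2 * s)) * potential p g := by
  have hd' : (d : ℝ) ≠ 0 := by positivity
  have : ∀ x : 𝔼, ‖𝓕⁻ (dilate R g) x‖ ^ p =
      R ^ (-((d : ℝ) / 2) * p) * ‖𝓕⁻ g (R⁻¹ • x)‖ ^ p := fun x => by
    rw [fourierInv_dilate hR, norm_mul, Complex.norm_real, Real.norm_of_nonneg (by positivity),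
      Real.mul_rpow (by positivity) (norm_nonneg _), ← Real.rpow_mul hR.le]
  simp only [potential, this]
  rw [integral_const_mul, integral_comp_smul_pos (fun x : 𝔼 => ‖𝓕⁻ g x‖ ^ p) (inv_pos.mpr hR),
    smul_eq_mul, ← mul_assoc, Real.inv_rpow hR.le, Real.rpow_neg hR.le (d : ℝ), inv_inv,
    ← Real.rpow_add hR]
  congr 2
  rw [hp]
  field_simp
  ring

theorem negHam_dilate {s p R : ℝ} (hd : 0 < d) (hp : p = 4 * s / d + 2) (hR : 0 < R)
    (g : 𝔼 → ℂ) : negHam s p (dilate R g) = R ^ (-(2 * s)) * negHam s p g := by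
  rw [negHam, negHam, potential_dilate hd hp hR, kinetic_dilate hR]
  ring

theorem BandLimited.dilate {R r : ℝ} (hR : 0 < r) {g : 𝔼 → ℂ} (hg : BandLimited R g) :
    BandLimited (R / r) (dilate r g) := by
  refine ⟨?_, fun ξ h => ?_⟩
  · refine MemLp.const_mul ?_ _
    have hq : Measure.QuasiMeasurePreserving (fun ξ : 𝔼 => r • ξ) volume volume := by
      refine ⟨measurable_const_smul r, ?_⟩
      rw [Measure.map_addHaar_smul volume hR.ne']
      exact Measure.smul_absolutelyContinuous
    have hm : AEStronglyMeasurable (fun ξ => g (r • ξ)) volume :=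
      hg.memLp.1.comp_quasiMeasurePreserving hq
    rw [memLp_two_iff_integrable_sq_norm hm]
    exact (memLp_two_integrable_sq hg.memLp).comp_smul hR.ne'
  · rw [FocusingGibbs.dilate, hg.zero, mul_zero]
    rw [norm_smul, Real.norm_of_nonneg hR.le, mul_comm]
    exact (div_lt_iff₀ hR).mp h

/-! ### The variational problem -/

theorem bddBelow_hamiltonian {s p K : ℝ} (hs : 0 ≤ s) (hp : 2 ≤ p) (hK : 0 ≤ K) :
    BddBelow (hamiltonian s p '' {u : SpaceL2 d | ‖u‖ = K ∧ u = ballMultiplier u}) := by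
  refine ⟨-(1 / p * ((Real.sqrt (volume.real (Metric.closedBall (0 : 𝔼) 1)) * K) ^ (p - 2) *
    K ^ 2)), ?_⟩
  rintro _ ⟨u, ⟨hu, hu'⟩, rfl⟩
  obtain ⟨g, hg, hm, hH⟩ := exists_bandLimited_of_eq_ballMultiplier (p := p) hs hu'
  rw [hu] at hm
  rw [hH, negHam, neg_le_neg_iff]
  have h1 := (hg.integrable_potential hp).2
  have h2 := hg.integral_norm_le
  rw [hm, Real.sqrt_sq hK] at h2
  have h3 := kinetic_nonneg s g
  have h4 : (∫ ξ, ‖g ξ‖) ^ (p - 2) ≤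
      (Real.sqrt (volume.real (Metric.closedBall (0 : 𝔼) 1)) * K) ^ (p - 2) :=
    Real.rpow_le_rpow (integral_nonneg fun _ => norm_nonneg _) h2 (by linarith)
  have h5 : potential p g ≤
      (Real.sqrt (volume.real (Metric.closedBall (0 : 𝔼) 1)) * K) ^ (p - 2) * K ^ 2 := by
    refine h1.trans ?_
    rw [hm]
    gcongr
  have : 1 / p * potential p g ≤ _ := mul_le_mul_of_nonneg_left h5 (by positivity)
  linarith

theorem negHam_le_critConst_of_mass_eq {s p K : ℝ} (hs : 0 ≤ s) (hp : 2 ≤ p) (hK : 0 ≤ K)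
    {g : 𝔼 → ℂ} (hg : BandLimited 1 g) (hm : mass g = K ^ 2) :
    negHam s p g ≤ critConst d s p K := by
  obtain ⟨u, hu, hu', hH⟩ := hg.exists_competitor (p := p) hs
  have hu'' : ‖u‖ = K := by
    rw [hm] at hu
    exact (pow_left_inj₀ (norm_nonneg _) hK two_ne_zero).mp hu
  have := csInf_le (bddBelow_hamiltonian (d := d) (s := s) hs hp hK) ⟨u, ⟨hu'', hu'⟩, rfl⟩
  rw [critConst]
  linarith

/-- Near-maximizers exist, because a positive `critConst` cannot be the infimum `0` of the empty
set. -/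
theorem exists_negHam_gt {s p K : ℝ} (hs : 0 ≤ s) (hC : 0 < critConst d s p K)
    {ε : ℝ} (hε : 0 < ε) :
    ∃ g : 𝔼 → ℂ, BandLimited 1 g ∧ mass g = K ^ 2 ∧ critConst d s p K - ε < negHam s p g := by
  have hne : (hamiltonian s p '' {u : SpaceL2 d | ‖u‖ = K ∧ u = ballMultiplier u}).Nonempty := by
    by_contra h
    rw [Set.not_nonempty_iff_eq_empty] at h
    rw [critConst, h] at hC
    simp at hC
  obtain ⟨_, ⟨u, ⟨hu, hu'⟩, rfl⟩, hlt⟩ := Real.lt_sInf_add_pos hne hε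
  obtain ⟨g, hg, hm, hH⟩ := exists_bandLimited_of_eq_ballMultiplier (p := p) hs hu'
  refine ⟨g, hg, by rw [hm, hu], ?_⟩
  rw [critConst]
  linarith

/-- Raising the amplitude of a function of mass at most `K²` to mass exactly `K²` multiplies a
positive value of `negHam` by a factor of at least one. -/
theorem negHam_le_critConst_of_pos {s p K : ℝ} (hs : 0 ≤ s) (hp : 2 < p) (hK : 0 ≤ K)
    {g : 𝔼 → ℂ} (hg : BandLimited 1 g) (hm : mass g ≤ K ^ 2) (hpos : 0 < negHam s p g) :
    negHam s p g ≤ critConst d s p K := by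
  have hm0 : 0 < mass g := by
    refine (mass_nonneg g).lt_of_ne fun h => ?_
    have h1 := (hg.integrable_potential hp.le).2
    rw [← h, mul_zero] at h1
    have h2 := kinetic_nonneg s g
    rw [negHam] at hpos
    have h3 : 1 / p * potential p g ≤ 0 :=
      mul_nonpos_of_nonneg_of_nonpos (by positivity) h1
    linarith
  set l : ℝ := K / Real.sqrt (mass g) with hl
  have hsq : 0 < Real.sqrt (mass g) := Real.sqrt_pos.mpr hm0
  have hl1 : 1 ≤ l := by
    rw [hl, one_le_div hsq]
    exact Real.sqrt_le_iff.mpr ⟨hK, hm⟩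
  have hnl : ‖(l : ℂ)‖ = l := by rw [Complex.norm_real, Real.norm_of_nonneg (by linarith)]
  have h1 := negHam_le_critConst_of_mass_eq (p := p) hs hp.le hK (hg.const_smul l) (by
    rw [mass_const_mul, hnl, hl, div_pow, Real.sq_sqrt hm0.le]
    field_simp)
  refine le_trans ?_ h1
  rw [negHam, negHam, potential_const_mul, kinetic_const_mul, hnl]
  have h2 : l ^ (2 : ℕ) ≤ l ^ p := by
    rw [← Real.rpow_natCast]
    exact Real.rpow_le_rpow_of_exponent_le hl1 (by norm_num; linarith)
  have h3 : 1 ≤ l ^ 2 := one_le_pow₀ hl1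
  rw [negHam] at hpos
  have h4 : 0 ≤ 1 / p * potential p g := mul_nonneg (by positivity) (potential_nonneg p g)
  nlinarith [mul_nonneg (sub_nonneg.mpr h2) h4, mul_nonneg (sub_nonneg.mpr h3) hpos.le]

/-- The variational upper bound at frequency scale `R`. -/
theorem negHam_le {s p K R : ℝ} (hd : 0 < d) (hs : 0 < s) (hp : p = 4 * s / d + 2) (hK : 0 ≤ K)
    (hC : 0 ≤ critConst d s p K) (hR : 0 < R) {g : 𝔼 → ℂ} (hg : BandLimited R g)
    (hm : mass g ≤ K ^ 2) : negHam s p g ≤ R ^ (2 * s) * critConst d s p K := by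
  have hp2 : 2 < p := by
    rw [hp]
    have : (0 : ℝ) < d := by positivity
    have : 0 < 4 * s / d := by positivity
    linarith
  have h1 : negHam s p g = R ^ (2 * s) * negHam s p (dilate R g) := by
    rw [negHam_dilate hd hp hR, ← mul_assoc, ← Real.rpow_add hR]
    simp
  rw [h1]
  refine mul_le_mul_of_nonneg_left ?_ (by positivity)
  by_cases hpos : 0 < negHam s p (dilate R g)
  · exact negHam_le_critConst_of_pos hs.le hp2 hK
      (by simpa [hR.ne'] using hg.dilate hR) (by rwa [mass_dilate hR]) hpos
  · linarith

end Variational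

/-! ### Positivity of the critical constant -/

section Positivity

variable {d : ℕ}

local notation "𝔼" => EuclideanSpace ℝ (Fin d)

/-- The sharp Fourier truncation of `û` to frequencies at most `R`. -/
def truncate (R : ℝ) (u : SpaceL2 d) : 𝔼 → ℂ :=
  (Metric.closedBall (0 : 𝔼) R).indicator ((𝓕 u : SpaceL2 d) : 𝔼 → ℂ)

theorem bandLimited_truncate (R : ℝ) (u : SpaceL2 d) : BandLimited R (truncate R u) :=
  ⟨(Lp.memLp (𝓕 u : SpaceL2 d)).indicator measurableSet_closedBall,
    fun ξ h => Set.indicator_of_notMem (by simpa using h) _⟩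

theorem norm_truncate_le (R : ℝ) (u : SpaceL2 d) (ξ : 𝔼) :
    ‖truncate R u ξ‖ ≤ ‖(𝓕 u : SpaceL2 d) ξ‖ :=
  norm_indicator_le_norm_self _ _

theorem mass_truncate_le (R : ℝ) (u : SpaceL2 d) : mass (truncate R u) ≤ ‖u‖ ^ 2 := by
  rw [← Lp.norm_fourier_eq, norm_sq_eq_integral, mass]
  refine integral_mono (memLp_two_integrable_sq (bandLimited_truncate R u).memLp)
    (memLp_two_integrable_sq (Lp.memLp _)) fun ξ => ?_
  have := norm_truncate_le R u ξ
  simp only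
  gcongr

theorem kinetic_truncate_le {s : ℝ} (hs : 0 ≤ s) (R : ℝ) {u : SpaceL2 d} (hu : MemHs s u) :
    kinetic s (truncate R u) ≤ ‖rieszD s u‖ ^ 2 := by
  rw [norm_rieszD_sq hu, kinetic, kinetic]
  refine integral_mono ((bandLimited_truncate R u).integrable_kinetic hs) ?_ fun ξ => ?_
  · refine (memLp_two_integrable_sq hu).congr (Eventually.of_forall fun ξ => ?_)
    exact sq_rpow_mul _ _ (by positivity) _
  · have := norm_truncate_le R u ξ
    simp only
    gcongr

theorem tendsto_fourierInv_truncate (u : SpaceL2 d) :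
    Tendsto (fun n : ℕ =>
      (𝓕⁻ ((bandLimited_truncate (n + 1) u).memLp.toLp _ : SpaceL2 d) : SpaceL2 d))
      atTop (𝓝 u) := by
  have key : ∀ n : ℕ,
      ‖(𝓕⁻ ((bandLimited_truncate (n + 1) u).memLp.toLp _ : SpaceL2 d) : SpaceL2 d) - u‖ ^ 2 =
        ∫ ξ, ‖truncate (n + 1) u ξ - (𝓕 u : SpaceL2 d) ξ‖ ^ 2 := fun n => by
    rw [← Lp.norm_fourier_eq, sub_eq_add_neg, FourierTransform.fourier_add,
      FourierTransform.fourier_neg, FourierTransform.fourier_fourierInv_eq, ← sub_eq_add_neg,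
      norm_sq_eq_integral]
    refine integral_congr_ae ?_
    filter_upwards [Lp.coeFn_sub ((bandLimited_truncate (n + 1) u).memLp.toLp _) (𝓕 u : SpaceL2 d),
      (bandLimited_truncate (n + 1) u).memLp.coeFn_toLp] with ξ h1 h2
    rw [h1, Pi.sub_apply, h2]
  have h0 : Tendsto (fun n : ℕ => ∫ ξ, ‖truncate (n + 1) u ξ - (𝓕 u : SpaceL2 d) ξ‖ ^ 2) atTop
      (𝓝 (∫ _ : 𝔼, (0 : ℝ))) := by
    refine tendsto_integral_of_dominated_convergence
      (fun ξ => ‖(𝓕 u : SpaceL2 d) ξ‖ ^ 2) (fun n => ?_)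
      (memLp_two_integrable_sq (Lp.memLp _)) (fun n => Eventually.of_forall fun ξ => ?_)
      (Eventually.of_forall fun ξ => ?_)
    · exact (((bandLimited_truncate (n + 1) u).memLp.1.sub
        (Lp.memLp (𝓕 u : SpaceL2 d)).1).norm).pow 2
    · rw [Real.norm_of_nonneg (by positivity)]
      by_cases h : ξ ∈ Metric.closedBall (0 : 𝔼) (n + 1)
      · rw [truncate, Set.indicator_of_mem h]
        simp
      · rw [truncate, Set.indicator_of_notMem h]
        simp
    · obtain ⟨n₀, hn₀⟩ := exists_nat_ge ‖ξ‖
      refine tendsto_const_nhds.congr' ?_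
      filter_upwards [eventually_ge_atTop n₀] with n hn
      have h : ξ ∈ Metric.closedBall (0 : 𝔼) (n + 1) := by
        have : (n₀ : ℝ) ≤ n := by exact_mod_cast hn
        simpa using (hn₀.trans this).trans (by linarith)
      rw [truncate, Set.indicator_of_mem h]
      simp
  rw [tendsto_iff_norm_sub_tendsto_zero]
  have h1 : Tendsto (fun n : ℕ =>
      ‖(𝓕⁻ ((bandLimited_truncate (n + 1) u).memLp.toLp _ : SpaceL2 d) : SpaceL2 d) - u‖ ^ 2) atTop
      (𝓝 0) := by
    simp_rw [key]
    simpa using h0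
  have h2 := h1.sqrt
  simpa using h2

/-- Lower semicontinuity of the `Lᵖ` norm along Fourier truncations. -/
theorem intPow_le_of_potential_truncate_le {p : ℝ} (hp : 2 ≤ p) {u : SpaceL2 d} {M : ℝ}
    (hM : ∀ n : ℕ, potential p (truncate (n + 1) u) ≤ M) : intPow p u ≤ M := by
  have hM0 : 0 ≤ M := (potential_nonneg p _).trans (hM 0)
  by_cases hint : Integrable fun x => ‖u x‖ ^ p
  swap
  -- the Bochner integral of a non-integrable function is `0`
  · rwa [intPow, integral_undef hint]
  have h1 := (tendstoInMeasure_of_tendsto_Lp (tendsto_fourierInv_truncate u)).exists_seq_tendsto_ae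
  obtain ⟨ns, -, hns⟩ := h1
  have h2 : ∀ᵐ x : 𝔼, ∀ n : ℕ,
      (𝓕⁻ ((bandLimited_truncate (n + 1) u).memLp.toLp _ : SpaceL2 d) : SpaceL2 d) x =
        𝓕⁻ (truncate (n + 1) u) x := by
    rw [ae_all_iff]
    exact fun n => coeFn_fourierInv_toLp (bandLimited_truncate (n + 1) u).integrable
      (bandLimited_truncate (n + 1) u).memLp
  have hcont : ∀ n : ℕ, Continuous fun x => ‖𝓕⁻ (truncate (n + 1) u) x‖ ^ p := fun n =>
    (continuous_fourierInv (bandLimited_truncate (n + 1) u).integrable).norm.rpow_const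
      fun x => Or.inr (by linarith)
  have h3 : ENNReal.ofReal (intPow p u) ≤ ENNReal.ofReal M := by
    rw [intPow, ofReal_integral_eq_lintegral_ofReal hint
      (Eventually.of_forall fun x => by positivity)]
    calc ∫⁻ x, ENNReal.ofReal (‖u x‖ ^ p)
        = ∫⁻ x, liminf (fun i => ENNReal.ofReal (‖𝓕⁻ (truncate (ns i + 1) u) x‖ ^ p)) atTop := by
          refine lintegral_congr_ae ?_
          filter_upwards [hns, h2] with x hx hx2
          refine (Tendsto.liminf_eq ?_).symm
          have hx' : Tendsto (fun i => 𝓕⁻ (truncate (ns i + 1) u) x) atTop (𝓝 (u x)) := by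
            refine hx.congr fun i => ?_
            exact hx2 (ns i)
          exact (ENNReal.continuous_ofReal.tendsto _).comp
            (hx'.norm.rpow_const (Or.inr (by linarith)))
      _ ≤ liminf (fun i => ∫⁻ x, ENNReal.ofReal (‖𝓕⁻ (truncate (ns i + 1) u) x‖ ^ p)) atTop :=
          lintegral_liminf_le fun i => (hcont (ns i)).measurable.ennreal_ofReal
      _ ≤ liminf (fun _ : ℕ => ENNReal.ofReal M) atTop := by
          refine liminf_le_liminf (Eventually.of_forall fun i => ?_)
          rw [← ofReal_integral_eq_lintegral_ofReal
            ((bandLimited_truncate (ns i + 1) u).integrable_potential hp).1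
            (Eventually.of_forall fun x => by positivity)]
          exact ENNReal.ofReal_le_ofReal (hM (ns i))
      _ = ENNReal.ofReal M := liminf_const _
  exact (ENNReal.ofReal_le_ofReal_iff hM0).mp h3

/-- Above the mass of the normalized optimizer the Hamiltonian takes negative values: the optimizer
has zero energy, a larger amplitude makes the energy negative, and a Fourier truncation followed by
a dilation puts the frequencies into the unit ball. -/
theorem critConst_pos {s p K : ℝ} (hd : 0 < d) (hs : 0 < s) (hp : p = 4 * s / d + 2)
    {Q : SpaceL2 d} (hQs : MemHs s Q) (hQ0 : Q ≠ 0) (hQn : IsGNSNormalized s p Q) (hK : ‖Q‖ < K) :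
    0 < critConst d s p K := by
  have hp2 : 2 < p := by
    rw [hp]
    have : (0 : ℝ) < d := by positivity
    have : 0 < 4 * s / d := by positivity
    linarith
  have hQpos : 0 < ‖Q‖ := norm_pos_iff.mpr hQ0
  have hK0 : 0 < K := hQpos.trans hK
  obtain ⟨hn1, hn2⟩ := hQn
  rw [← hn1] at hn2
  set l : ℝ := K / ‖Q‖ with hl
  have hl1 : 1 < l := (one_lt_div hQpos).mpr hK
  have hl0 : 0 < l := by linarith
  have hnl : ‖(l : ℂ)‖ = l := by rw [Complex.norm_real, Real.norm_of_nonneg hl0.le]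
  have hP : 0 < intPow p Q := by
    have : 0 < 2 / p * intPow p Q := hn2 ▸ by positivity
    exact (pos_iff_pos_of_mul_pos this).mp (by positivity)
  -- Otherwise `l^p ‖Q‖_p^p ≤ l^2 ‖Q‖_p^p` in the limit of no truncation, although `l > 1`.
  have hex : ∃ n : ℕ, 0 < negHam s p (fun ξ => (l : ℂ) * truncate (n + 1) Q ξ) := by
    by_contra! hcon
    have h1 : ∀ n : ℕ, potential p (truncate (n + 1) Q) ≤ l ^ (2 - p) * intPow p Q := fun n => by
      have h2 := hcon n
      rw [negHam, potential_const_mul, kinetic_const_mul, hnl] at h2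
      have h3 := kinetic_truncate_le hs.le (n + 1) hQs
      rw [← hn1, hn2] at h3
      have h4 : 1 / p * (l ^ p * potential p (truncate (n + 1) Q)) ≤
          1 / p * (l ^ 2 * intPow p Q) := by
        have : 1 / 2 * (l ^ 2 * kinetic s (truncate (n + 1) Q)) ≤
            1 / 2 * (l ^ 2 * (2 / p * intPow p Q)) := by gcongr
        have e : 1 / 2 * (l ^ 2 * (2 / p * intPow p Q)) = 1 / p * (l ^ 2 * intPow p Q) := by ring
        linarith
      have h5 : l ^ p * potential p (truncate (n + 1) Q) ≤ l ^ 2 * intPow p Q :=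
        le_of_mul_le_mul_left h4 (by positivity)
      have h6 : l ^ (2 - p) = l ^ 2 / l ^ p := by
        rw [Real.rpow_sub hl0, Real.rpow_two]
      rw [h6, div_mul_eq_mul_div, le_div_iff₀ (by positivity)]
      linarith
    have h2 := intPow_le_of_potential_truncate_le hp2.le h1
    have h3 : l ^ (2 - p) < 1 := Real.rpow_lt_one_of_one_lt_of_neg hl1 (by linarith)
    nlinarith
  obtain ⟨n, hpos⟩ := hex
  have hn' : (0 : ℝ) < n + 1 := by positivity
  have hg := (bandLimited_truncate (n + 1 : ℝ) Q).const_smul (l : ℂ)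
  have hpos' : 0 < negHam s p (dilate (n + 1 : ℝ) fun ξ => (l : ℂ) * truncate (n + 1) Q ξ) := by
    rw [negHam_dilate hd hp hn']
    positivity
  refine hpos'.trans_le (negHam_le_critConst_of_pos hs.le hp2 hK0.le
    (by simpa [hn'.ne'] using hg.dilate hn') ?_ hpos')
  rw [mass_dilate hn', mass_const_mul, hnl]
  calc l ^ 2 * mass (truncate (n + 1) Q) ≤ l ^ 2 * ‖Q‖ ^ 2 := by
        gcongr
        exact mass_truncate_le _ _
    _ = K ^ 2 := by
        rw [hl]
        field_simp

end Positivity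

/-! ### Trigonometric polynomials on the torus -/

section Torus

variable {d : ℕ}

local notation "𝔼" => EuclideanSpace ℝ (Fin d)
local notation "𝕋" => UnitAddTorus (Fin d)

/-- The integer frequency `n` as a vector of `ℝᵈ`. -/
def freqVec (n : Fin d → ℤ) : 𝔼 := WithLp.toLp 2 fun i => (n i : ℝ)

theorem norm_freqVec (n : Fin d → ℤ) : ‖freqVec n‖ = freqNorm n := by
  simp [EuclideanSpace.norm_eq, freqVec, freqNorm]

/-- The covering map `ℝᵈ → 𝕋ᵈ`. -/
def proj (x : 𝔼) : 𝕋 := fun i => ((x i : ℝ) : UnitAddCircle)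

theorem continuous_proj : Continuous (proj : 𝔼 → 𝕋) :=
  continuous_pi fun i => (AddCircle.continuous_mk' (1 : ℝ)).comp (by fun_prop)

theorem mFourier_proj (n : Fin d → ℤ) (x : 𝔼) :
    UnitAddTorus.mFourier n (proj x) = (Real.fourierChar (inner ℝ (freqVec n) x) : ℂ) := by
  rw [UnitAddTorus.mFourier, ContinuousMap.coe_mk]
  simp only [proj, fourier_coe_apply, Real.fourierChar_apply]
  rw [← Complex.exp_sum]
  congr 1
  rw [PiLp.inner_apply]
  simp only [freqVec, RCLike.inner_apply, conj_trivial]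
  push_cast
  rw [Finset.mul_sum, Finset.sum_mul]
  refine Finset.sum_congr rfl fun i _ => ?_
  simp
  ring

theorem norm_mFourier_apply (n : Fin d → ℤ) (t : 𝕋) : ‖UnitAddTorus.mFourier n t‖ = 1 := by
  rw [UnitAddTorus.mFourier, ContinuousMap.coe_mk, norm_prod]
  exact Finset.prod_eq_one fun i _ => by rw [fourier_apply, Circle.norm_coe]

theorem mFourier_apply_add (n : Fin d → ℤ) (t t' : 𝕋) :
    UnitAddTorus.mFourier n (t + t') =
      UnitAddTorus.mFourier n t * UnitAddTorus.mFourier n t' := by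
  simp only [UnitAddTorus.mFourier, ContinuousMap.coe_mk, ← Finset.prod_mul_distrib]
  refine Finset.prod_congr rfl fun i _ => ?_
  simp [fourier_apply, smul_add, AddCircle.toCircle_add]

/-- The half-open unit cube with lower corner `a`. -/
def cube (a : 𝔼) : Set 𝔼 := {x | ∀ i, x i ∈ Set.Ioc (a i) (a i + 1)}

theorem measurableSet_cube (a : 𝔼) : MeasurableSet (cube a) := by
  have : cube a = ⋂ i, {x : 𝔼 | x i ∈ Set.Ioc (a i) (a i + 1)} := by
    ext x
    simp [cube]
  rw [this]
  refine MeasurableSet.iInter fun i => ?_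
  have hm : Measurable fun x : 𝔼 => x i := by fun_prop
  exact hm measurableSet_Ioc

/-- The integral over the torus is the integral over any unit cube. -/
theorem lintegral_torus (f : 𝕋 → ℝ≥0∞) (a : 𝔼) :
    ∫⁻ t, f t ∂torusMeasure d = ∫⁻ x in cube a, f (proj x) := by
  have h := UnitAddTorus.lintegral_preimage f (WithLp.ofLp a)
  have h2 := (PiLp.volume_preserving_ofLp (Fin d)).setLIntegral_comp_preimage_emb
    (MeasurableEquiv.toLp 2 (Fin d → ℝ)).symm.measurableEmbedding
    (fun x : Fin d → ℝ => f fun i => (x i : UnitAddCircle))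
    {x | ∀ i, x i ∈ Set.Ioc (a i) (a i + 1)}
  exact h.trans h2.symm

theorem volume_cube (a : 𝔼) : volume (cube a) = 1 := by
  have h := lintegral_torus (fun _ => 1) a
  simpa using h.symm

theorem isFiniteMeasure_cube (a : 𝔼) : IsFiniteMeasure (volume.restrict (cube a)) :=
  ⟨by simp [volume_cube]⟩

/-- The trigonometric polynomial `∑ᵢ cᵢ e^{2πi kᵢ·x}`. -/
def trigPoly {ι : Type*} [Fintype ι] (k : ι → Fin d → ℤ) (c : ι → ℂ) : C(𝕋, ℂ) :=
  ∑ i, c i • UnitAddTorus.mFourier (k i)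

variable {ι : Type*} [Fintype ι]

theorem trigPoly_apply (k : ι → Fin d → ℤ) (c : ι → ℂ) (t : 𝕋) :
    trigPoly k c t = ∑ i, c i * UnitAddTorus.mFourier (k i) t := by
  simp [trigPoly, ContinuousMap.sum_apply]

theorem trigPoly_apply_add (k : ι → Fin d → ℤ) (c : ι → ℂ) (t t' : 𝕋) :
    trigPoly k c (t + t') =
      trigPoly k (fun i => c i * UnitAddTorus.mFourier (k i) t') t := by
  rw [trigPoly_apply, trigPoly_apply]
  refine Finset.sum_congr rfl fun i _ => ?_
  rw [mFourier_apply_add]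
  ring

theorem norm_toLp_trigPoly_sq {k : ι → Fin d → ℤ} (hk : Function.Injective k) (c : ι → ℂ) :
    ‖ContinuousMap.toLp (E := ℂ) 2 (torusMeasure d) ℂ (trigPoly k c)‖ ^ 2 = ∑ i, ‖c i‖ ^ 2 := by
  have ho : Orthonormal ℂ fun i => ContinuousMap.toLp (E := ℂ) 2 (torusMeasure d) ℂ
      (UnitAddTorus.mFourier (k i)) :=
    (UnitAddTorus.orthonormal_mFourier (d := Fin d)).comp k hk
  have h : ContinuousMap.toLp (E := ℂ) 2 (torusMeasure d) ℂ (trigPoly k c) =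
      ∑ i, c i • ContinuousMap.toLp (E := ℂ) 2 (torusMeasure d) ℂ
        (UnitAddTorus.mFourier (k i)) := by
    rw [trigPoly, map_sum]
    simp
  rw [h, ← Complex.ofReal_inj]
  push_cast
  have := ho.inner_sum c c Finset.univ
  rw [inner_self_eq_norm_sq_to_K] at this
  refine this.trans (Finset.sum_congr rfl fun i _ => ?_)
  exact Complex.conj_mul' (c i)

theorem eLpNorm_trigPoly {k : ι → Fin d → ℤ} (hk : Function.Injective k) (c : ι → ℂ) :
    eLpNorm (trigPoly k c) 2 (torusMeasure d) = ENNReal.ofReal (Real.sqrt (∑ i, ‖c i‖ ^ 2)) := by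
  rw [← norm_toLp_trigPoly_sq hk, Real.sqrt_sq (norm_nonneg _), Lp.norm_def,
    ENNReal.ofReal_toReal (Lp.eLpNorm_ne_top _)]
  exact (eLpNorm_congr_ae (ContinuousMap.coeFn_toLp _ _)).symm

theorem lintegral_trigPoly_sq {k : ι → Fin d → ℤ} (hk : Function.Injective k) (c : ι → ℂ) :
    ∫⁻ t, ENNReal.ofReal (‖trigPoly k c t‖ ^ 2) ∂torusMeasure d =
      ENNReal.ofReal (∑ i, ‖c i‖ ^ 2) := by
  have h := eLpNorm_trigPoly hk c
  rw [eLpNorm_eq_lintegral_rpow_enorm_toReal two_ne_zero ENNReal.ofNat_ne_top] at h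
  have h2 := congrArg (fun x : ℝ≥0∞ => x ^ (2 : ℝ)) h
  simp only [ENNReal.toReal_ofNat] at h2
  rw [← ENNReal.rpow_mul, ENNReal.ofReal_rpow_of_nonneg (Real.sqrt_nonneg _) (by norm_num),
    Real.rpow_two, Real.sq_sqrt (by positivity)] at h2
  rw [← h2]
  norm_num

end Torus

/-! ### Windows of compact Fourier support -/

section Window

variable {d : ℕ}

local notation "𝔼" => EuclideanSpace ℝ (Fin d)

theorem hasCompactSupport_of_norm_lt {R : ℝ} {g : 𝔼 → ℂ} (hg : ∀ ξ, R < ‖ξ‖ → g ξ = 0) :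
    HasCompactSupport g :=
  HasCompactSupport.intro (isCompact_closedBall (0 : 𝔼) R) fun ξ h => hg ξ (by simpa using h)

theorem bandLimited_of_continuous {R : ℝ} {g : 𝔼 → ℂ} (hc : Continuous g)
    (hg : ∀ ξ, R < ‖ξ‖ → g ξ = 0) : BandLimited R g :=
  ⟨hc.memLp_of_hasCompactSupport (hasCompactSupport_of_norm_lt hg), hg⟩

/-- There are continuous, compactly supported profiles `η` of unit mass such that `|𝓕⁻ η|²` is
concentrated near the origin. -/
theorem exists_concentrated_profile {ρ δ : ℝ} (hρ : 0 < ρ) (hδ : 0 < δ) :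
    ∃ L > 0, ∃ η : 𝔼 → ℂ, Continuous η ∧ (∀ ξ, L < ‖ξ‖ → η ξ = 0) ∧ mass η = 1 ∧
      1 - δ ≤ ∫ y in Metric.ball (0 : 𝔼) ρ, ‖𝓕⁻ η y‖ ^ 2 := by
  -- a normalized tent function, dilated by a large factor
  set η₀ : 𝔼 → ℂ := fun ξ => ((max 0 (1 - ‖ξ‖) : ℝ) : ℂ) with hη₀
  have hc₀ : Continuous η₀ := by fun_prop
  have hb₀ : BandLimited 1 η₀ := bandLimited_of_continuous hc₀ fun ξ h => by
    simp only [hη₀, Complex.ofReal_eq_zero]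
    exact max_eq_left (by linarith)
  have hm₀ : 0 < mass η₀ := by
    refine (integral_pos_iff_support_of_nonneg (fun ξ => by positivity)
      (memLp_two_integrable_sq hb₀.memLp)).mpr ?_
    refine (IsOpen.measure_pos volume (hc₀.norm.pow 2).isOpen_support ⟨0, ?_⟩)
    simp [hη₀]
  set a : ℝ := (Real.sqrt (mass η₀))⁻¹ with ha
  set η₁ : 𝔼 → ℂ := fun ξ => (a : ℂ) * η₀ ξ with hη₁
  have hb₁ : BandLimited 1 η₁ := hb₀.const_smul _
  have hm₁ : mass η₁ = 1 := by
    rw [hη₁, mass_const_mul, Complex.norm_real, Real.norm_of_nonneg (by positivity), ha, inv_pow,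
      Real.sq_sqrt hm₀.le, inv_mul_cancel₀ hm₀.ne']
  have hi : Integrable fun y => ‖𝓕⁻ η₁ y‖ ^ 2 :=
    memLp_two_integrable_sq (memLp_fourierInv hb₁.integrable hb₁.memLp)
  have ht : Tendsto (fun n : ℕ => ∫ y in Metric.ball (0 : 𝔼) n, ‖𝓕⁻ η₁ y‖ ^ 2) atTop (𝓝 1) := by
    have h1 := tendsto_setIntegral_of_monotone (μ := (volume : Measure 𝔼))
      (s := fun n : ℕ => Metric.ball (0 : 𝔼) n) (f := fun y => ‖𝓕⁻ η₁ y‖ ^ 2)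
      (fun n => measurableSet_ball)
      (fun m n h => Metric.ball_subset_ball (by exact_mod_cast h)) hi.integrableOn
    rw [Metric.iUnion_ball_nat, setIntegral_univ, integral_norm_sq_fourierInv hb₁.integrable
      hb₁.memLp] at h1
    exact hm₁ ▸ h1
  obtain ⟨n, hn, hn0⟩ := ((ht.eventually (lt_mem_nhds (show 1 - δ < 1 by linarith))).and
    (eventually_gt_atTop 0)).exists
  have hn0' : (0 : ℝ) < n := by exact_mod_cast hn0
  set L : ℝ := n / ρ with hL
  have hL0 : 0 < L := by positivity
  have hbL : BandLimited L (dilate L⁻¹ η₁) := by simpa using hb₁.dilate (inv_pos.mpr hL0)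
  refine ⟨L, hL0, dilate L⁻¹ η₁, ?_, hbL.zero, ?_, ?_⟩
  · unfold dilate
    fun_prop
  · rw [mass_dilate (inv_pos.mpr hL0), hm₁]
  · have e : ∀ y : 𝔼, (Metric.ball (0 : 𝔼) ρ).indicator
        (fun y => ‖𝓕⁻ (dilate L⁻¹ η₁) y‖ ^ 2) y = L ^ (d : ℝ) *
        (Metric.ball (0 : 𝔼) n).indicator (fun y => ‖𝓕⁻ η₁ y‖ ^ 2) (L • y) := fun y => by
      have hiff : y ∈ Metric.ball (0 : 𝔼) ρ ↔ L • y ∈ Metric.ball (0 : 𝔼) n := by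
        rw [mem_ball_zero_iff, mem_ball_zero_iff, norm_smul, Real.norm_of_nonneg hL0.le, hL,
          div_mul_eq_mul_div, div_lt_iff₀ hρ, mul_lt_mul_iff_right₀ hn0']
      by_cases h : y ∈ Metric.ball (0 : 𝔼) ρ
      · rw [Set.indicator_of_mem h, Set.indicator_of_mem (hiff.mp h),
          fourierInv_dilate (inv_pos.mpr hL0), inv_inv, sq_rpow_mul _ _ (by positivity),
          Real.inv_rpow hL0.le, ← Real.rpow_neg hL0.le]
        congr 2
        ring
      · rw [Set.indicator_of_notMem h, Set.indicator_of_notMem (mt hiff.mpr h), mul_zero]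
    rw [← integral_indicator measurableSet_ball]
    simp_rw [e]
    rw [integral_const_mul, integral_comp_smul_pos _ hL0, smul_eq_mul, ← mul_assoc,
      ← Real.rpow_add hL0, add_neg_cancel, Real.rpow_zero, one_mul,
      integral_indicator measurableSet_ball]
    exact hn.le

/-- The cube `(-1/2, 1/2]ᵈ`. -/
def unitCube (d : ℕ) : Set (EuclideanSpace ℝ (Fin d)) := cube (WithLp.toLp 2 fun _ => -(1 / 2))

theorem measurableSet_unitCube : MeasurableSet (unitCube d) := measurableSet_cube _

/-- The autocorrelation of `η`, whose inverse Fourier transform is `|𝓕⁻ η|²`. -/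
def autocorr (η : 𝔼 → ℂ) : 𝔼 → ℂ :=
  convolution η (fun v => (starRingEnd ℂ) (η (-v))) (ContinuousLinearMap.mul ℂ ℂ) volume

theorem fourierInv_conj_neg (η : 𝔼 → ℂ) (x : 𝔼) :
    𝓕⁻ (fun v => (starRingEnd ℂ) (η (-v))) x = (starRingEnd ℂ) (𝓕⁻ η x) := by
  rw [Real.fourierInv_eq, Real.fourierInv_eq, ← integral_conj,
    ← integral_neg_eq_self (fun v : 𝔼 => (starRingEnd ℂ) (Real.fourierChar (inner ℝ v x) • η v))]
  congr 1 with v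
  simp [Circle.smul_def, inner_neg_left, AddChar.map_neg_eq_inv]

theorem continuous_conj_neg {η : 𝔼 → ℂ} (hc : Continuous η) :
    Continuous fun v => (starRingEnd ℂ) (η (-v)) :=
  Complex.continuous_conj.comp (hc.comp continuous_neg)

theorem fourierInv_autocorr {η : 𝔼 → ℂ} {L : ℝ} (hc : Continuous η)
    (h0 : ∀ ξ, L < ‖ξ‖ → η ξ = 0) (x : 𝔼) :
    𝓕⁻ (autocorr η) x = ((‖𝓕⁻ η x‖ ^ 2 : ℝ) : ℂ) := by
  have hi : Integrable η := (bandLimited_of_continuous hc h0).integrable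
  have hi' : Integrable fun v => (starRingEnd ℂ) (η (-v)) :=
    (bandLimited_of_continuous (R := L) (continuous_conj_neg hc)
      fun ξ h => by rw [h0 (-ξ) (by simpa using h), map_zero]).integrable
  rw [Real.fourierInv_eq_fourier_neg, autocorr, Real.fourier_mul_convolution_eq hi hi',
    ← Real.fourierInv_eq_fourier_neg, ← Real.fourierInv_eq_fourier_neg, fourierInv_conj_neg,
    Complex.mul_conj, Complex.normSq_eq_norm_sq]

theorem continuous_autocorr {η : 𝔼 → ℂ} {L : ℝ} (hc : Continuous η) (h0 : ∀ ξ, L < ‖ξ‖ → η ξ = 0) :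
    Continuous (autocorr η) := by
  refine HasCompactSupport.continuous_convolution_right _
    (hasCompactSupport_of_norm_lt (R := L) fun ξ h => by
      rw [h0 (-ξ) (by simpa using h), map_zero])
    hc.locallyIntegrable (continuous_conj_neg hc)

theorem autocorr_eq_zero {η : 𝔼 → ℂ} {L : ℝ} (h0 : ∀ ξ, L < ‖ξ‖ → η ξ = 0)
    (ξ : 𝔼) (hξ : 2 * L < ‖ξ‖) :
    autocorr η ξ = 0 := by
  by_contra hne
  obtain ⟨a, ha, b, hb, hab⟩ := Set.mem_add.mp
    (support_convolution_subset (ContinuousLinearMap.mul ℂ ℂ) hne)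
  have h1 : ‖a‖ ≤ L := not_lt.mp fun h => ha (h0 a h)
  have h2 : ‖b‖ ≤ L := not_lt.mp fun h => hb (by
    simp only
    rw [h0 (-b) (by simpa using h), map_zero])
  have := norm_add_le a b
  rw [hab] at this
  linarith

/-- The Fourier transform of the smoothed indicator `1_{unitCube} * |𝓕⁻ η|²` of the unit cube. -/
def window (η : 𝔼 → ℂ) (ξ : 𝔼) : ℂ :=
  𝓕 ((unitCube d).indicator fun _ => (1 : ℂ)) ξ * autocorr η ξ

/-- The smoothed indicator `1_{unitCube} * |𝓕⁻ η|²` of the unit cube. -/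
def smoothCube (η : 𝔼 → ℂ) (x : 𝔼) : ℝ := ∫ z in unitCube d, ‖𝓕⁻ η (x - z)‖ ^ 2

theorem integrable_indicator_unitCube :
    Integrable ((unitCube d).indicator fun _ => (1 : ℂ)) := by
  rw [integrable_indicator_iff measurableSet_unitCube]
  have : IsFiniteMeasure (volume.restrict (unitCube d)) := isFiniteMeasure_cube _
  exact integrable_const _

theorem bandLimited_window {η : 𝔼 → ℂ} {L : ℝ} (hc : Continuous η) (h0 : ∀ ξ, L < ‖ξ‖ → η ξ = 0) :
    BandLimited (2 * L) (window η) := by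
  refine bandLimited_of_continuous ?_ fun ξ h => ?_
  · have h : Continuous (𝓕 ((unitCube d).indicator fun _ => (1 : ℂ)) : 𝔼 → ℂ) :=
      VectorFourier.fourierIntegral_continuous Real.continuous_fourierChar
        (innerSL ℝ).continuous₂ integrable_indicator_unitCube
    exact h.mul (continuous_autocorr hc h0)
  · rw [window, autocorr_eq_zero h0 ξ h, mul_zero]

theorem fourierInv_window {η : 𝔼 → ℂ} {L : ℝ} (hc : Continuous η)
    (h0 : ∀ ξ, L < ‖ξ‖ → η ξ = 0) (x : 𝔼) :
    𝓕⁻ (window η) x = (smoothCube η x : ℂ) := by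
  have hi : Integrable (autocorr η) :=
    (bandLimited_of_continuous (continuous_autocorr hc h0) (autocorr_eq_zero h0)).integrable
  have hg : Integrable fun τ => Real.fourierChar (inner ℝ τ x) • autocorr η τ :=
    (bandLimited_of_continuous (R := 2 * L)
      (by
        have := continuous_autocorr hc h0
        have h2 : Continuous fun τ : 𝔼 => Real.fourierChar (inner ℝ τ x) :=
          Real.continuous_fourierChar.comp (by fun_prop)
        exact h2.smul this)
      fun ξ h => by rw [autocorr_eq_zero h0 ξ h, smul_zero]).integrable
  have hflip : (innerₗ 𝔼).flip = innerₗ 𝔼 := by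
    ext a b
    simp
  have h5 := VectorFourier.integral_fourierIntegral_smul_eq_flip (μ := volume) (ν := volume)
    (L := innerₗ 𝔼) (f := (unitCube d).indicator fun _ => (1 : ℂ))
    (g := fun τ => Real.fourierChar (inner ℝ τ x) • autocorr η τ)
    Real.continuous_fourierChar (by
      have : (fun p : 𝔼 × 𝔼 ↦ (innerₗ 𝔼) p.1 p.2) = fun p => inner ℝ p.1 p.2 := by
        ext p; simp
      rw [this]
      fun_prop) integrable_indicator_unitCube hg
  rw [hflip] at h5
  have e1 : 𝓕⁻ (window η) x = ∫ ξ, (VectorFourier.fourierIntegral Real.fourierChar volume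
      (innerₗ 𝔼) ((unitCube d).indicator fun _ => (1 : ℂ)) ξ) •
        (Real.fourierChar (inner ℝ ξ x) • autocorr η ξ) := by
    rw [Real.fourierInv_eq]
    refine integral_congr_ae (Eventually.of_forall fun ξ => ?_)
    simp only [window, Circle.smul_def, smul_eq_mul]
    rw [mul_left_comm]
    rfl
  have e2 : ∀ z, VectorFourier.fourierIntegral Real.fourierChar volume (innerₗ 𝔼)
      (fun τ => Real.fourierChar (inner ℝ τ x) • autocorr η τ) z =
      ((‖𝓕⁻ η (x - z)‖ ^ 2 : ℝ) : ℂ) := fun z => by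
    rw [← fourierInv_autocorr hc h0, Real.fourierInv_eq, VectorFourier.fourierIntegral]
    refine integral_congr_ae (Eventually.of_forall fun ξ => ?_)
    simp only [innerₗ_apply_apply, ← mul_smul, ← AddChar.map_add_eq_mul, inner_sub_right]
    congr 2
    ring
  rw [e1, h5, smoothCube, ← integral_complex_ofReal, ← integral_indicator measurableSet_unitCube]
  refine integral_congr_ae (Eventually.of_forall fun z => ?_)
  simp only [e2]
  by_cases h : z ∈ unitCube d <;> simp [h]

end Window

/-! ### Localizing trigonometric polynomials -/

section WindowSum

variable {d : ℕ}

local notation "𝔼" => EuclideanSpace ℝ (Fin d)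
local notation "𝕋" => UnitAddTorus (Fin d)

theorem smoothCube_nonneg (η : 𝔼 → ℂ) (x : 𝔼) : 0 ≤ smoothCube η x :=
  integral_nonneg fun _ => by positivity

theorem integrable_norm_sq_fourierInv {η : 𝔼 → ℂ} {L : ℝ} (hc : Continuous η)
    (h0 : ∀ ξ, L < ‖ξ‖ → η ξ = 0) : Integrable fun y => ‖𝓕⁻ η y‖ ^ 2 :=
  memLp_two_integrable_sq (memLp_fourierInv (bandLimited_of_continuous hc h0).integrable
    (bandLimited_of_continuous hc h0).memLp)

theorem smoothCube_eq (η : 𝔼 → ℂ) (x : 𝔼) :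
    smoothCube η x = ∫ y, (unitCube d).indicator (fun _ => ‖𝓕⁻ η y‖ ^ 2) (x - y) := by
  rw [smoothCube, ← integral_indicator measurableSet_unitCube,
    ← integral_sub_left_eq_self _ volume x]
  congr 1 with y
  by_cases h : x - y ∈ unitCube d <;> simp [h]

theorem integrable_indicator_sub {η : 𝔼 → ℂ} (hi : Integrable fun y => ‖𝓕⁻ η y‖ ^ 2) (x : 𝔼) :
    Integrable fun y => (unitCube d).indicator (fun _ => ‖𝓕⁻ η y‖ ^ 2) (x - y) := by
  have : (fun y => (unitCube d).indicator (fun _ => ‖𝓕⁻ η y‖ ^ 2) (x - y)) =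
      ((fun y => x - y) ⁻¹' (unitCube d)).indicator fun y => ‖𝓕⁻ η y‖ ^ 2 := rfl
  rw [this]
  exact hi.indicator (measurableSet_unitCube.preimage (measurable_const_sub x))

theorem smoothCube_le_one {η : 𝔼 → ℂ} {L : ℝ} (hc : Continuous η) (h0 : ∀ ξ, L < ‖ξ‖ → η ξ = 0)
    (hm : mass η = 1) (x : 𝔼) : smoothCube η x ≤ 1 := by
  have hi := integrable_norm_sq_fourierInv hc h0
  have hb := bandLimited_of_continuous hc h0
  rw [smoothCube_eq]
  have := integral_norm_sq_fourierInv hb.integrable hb.memLp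
  rw [show ∫ ξ, ‖η ξ‖ ^ 2 = 1 from hm] at this
  rw [← this]
  refine integral_mono (integrable_indicator_sub hi x) hi fun y => ?_
  exact Set.indicator_le_self' (fun _ _ => by positivity) _

/-- The open cube concentric to `unitCube` whose faces are at distance `ρ` from those of
`unitCube`. -/
def innerCube (d : ℕ) (ρ : ℝ) : Set (EuclideanSpace ℝ (Fin d)) :=
  {x | ∀ i, x i ∈ Set.Ioo (-(1 / 2 - ρ)) (1 / 2 - ρ)}

theorem innerCube_eq_preimage (ρ : ℝ) : innerCube d ρ = (WithLp.ofLp : 𝔼 → Fin d → ℝ) ⁻¹'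
    (Set.univ.pi fun _ => Set.Ioo (-(1 / 2 - ρ)) (1 / 2 - ρ)) := by
  ext x
  simp [innerCube]

theorem measurableSet_innerCube (ρ : ℝ) : MeasurableSet (innerCube d ρ) := by
  rw [innerCube_eq_preimage]
  exact (MeasurableSet.univ_pi fun _ => measurableSet_Ioo).preimage (by fun_prop)

theorem volume_innerCube (ρ : ℝ) : volume (innerCube d ρ) = ENNReal.ofReal (1 - 2 * ρ) ^ d := by
  rw [innerCube_eq_preimage, (PiLp.volume_preserving_ofLp (Fin d)).measure_preimage
    (MeasurableSet.univ_pi fun _ => measurableSet_Ioo).nullMeasurableSet, Real.volume_pi_Ioo]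
  simp only [Finset.prod_const, Finset.card_univ, Fintype.card_fin]
  congr 2
  ring

/-- On the inner cube the smoothed indicator is close to one. -/
theorem le_smoothCube {η : 𝔼 → ℂ} {L ρ : ℝ} (hc : Continuous η) (h0 : ∀ ξ, L < ‖ξ‖ → η ξ = 0)
    {x : 𝔼} (hx : x ∈ innerCube d ρ) :
    ∫ y in Metric.ball (0 : 𝔼) ρ, ‖𝓕⁻ η y‖ ^ 2 ≤ smoothCube η x := by
  have hi := integrable_norm_sq_fourierInv hc h0
  rw [smoothCube_eq, ← integral_indicator measurableSet_ball]
  refine integral_mono (hi.indicator measurableSet_ball) (integrable_indicator_sub hi x)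
    fun y => ?_
  by_cases hy : y ∈ Metric.ball (0 : 𝔼) ρ
  · have hmem : x - y ∈ unitCube d := by
      intro i
      have h1 := hx i
      have h2 : |y i| < ρ := (PiLp.norm_apply_le y i).trans_lt (mem_ball_zero_iff.mp hy)
      rw [abs_lt] at h2
      simp only [PiLp.sub_apply, Set.mem_Ioc, Set.mem_Ioo] at *
      constructor <;> linarith [h1.1, h1.2, h2.1, h2.2]
    simp only [Set.indicator_of_mem hy, Set.indicator_of_mem hmem, le_refl]
  · simp only [Set.indicator_of_notMem hy]
    exact Set.indicator_nonneg (fun _ _ => by positivity) _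

/-- The smoothed indicator integrates to one against the translates of a periodic function: it is
an average of indicators of translated unit cubes. -/
theorem lintegral_proj_mul_smoothCube {η : 𝔼 → ℂ} {L : ℝ} (hc : Continuous η)
    (h0 : ∀ ξ, L < ‖ξ‖ → η ξ = 0) (hm : mass η = 1) {f : 𝕋 → ℝ≥0∞} (hf : Measurable f) :
    ∫⁻ x, f (proj x) * ENNReal.ofReal (smoothCube η x) = ∫⁻ t, f t ∂torusMeasure d := by
  have hi := integrable_norm_sq_fourierInv hc h0
  have hb := bandLimited_of_continuous hc h0
  set k : 𝔼 → ℝ≥0∞ := fun y => ENNReal.ofReal (‖𝓕⁻ η y‖ ^ 2) with hk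
  have hkm : Measurable k :=
    ((continuous_fourierInv hb.integrable).norm.pow 2).measurable.ennreal_ofReal
  have hpm : Measurable fun x : 𝔼 => f (proj x) := hf.comp continuous_proj.measurable
  have hs : MeasurableSet {q : 𝔼 × 𝔼 | q.1 - q.2 ∈ unitCube d} :=
    measurableSet_unitCube.preimage (by fun_prop)
  have e1 : ∀ x, f (proj x) * ENNReal.ofReal (smoothCube η x) =
      ∫⁻ y, ({q : 𝔼 × 𝔼 | q.1 - q.2 ∈ unitCube d}.indicator
        (fun q => f (proj q.1) * k q.2)) (x, y) := fun x => by
    rw [smoothCube_eq, ofReal_integral_eq_lintegral_ofReal (integrable_indicator_sub hi x)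
      (Eventually.of_forall fun y => Set.indicator_nonneg (fun _ _ => by positivity) _),
      ← lintegral_const_mul]
    · refine lintegral_congr fun y => ?_
      by_cases h : x - y ∈ unitCube d <;> simp [Set.indicator, h, hk]
    · have hmm : Measurable (((fun y => x - y) ⁻¹' (unitCube d)).indicator
          fun y => ‖𝓕⁻ η y‖ ^ 2) :=
        ((continuous_fourierInv hb.integrable).norm.pow 2).measurable.indicator
          (measurableSet_unitCube.preimage (measurable_const_sub x))
      exact hmm.ennreal_ofReal
  simp_rw [e1]
  rw [lintegral_lintegral_swap]
  · have e2 : ∀ y, ∫⁻ x, ({q : 𝔼 × 𝔼 | q.1 - q.2 ∈ unitCube d}.indicator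
        (fun q => f (proj q.1) * k q.2)) (x, y) = (∫⁻ t, f t ∂torusMeasure d) * k y := fun y => by
      rw [lintegral_torus f (y + WithLp.toLp 2 fun _ => -(1 / 2)),
        ← lintegral_indicator (measurableSet_cube _),
        ← lintegral_mul_const _ (hpm.indicator (measurableSet_cube _))]
      refine lintegral_congr fun x => ?_
      have hiff : x - y ∈ unitCube d ↔ x ∈ cube (y + WithLp.toLp 2 fun _ => -(1 / 2)) := by
        simp only [unitCube, cube, Set.mem_ofPred_eq, Set.mem_Ioc, PiLp.sub_apply, PiLp.add_apply]
        refine forall_congr' fun i => ?_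
        constructor <;> rintro ⟨h1, h2⟩ <;> constructor <;> linarith
      by_cases h : x - y ∈ unitCube d
      · rw [Set.indicator_of_mem (hiff.mp h)]
        exact Set.indicator_of_mem (s := {q : 𝔼 × 𝔼 | q.1 - q.2 ∈ unitCube d}) h _
      · rw [Set.indicator_of_notMem (mt hiff.mpr h), zero_mul]
        exact Set.indicator_of_notMem (s := {q : 𝔼 × 𝔼 | q.1 - q.2 ∈ unitCube d}) h _
    simp_rw [e2]
    rw [lintegral_const_mul _ hkm]
    have : ∫⁻ y, k y = 1 := by
      rw [hk, ← ofReal_integral_eq_lintegral_ofReal hi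
        (Eventually.of_forall fun y => by positivity),
        integral_norm_sq_fourierInv hb.integrable hb.memLp]
      rw [show ∫ ξ, ‖η ξ‖ ^ 2 = 1 from hm, ENNReal.ofReal_one]
    rw [this, mul_one]
  · refine Measurable.aemeasurable ?_
    refine Measurable.indicator ?_ hs
    exact (hpm.comp measurable_fst).mul (hkm.comp measurable_snd)

/-- The Fourier transform `∑ᵢ cᵢ ψ(ξ - kᵢ)` of the product of a trigonometric polynomial with the
function `𝓕⁻ ψ`. -/
def shiftSum {ι : Type*} [Fintype ι] (ψ : 𝔼 → ℂ) (k : ι → Fin d → ℤ) (c : ι → ℂ) (ξ : 𝔼) : ℂ :=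
  ∑ i, c i * ψ (ξ - freqVec (k i))

variable {ι : Type*} [Fintype ι]

theorem bandLimited_shiftSum {R N : ℝ} {ψ : 𝔼 → ℂ} (hψ : BandLimited R ψ) {k : ι → Fin d → ℤ}
    (hk : ∀ i, freqNorm (k i) ≤ N) (c : ι → ℂ) : BandLimited (N + R) (shiftSum ψ k c) := by
  refine ⟨?_, fun ξ h => Finset.sum_eq_zero fun i _ => ?_⟩
  · refine memLp_finsetSum _ fun i _ => MemLp.const_mul ?_ _
    exact hψ.memLp.comp_measurePreserving (measurePreserving_sub_right volume _)
  · rw [hψ.zero, mul_zero]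
    have h1 := hk i
    rw [← norm_freqVec] at h1
    have := norm_sub_norm_le ξ (freqVec (k i))
    linarith

theorem fourierInv_shiftSum {R : ℝ} {ψ : 𝔼 → ℂ} (hψ : BandLimited R ψ) (k : ι → Fin d → ℤ)
    (c : ι → ℂ) (x : 𝔼) :
    𝓕⁻ (shiftSum ψ k c) x = trigPoly k c (proj x) * 𝓕⁻ ψ x := by
  have hint : ∀ i, Integrable fun ξ : 𝔼 =>
      c i * (Real.fourierChar (inner ℝ ξ x) • ψ (ξ - freqVec (k i))) := fun i => by
    refine Integrable.const_mul ?_ _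
    have h1 : Integrable fun ξ => ψ (ξ - freqVec (k i)) := hψ.integrable.comp_sub_right _
    refine (integrable_norm_iff ?_).mp ?_
    · have h2 : Continuous fun τ : 𝔼 => Real.fourierChar (inner ℝ τ x) :=
        Real.continuous_fourierChar.comp (by fun_prop)
      exact h2.aestronglyMeasurable.smul h1.1
    · simpa using h1.norm
  rw [Real.fourierInv_eq, trigPoly_apply, Finset.sum_mul]
  have e : ∀ ξ : 𝔼, Real.fourierChar (inner ℝ ξ x) • shiftSum ψ k c ξ =
      ∑ i, c i * (Real.fourierChar (inner ℝ ξ x) • ψ (ξ - freqVec (k i))) := fun ξ => by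
    simp only [shiftSum, Circle.smul_def, smul_eq_mul, Finset.mul_sum]
    exact Finset.sum_congr rfl fun i _ => by ring
  simp_rw [e]
  rw [integral_finsetSum _ fun i _ => hint i]
  refine Finset.sum_congr rfl fun i _ => ?_
  have e2 := integral_sub_right_eq_self (μ := volume) (fun ξ : 𝔼 =>
    (Real.fourierChar (inner ℝ (freqVec (k i)) x) : ℂ) *
      (Real.fourierChar (inner ℝ ξ x) • ψ ξ)) (freqVec (k i))
  rw [mul_assoc, mFourier_proj, Real.fourierInv_eq]
  refine (integral_const_mul _ _).trans (congrArg _ ?_)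
  refine Eq.trans ?_ (e2.trans (integral_const_mul _ _))
  refine integral_congr_ae (Eventually.of_forall fun ξ => ?_)
  simp only [Circle.smul_def, smul_eq_mul, ← mul_assoc, ← Circle.coe_mul,
    ← AddChar.map_add_eq_mul, inner_sub_left]
  congr 3
  ring

theorem norm_fourierInv_shiftSum_window {η : 𝔼 → ℂ} {L : ℝ} (hc : Continuous η)
    (h0 : ∀ ξ, L < ‖ξ‖ → η ξ = 0) (k : ι → Fin d → ℤ) (c : ι → ℂ) (x : 𝔼) :
    ‖𝓕⁻ (shiftSum (window η) k c) x‖ = ‖trigPoly k c (proj x)‖ * smoothCube η x := by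
  rw [fourierInv_shiftSum (bandLimited_window hc h0), fourierInv_window hc h0, norm_mul,
    Complex.norm_real, Real.norm_of_nonneg (smoothCube_nonneg η x)]

/-- Localizing a trigonometric polynomial by the smoothed indicator does not increase the mass,
because the window takes values in `[0, 1]`. -/
theorem mass_shiftSum_window_le {η : 𝔼 → ℂ} {L : ℝ} (hc : Continuous η)
    (h0 : ∀ ξ, L < ‖ξ‖ → η ξ = 0) (hm : mass η = 1) {k : ι → Fin d → ℤ}
    (hk : Function.Injective k) (c : ι → ℂ) :
    mass (shiftSum (window η) k c) ≤ ∑ i, ‖c i‖ ^ 2 := by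
  obtain ⟨N, hN⟩ : ∃ N, ∀ i, freqNorm (k i) ≤ N :=
    ⟨∑ i, freqNorm (k i), fun i => Finset.single_le_sum (f := fun i => freqNorm (k i))
      (fun j _ => Real.sqrt_nonneg _) (Finset.mem_univ i)⟩
  have hb := bandLimited_shiftSum (bandLimited_window hc h0) hN c
  have hi := memLp_two_integrable_sq (memLp_fourierInv hb.integrable hb.memLp)
  rw [mass, ← integral_norm_sq_fourierInv hb.integrable hb.memLp,
    ← ENNReal.ofReal_le_ofReal_iff (by positivity),
    ofReal_integral_eq_lintegral_ofReal hi (Eventually.of_forall fun y => by positivity),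
    ← lintegral_trigPoly_sq hk, ← lintegral_proj_mul_smoothCube hc h0 hm
      (f := fun t => ENNReal.ofReal (‖trigPoly k c t‖ ^ 2))
      ((map_continuous (trigPoly k c)).norm.pow 2).measurable.ennreal_ofReal]
  refine lintegral_mono fun x => ?_
  simp only
  rw [← ENNReal.ofReal_mul (by positivity), norm_fourierInv_shiftSum_window hc h0, mul_pow]
  refine ENNReal.ofReal_le_ofReal (mul_le_mul_of_nonneg_left ?_ (by positivity))
  have h1 := smoothCube_le_one hc h0 hm x
  have h2 := smoothCube_nonneg η x
  nlinarith

/-- Some translate of a trigonometric polynomial has at least its average share of the `Lᵖ` mass in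
the inner cube, where the window is close to one. -/
theorem exists_translate_potential_ge {η : 𝔼 → ℂ} {L ρ δ p : ℝ} (hp : 2 ≤ p)
    (hδ : δ ≤ 1) (hρ : ρ ≤ 1 / 2) (hc : Continuous η)
    (h0 : ∀ ξ, L < ‖ξ‖ → η ξ = 0)
    (hη : 1 - δ ≤ ∫ y in Metric.ball (0 : 𝔼) ρ, ‖𝓕⁻ η y‖ ^ 2)
    (k : ι → Fin d → ℤ) (c : ι → ℂ) :
    ∃ t' : 𝕋, (1 - δ) ^ p * (1 - 2 * ρ) ^ d * ∫ t, ‖trigPoly k c t‖ ^ p ∂torusMeasure d ≤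
      potential p (shiftSum (window η) k fun i => c i * UnitAddTorus.mFourier (k i) t') := by
  obtain ⟨N, hN⟩ : ∃ N, ∀ i, freqNorm (k i) ≤ N :=
    ⟨∑ i, freqNorm (k i), fun i => Finset.single_le_sum (f := fun i => freqNorm (k i))
      (fun j _ => Real.sqrt_nonneg _) (Finset.mem_univ i)⟩
  have hp0 : 0 ≤ p := by linarith
  have hcont : Continuous fun t => ‖trigPoly k c t‖ ^ p :=
    (map_continuous (trigPoly k c)).norm.rpow_const fun x => Or.inr hp0
  set F : 𝕋 → ℝ≥0∞ := fun t => ENNReal.ofReal (‖trigPoly k c t‖ ^ p) with hF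
  have hFm : Measurable F := hcont.measurable.ennreal_ofReal
  have hFi : ENNReal.ofReal (∫ t, ‖trigPoly k c t‖ ^ p ∂torusMeasure d) =
      ∫⁻ t, F t ∂torusMeasure d :=
    ofReal_integral_eq_lintegral_ofReal
      (hcont.integrable_of_hasCompactSupport (HasCompactSupport.of_compactSpace _))
      (Eventually.of_forall fun y => by positivity)
  -- The mean over all translates `t'` of the mass in the inner cube is its volume times the total.
  have hav : ∫⁻ t', (∫⁻ x in innerCube d ρ, F (proj x + t')) ∂torusMeasure d =
      ENNReal.ofReal (1 - 2 * ρ) ^ d * ∫⁻ t, F t ∂torusMeasure d := by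
    rw [lintegral_lintegral_swap]
    · have : ∀ x : 𝔼, ∫⁻ t', F (proj x + t') ∂torusMeasure d = ∫⁻ t, F t ∂torusMeasure d :=
        fun x => lintegral_add_left_eq_self F (proj x)
      simp_rw [this]
      rw [lintegral_const, Measure.restrict_apply_univ, volume_innerCube, mul_comm]
    · refine (hFm.comp ?_).aemeasurable
      exact (continuous_proj.measurable.comp measurable_snd).add measurable_fst
  obtain ⟨t', ht'⟩ := exists_lintegral_le (μ := torusMeasure d)
    (f := fun t' => ∫⁻ x in innerCube d ρ, F (proj x + t')) (by
      rw [hav, ← hFi]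
      exact ENNReal.mul_ne_top (by simp) ENNReal.ofReal_ne_top)
  refine ⟨t', ?_⟩
  set c' : ι → ℂ := fun i => c i * UnitAddTorus.mFourier (k i) t' with hc'
  have hb := bandLimited_shiftSum (bandLimited_window hc h0) hN c'
  have hi := (hb.integrable_potential hp).1
  rw [hav, ← hFi] at ht'
  rw [← ENNReal.ofReal_le_ofReal_iff (potential_nonneg _ _), potential,
    ofReal_integral_eq_lintegral_ofReal hi (Eventually.of_forall fun y => by positivity), mul_assoc,
    ENNReal.ofReal_mul (by have : 0 ≤ 1 - δ := by linarith
                           positivity),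
    ENNReal.ofReal_mul (pow_nonneg (by linarith) _), ENNReal.ofReal_pow (by linarith)]
  calc ENNReal.ofReal ((1 - δ) ^ p) * (ENNReal.ofReal (1 - 2 * ρ) ^ d *
        ENNReal.ofReal (∫ t, ‖trigPoly k c t‖ ^ p ∂torusMeasure d))
      ≤ ENNReal.ofReal ((1 - δ) ^ p) * ∫⁻ x in innerCube d ρ, F (proj x + t') :=
        mul_le_mul_right ht' _
    _ = ∫⁻ x in innerCube d ρ, ENNReal.ofReal ((1 - δ) ^ p) * F (proj x + t') := by
        rw [lintegral_const_mul]
        exact hFm.comp (continuous_proj.measurable.add_const t')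
    _ ≤ ∫⁻ x in innerCube d ρ,
          ENNReal.ofReal (‖𝓕⁻ (shiftSum (window η) k c') x‖ ^ p) := by
        refine setLIntegral_mono' (measurableSet_innerCube ρ) fun x hx => ?_
        rw [hF, ← ENNReal.ofReal_mul (by
          have : 0 ≤ 1 - δ := by linarith
          positivity), norm_fourierInv_shiftSum_window hc h0, trigPoly_apply_add,
          Real.mul_rpow (norm_nonneg _) (smoothCube_nonneg _ _), mul_comm]
        refine ENNReal.ofReal_le_ofReal (mul_le_mul_of_nonneg_left ?_ (by positivity))
        exact Real.rpow_le_rpow (by linarith) (hη.trans (le_smoothCube hc h0 hx)) hp0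
    _ ≤ ∫⁻ x, ENNReal.ofReal (‖𝓕⁻ (shiftSum (window η) k c') x‖ ^ p) :=
        setLIntegral_le_lintegral _ _

end WindowSum

/-! ### Upper bound for the energy on the torus -/

section UpperBound

variable {d : ℕ}

local notation "𝔼" => EuclideanSpace ℝ (Fin d)

/-- At frequency scale `N` the symbol `(2π|ξ|)ˢ` varies by `o(Nˢ)` over bounded distances. -/
theorem eventually_symbol_sub_le {s R ω : ℝ} (hs : 0 < s) (hω : 0 < ω) :
    ∀ᶠ N : ℕ in atTop, ∀ a b : ℝ, 0 ≤ a → a ≤ N → 0 ≤ b → |b - a| ≤ R →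
      |(2 * Real.pi * b) ^ s - (2 * Real.pi * a) ^ s| ≤ ω * (N : ℝ) ^ s := by
  have hc : Continuous fun t : ℝ => (2 * Real.pi * t) ^ s :=
    (continuous_const.mul continuous_id).rpow_const fun _ => Or.inr hs.le
  have hu := (isCompact_Icc (a := (0 : ℝ)) (b := 2)).uniformContinuousOn_of_continuous
    hc.continuousOn
  obtain ⟨δ, hδ, h⟩ := Metric.uniformContinuousOn_iff.mp hu ω hω
  have ht : Tendsto (fun N : ℕ => R / (N : ℝ)) atTop (𝓝 0) :=
    tendsto_const_nhds.div_atTop tendsto_natCast_atTop_atTop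
  filter_upwards [ht.eventually (gt_mem_nhds hδ), ht.eventually (gt_mem_nhds one_pos),
    eventually_gt_atTop 0] with N h1 h2 hN a b ha0 haN hb0 hab
  have hN' : (0 : ℝ) < N := by exact_mod_cast hN
  have hscale : ∀ t : ℝ, 0 ≤ t → (2 * Real.pi * t) ^ s =
      (N : ℝ) ^ s * (2 * Real.pi * (t / N)) ^ s := fun t ht => by
    rw [← Real.mul_rpow hN'.le (by positivity)]
    congr 1
    field_simp
  have hdist : |b / N - a / N| ≤ R / N := by
    rw [← sub_div, abs_div, abs_of_pos hN']
    gcongr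
  have haN' : a / N ≤ 1 := (div_le_one hN').mpr haN
  have hb2 : b / N ≤ 2 := by
    have := le_abs_self (b / N - a / N)
    linarith
  have := h (b / N) ⟨by positivity, hb2⟩ (a / N) ⟨by positivity, by linarith⟩
    (by rw [Real.dist_eq]; exact hdist.trans_lt h1)
  rw [Real.dist_eq] at this
  rw [hscale a ha0, hscale b hb0, ← mul_sub, abs_mul, abs_of_nonneg (by positivity), mul_comm]
  gcongr

variable {ι : Type*} [Fintype ι]

theorem card_freqVec_near_le {k : ι → Fin d → ℤ} (hk : Function.Injective k) {R : ℝ} (hR : 0 ≤ R)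
    (ξ : 𝔼) :
    ((Finset.univ.filter fun i => ‖ξ - freqVec (k i)‖ ≤ R).card : ℝ) ≤ (2 * R + 1) ^ d := by
  classical
  have h1 : (Finset.univ.filter fun i => ‖ξ - freqVec (k i)‖ ≤ R).card ≤
      (Fintype.piFinset fun j : Fin d => Finset.Icc ⌈ξ j - R⌉ ⌊ξ j + R⌋).card := by
    refine Finset.card_le_card_of_injOn k (fun i hi => ?_) hk.injOn
    rw [Finset.mem_coe, Finset.mem_filter] at hi
    rw [Finset.mem_coe, Fintype.mem_piFinset]
    intro j
    have h2 : |ξ j - k i j| ≤ R := (PiLp.norm_apply_le (ξ - freqVec (k i)) j).trans hi.2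
    rw [abs_le] at h2
    rw [Finset.mem_Icc, Int.ceil_le, Int.le_floor]
    constructor <;> linarith [h2.1, h2.2]
  refine (Nat.cast_le.mpr h1).trans ?_
  rw [Fintype.card_piFinset]
  push_cast
  calc ∏ j : Fin d, ((Finset.Icc ⌈ξ j - R⌉ ⌊ξ j + R⌋).card : ℝ) ≤ ∏ _j : Fin d, (2 * R + 1) := by
        refine Finset.prod_le_prod (fun _ _ => by positivity) fun j _ => ?_
        rw [Int.card_Icc]
        have h3 := Int.floor_le (ξ j + R)
        have h4 := Int.le_ceil (ξ j - R)
        have h5 : (((⌊ξ j + R⌋ + 1 - ⌈ξ j - R⌉).toNat : ℤ) : ℝ) ≤ 2 * R + 1 := by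
          rw [Int.toNat_eq_max]
          push_cast
          exact max_le (by linarith) (by linarith)
        exact_mod_cast h5
    _ = (2 * R + 1) ^ d := by simp

/-- A sum of bump functions centred at distinct integer points is almost orthogonal, because at
most `(2R + 1)ᵈ` of them overlap. -/
theorem integral_sq_sum_le {R : ℝ} {ψ : 𝔼 → ℂ} (hR : 0 ≤ R) (hψ : BandLimited R ψ)
    {k : ι → Fin d → ℤ} (hk : Function.Injective k) (c : ι → ℂ) :
    Integrable (fun ξ => (∑ i, ‖c i‖ * ‖ψ (ξ - freqVec (k i))‖) ^ 2) ∧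
    ∫ ξ, (∑ i, ‖c i‖ * ‖ψ (ξ - freqVec (k i))‖) ^ 2 ≤
      (2 * R + 1) ^ d * mass ψ * ∑ i, ‖c i‖ ^ 2 := by
  classical
  have hmem : ∀ i, MemLp (fun ξ => ψ (ξ - freqVec (k i))) 2 volume := fun i =>
    hψ.memLp.comp_measurePreserving (measurePreserving_sub_right volume _)
  have hint : ∀ i, Integrable fun ξ => ‖c i‖ ^ 2 * ‖ψ (ξ - freqVec (k i))‖ ^ 2 := fun i =>
    (memLp_two_integrable_sq (hmem i)).const_mul _
  have hpt : ∀ ξ, (∑ i, ‖c i‖ * ‖ψ (ξ - freqVec (k i))‖) ^ 2 ≤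
      (2 * R + 1) ^ d * ∑ i, ‖c i‖ ^ 2 * ‖ψ (ξ - freqVec (k i))‖ ^ 2 := fun ξ => by
    set S := Finset.univ.filter fun i => ‖ξ - freqVec (k i)‖ ≤ R with hS
    have e1 : ∑ i, ‖c i‖ * ‖ψ (ξ - freqVec (k i))‖ =
        ∑ i ∈ S, ‖c i‖ * ‖ψ (ξ - freqVec (k i))‖ := by
      refine (Finset.sum_subset (Finset.subset_univ S) fun i _ hi => ?_).symm
      rw [hψ.zero, norm_zero, mul_zero]
      simpa [hS] using hi
    calc (∑ i, ‖c i‖ * ‖ψ (ξ - freqVec (k i))‖) ^ 2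
        ≤ S.card * ∑ i ∈ S, (‖c i‖ * ‖ψ (ξ - freqVec (k i))‖) ^ 2 := by
          rw [e1]
          exact sq_sum_le_card_mul_sum_sq
      _ ≤ (2 * R + 1) ^ d * ∑ i ∈ S, (‖c i‖ * ‖ψ (ξ - freqVec (k i))‖) ^ 2 :=
          mul_le_mul_of_nonneg_right (card_freqVec_near_le hk hR ξ)
            (Finset.sum_nonneg fun _ _ => by positivity)
      _ ≤ (2 * R + 1) ^ d * ∑ i, ‖c i‖ ^ 2 * ‖ψ (ξ - freqVec (k i))‖ ^ 2 := by
          refine mul_le_mul_of_nonneg_left ?_ (by positivity)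
          simp_rw [mul_pow]
          exact Finset.sum_le_sum_of_subset_of_nonneg (Finset.subset_univ S)
            fun _ _ _ => by positivity
  have hint' : Integrable fun ξ => (2 * R + 1) ^ d *
      ∑ i, ‖c i‖ ^ 2 * ‖ψ (ξ - freqVec (k i))‖ ^ 2 :=
    (integrable_finsetSum _ fun i _ => hint i).const_mul _
  have hi0 : Integrable (fun ξ => (∑ i, ‖c i‖ * ‖ψ (ξ - freqVec (k i))‖) ^ 2) := by
    refine hint'.mono' ?_ (Eventually.of_forall fun ξ => ?_)
    · refine AEStronglyMeasurable.pow ?_ 2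
      refine Finset.aestronglyMeasurable_fun_sum _ fun i _ => ?_
      exact (hmem i).1.norm.const_mul _
    · rw [Real.norm_of_nonneg (by positivity)]
      exact hpt ξ
  refine ⟨hi0, (integral_mono hi0 hint' hpt).trans (le_of_eq ?_)⟩
  rw [integral_const_mul, integral_finsetSum _ fun i _ => hint i, mul_assoc]
  congr 1
  rw [Finset.mul_sum]
  refine Finset.sum_congr rfl fun i _ => ?_
  rw [integral_const_mul, mul_comm]
  congr 1
  exact integral_sub_right_eq_self (fun ξ => ‖ψ ξ‖ ^ 2) (freqVec (k i))

theorem add_sq_le_of_pos {τ : ℝ} (hτ : 0 < τ) (a b : ℝ) :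
    (a + b) ^ 2 ≤ (1 + τ) * a ^ 2 + (1 + 1 / τ) * b ^ 2 := by
  have : (1 + τ) * a ^ 2 + (1 + 1 / τ) * b ^ 2 - (a + b) ^ 2 = (τ * a - b) ^ 2 / τ := by
    field_simp
    ring
  have h2 : 0 ≤ (τ * a - b) ^ 2 / τ := by positivity
  linarith

/-- Commutator estimate: localizing a trigonometric polynomial with a band-limited window increases
its kinetic energy only by the oscillation of the symbol over the support of the window's Fourier
transform. -/
theorem kinetic_shiftSum_le {s R ω τ : ℝ} (hs : 0 ≤ s) (hR : 0 ≤ R) (hτ : 0 < τ) {ψ : 𝔼 → ℂ}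
    (hψ : BandLimited R ψ)
    (hmass : ∀ c : ι → ℂ, ∀ k : ι → Fin d → ℤ, Function.Injective k →
      mass (shiftSum ψ k c) ≤ ∑ i, ‖c i‖ ^ 2)
    {k : ι → Fin d → ℤ} (hk : Function.Injective k)
    (hω : ∀ i (ξ : 𝔼), ‖ξ - freqVec (k i)‖ ≤ R →
      |(2 * Real.pi * ‖ξ‖) ^ s - (2 * Real.pi * freqNorm (k i)) ^ s| ≤ ω) (c : ι → ℂ) :
    kinetic s (shiftSum ψ k c) ≤
      (1 + τ) * ∑ i, (2 * Real.pi * freqNorm (k i)) ^ (2 * s) * ‖c i‖ ^ 2 +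
        (1 + 1 / τ) * (ω ^ 2 * ((2 * R + 1) ^ d * mass ψ * ∑ i, ‖c i‖ ^ 2)) := by
  obtain ⟨N, hN⟩ : ∃ N, ∀ i, freqNorm (k i) ≤ N :=
    ⟨∑ i, freqNorm (k i), fun i => Finset.single_le_sum (f := fun i => freqNorm (k i))
      (fun j _ => Real.sqrt_nonneg _) (Finset.mem_univ i)⟩
  have hb := bandLimited_shiftSum hψ hN c
  set m : ι → ℝ := fun i => (2 * Real.pi * freqNorm (k i)) ^ s with hm
  have hfn : ∀ i, 0 ≤ freqNorm (k i) := fun i => Real.sqrt_nonneg _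
  set c' : ι → ℂ := fun i => (m i : ℂ) * c i with hc'
  have hb' := bandLimited_shiftSum hψ hN c'
  obtain ⟨hi2, hle2⟩ := integral_sq_sum_le hR hψ hk c
  have hpt : ∀ ξ, (2 * Real.pi * ‖ξ‖) ^ (2 * s) * ‖shiftSum ψ k c ξ‖ ^ 2 ≤
      (1 + τ) * ‖shiftSum ψ k c' ξ‖ ^ 2 +
        (1 + 1 / τ) * (ω ^ 2 * (∑ i, ‖c i‖ * ‖ψ (ξ - freqVec (k i))‖) ^ 2) := fun ξ => by
    rw [← sq_rpow_mul _ _ (by positivity)]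
    set M : ℝ := (2 * Real.pi * ‖ξ‖) ^ s
    have h1 : ‖(M : ℂ) * shiftSum ψ k c ξ‖ ≤ ‖shiftSum ψ k c' ξ‖ +
        ω * ∑ i, ‖c i‖ * ‖ψ (ξ - freqVec (k i))‖ := by
      have e : (M : ℂ) * shiftSum ψ k c ξ = shiftSum ψ k c' ξ +
          ∑ i, ((M - m i : ℝ) : ℂ) * (c i * ψ (ξ - freqVec (k i))) := by
        simp only [shiftSum, hc', Finset.mul_sum, ← Finset.sum_add_distrib]
        refine Finset.sum_congr rfl fun i _ => ?_
        push_cast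
        ring
      rw [e]
      refine (norm_add_le _ _).trans (add_le_add_right ?_ _)
      rw [Finset.mul_sum]
      refine (norm_sum_le _ _).trans (Finset.sum_le_sum fun i _ => ?_)
      rw [norm_mul, norm_mul, Complex.norm_real, Real.norm_eq_abs]
      by_cases h : ‖ξ - freqVec (k i)‖ ≤ R
      · exact mul_le_mul_of_nonneg_right (hω i ξ h) (by positivity)
      · simp [hψ.zero _ (not_le.mp h)]
    calc ‖(M : ℂ) * shiftSum ψ k c ξ‖ ^ 2
        ≤ (‖shiftSum ψ k c' ξ‖ + ω * ∑ i, ‖c i‖ * ‖ψ (ξ - freqVec (k i))‖) ^ 2 := by gcongr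
      _ ≤ _ := by
        rw [← mul_pow]
        exact add_sq_le_of_pos hτ _ _
  have hia := (memLp_two_integrable_sq hb'.memLp).const_mul (1 + τ)
  have hib := (hi2.const_mul (ω ^ 2)).const_mul (1 + 1 / τ)
  refine (integral_mono (hb.integrable_kinetic hs) (hia.add hib) hpt).trans ?_
  refine (integral_add hia hib).le.trans ?_
  rw [integral_const_mul, integral_const_mul, integral_const_mul]
  have h1 : ∫ ξ, ‖shiftSum ψ k c' ξ‖ ^ 2 ≤
      ∑ i, (2 * Real.pi * freqNorm (k i)) ^ (2 * s) * ‖c i‖ ^ 2 := by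
    refine (hmass c' k hk).trans (le_of_eq (Finset.sum_congr rfl fun i _ => ?_))
    exact sq_rpow_mul _ _ (by have := hfn i; positivity) _
  gcongr

/-- The mean-field functional `(1/p) ∫ |u|ᵖ - ½ ‖u‖²_{Ḣˢ}` of the trigonometric polynomial with
frequencies `k` and coefficients `c`. -/
def torusNegHam (s p : ℝ) (k : ι → Fin d → ℤ) (c : ι → ℂ) : ℝ :=
  1 / p * ∫ t, ‖trigPoly k c t‖ ^ p ∂torusMeasure d -
    1 / 2 * ∑ i, (2 * Real.pi * freqNorm (k i)) ^ (2 * s) * ‖c i‖ ^ 2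

theorem sum_kinetic_le {s N K : ℝ} (hs : 0 ≤ s) (hN0 : 0 ≤ N) {k : ι → Fin d → ℤ}
    (hN : ∀ i, freqNorm (k i) ≤ N) {c : ι → ℂ} (hc : ∑ i, ‖c i‖ ^ 2 ≤ K ^ 2) :
    ∑ i, (2 * Real.pi * freqNorm (k i)) ^ (2 * s) * ‖c i‖ ^ 2 ≤
      (2 * Real.pi) ^ (2 * s) * N ^ (2 * s) * K ^ 2 := by
  calc ∑ i, (2 * Real.pi * freqNorm (k i)) ^ (2 * s) * ‖c i‖ ^ 2
      ≤ ∑ i, (2 * Real.pi * N) ^ (2 * s) * ‖c i‖ ^ 2 := by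
        refine Finset.sum_le_sum fun i _ => ?_
        have h1 := hN i
        have h2 : 0 ≤ freqNorm (k i) := Real.sqrt_nonneg _
        gcongr
    _ = (2 * Real.pi) ^ (2 * s) * N ^ (2 * s) * ∑ i, ‖c i‖ ^ 2 := by
        rw [← Finset.mul_sum, Real.mul_rpow (by positivity) hN0]
    _ ≤ _ := by gcongr

/-- The functional on the torus at frequency scale `N` is asymptotically bounded by the Euclidean
one, uniformly over all trigonometric polynomials of mass at most `K²`. -/
theorem eventually_torusNegHam_le {s p K : ℝ} (hd : 0 < d) (hs : 0 < s) (hp : p = 4 * s / d + 2)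
    (hK : 0 ≤ K) (hC : 0 ≤ critConst d s p K) {ε : ℝ} (hε : 0 < ε) :
    ∀ᶠ N : ℕ in atTop, ∀ (ι : Type) [Fintype ι] (k : ι → Fin d → ℤ) (c : ι → ℂ),
      Function.Injective k → (∀ i, freqNorm (k i) ≤ N) → ∑ i, ‖c i‖ ^ 2 ≤ K ^ 2 →
        torusNegHam s p k c ≤ (critConst d s p K + ε) * (N : ℝ) ^ (2 * s) := by
  have hp2 : 2 ≤ p := by
    rw [hp]
    have : (0 : ℝ) < d := by positivity
    have : 0 < 4 * s / d := by positivity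
    linarith
  set C := critConst d s p K
  set A : ℝ := (2 * Real.pi) ^ (2 * s) * K ^ 2 with hA
  -- The parameter `τ` absorbs the losses of the localization.
  obtain ⟨τ, hτ1, hτ2, hτ⟩ : ∃ τ : ℝ, (1 + τ) * C < C + ε / 8 ∧
      1 / 2 * ((1 + τ) ^ 2 - 1) * A < ε / 4 ∧ 0 < τ := by
    have t1 : Tendsto (fun τ : ℝ => (1 + τ) * C) (𝓝[>] 0) (𝓝 ((1 + 0) * C)) :=
      (Continuous.tendsto (by fun_prop) 0).mono_left nhdsWithin_le_nhds
    have t2 : Tendsto (fun τ : ℝ => 1 / 2 * ((1 + τ) ^ 2 - 1) * A) (𝓝[>] 0)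
        (𝓝 (1 / 2 * ((1 + 0) ^ 2 - 1) * A)) :=
      (Continuous.tendsto (by fun_prop) 0).mono_left nhdsWithin_le_nhds
    exact ((t1.eventually (gt_mem_nhds (by linarith))).and
      ((t2.eventually (gt_mem_nhds (by norm_num; linarith))).and self_mem_nhdsWithin)).exists
  -- The margin `ρ` of the inner cube and the defect of the window cost less than a factor `1 + τ`.
  obtain ⟨ρ, hρ1, hρ2, hρ⟩ : ∃ ρ : ℝ, 1 < (1 + τ) * ((1 - ρ) ^ p * (1 - 2 * ρ) ^ d) ∧
      ρ < 1 / 2 ∧ 0 < ρ := by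
    have t1 : Tendsto (fun ρ : ℝ => (1 + τ) * ((1 - ρ) ^ p * (1 - 2 * ρ) ^ d)) (𝓝[>] 0)
        (𝓝 ((1 + τ) * ((1 - 0) ^ p * (1 - 2 * 0) ^ d))) := by
      refine (Continuous.tendsto ?_ 0).mono_left nhdsWithin_le_nhds
      have : Continuous fun ρ : ℝ => (1 - ρ) ^ p :=
        (continuous_const.sub continuous_id).rpow_const fun _ => Or.inr (by linarith)
      fun_prop
    have t2 : Tendsto (fun ρ : ℝ => ρ) (𝓝[>] 0) (𝓝 0) := nhdsWithin_le_nhds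
    exact ((t1.eventually (lt_mem_nhds (by simp; linarith))).and
      ((t2.eventually (gt_mem_nhds (by norm_num))).and self_mem_nhdsWithin)).exists
  obtain ⟨L, hL, η, hηc, hη0, hηm, hη⟩ := exists_concentrated_profile (d := d) hρ hρ
  have hψ := bandLimited_window hηc hη0
  set ψ := window η with hψdef
  set R : ℝ := 2 * L with hRdef
  have hR : 0 ≤ R := by positivity
  set B : ℝ := (2 * R + 1) ^ d * mass ψ * K ^ 2 with hB
  have hB0 : 0 ≤ B := by
    have := mass_nonneg ψ
    positivity
  -- The window, hence `B`, is now fixed: the oscillation `ω Nˢ` of the symbol is small against it.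
  obtain ⟨ω, hω1, hω⟩ : ∃ ω : ℝ, 1 / 2 * (1 + τ) * ((1 + 1 / τ) * (ω ^ 2 * B)) < ε / 4 ∧ 0 < ω := by
    have t1 : Tendsto (fun ω : ℝ => 1 / 2 * (1 + τ) * ((1 + 1 / τ) * (ω ^ 2 * B))) (𝓝[>] 0)
        (𝓝 (1 / 2 * (1 + τ) * ((1 + 1 / τ) * (0 ^ 2 * B)))) :=
      (Continuous.tendsto (by fun_prop) 0).mono_left nhdsWithin_le_nhds
    exact ((t1.eventually (gt_mem_nhds (by norm_num; exact hε))).and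
      self_mem_nhdsWithin).exists
  -- The localized polynomial has frequencies up to `N + R`, which is harmless as `N → ∞`.
  have hscale : ∀ᶠ N : ℕ in atTop,
      (1 + τ) * C * ((N : ℝ) + R) ^ (2 * s) ≤ (C + ε / 4) * (N : ℝ) ^ (2 * s) := by
    have t1 : Tendsto (fun N : ℕ => (1 + τ) * C * (1 + R / (N : ℝ)) ^ (2 * s)) atTop
        (𝓝 ((1 + τ) * C * (1 + 0) ^ (2 * s))) := by
      refine Tendsto.const_mul _ ?_
      exact (tendsto_const_nhds.add (tendsto_const_nhds.div_atTop
        tendsto_natCast_atTop_atTop)).rpow_const (Or.inr (by positivity))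
    filter_upwards [t1.eventually (gt_mem_nhds (show (1 + τ) * C * (1 + 0) ^ (2 * s) < C + ε / 4 by
        rw [add_zero, Real.one_rpow]; linarith)),
      eventually_gt_atTop 0] with N h1 h2
    have hN : (0 : ℝ) < N := by exact_mod_cast h2
    have e : (N : ℝ) + R = N * (1 + R / N) := by field_simp
    rw [e, Real.mul_rpow hN.le (by positivity), mul_left_comm, mul_comm]
    gcongr
  filter_upwards [eventually_symbol_sub_le (R := R) hs hω, hscale, eventually_gt_atTop 0]
    with N hsym hsc hN0 ι _ k c hk hkN hc
  have hN : (0 : ℝ) < N := by exact_mod_cast hN0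
  obtain ⟨t', ht'⟩ := exists_translate_potential_ge hp2 (by linarith) hρ2.le hηc hη0 hη k c
  set c' : ι → ℂ := fun i => c i * UnitAddTorus.mFourier (k i) t' with hc'
  have hcn : ∀ i, ‖c' i‖ = ‖c i‖ := fun i => by
    rw [hc', norm_mul, norm_mFourier_apply, mul_one]
  have hmass : mass (shiftSum ψ k c') ≤ K ^ 2 := by
    refine (mass_shiftSum_window_le hηc hη0 hηm hk c').trans ?_
    simpa only [hcn] using hc
  have hvar := negHam_le hd hs hp hK hC (by positivity) (bandLimited_shiftSum hψ hkN c') hmass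
  have hkin := kinetic_shiftSum_le (ω := ω * (N : ℝ) ^ s) hs.le hR hτ hψ
    (fun c k hk => mass_shiftSum_window_le hηc hη0 hηm hk c) hk (fun i ξ h => by
      refine hsym _ _ (Real.sqrt_nonneg _) (hkN i) (norm_nonneg _) ?_
      rw [← norm_freqVec]
      exact (abs_norm_sub_norm_le _ _).trans h) c'
  simp only [hcn] at hkin
  set T : ℝ := ∑ i, (2 * Real.pi * freqNorm (k i)) ^ (2 * s) * ‖c i‖ ^ 2 with hT
  set P : ℝ := ∫ t, ‖trigPoly k c t‖ ^ p ∂torusMeasure d with hP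
  have hP0 : 0 ≤ P := integral_nonneg fun _ => by positivity
  have hTA : T ≤ A * (N : ℝ) ^ (2 * s) :=
    (sum_kinetic_le hs.le hN.le hkN hc).trans (le_of_eq (by rw [hA]; ring))
  have hBN : (ω * (N : ℝ) ^ s) ^ 2 * ((2 * R + 1) ^ d * mass ψ * ∑ i, ‖c i‖ ^ 2) ≤
      ω ^ 2 * B * (N : ℝ) ^ (2 * s) := by
    have e : ((N : ℝ) ^ s) ^ 2 = (N : ℝ) ^ (2 * s) := by
      rw [mul_comm 2 s, Real.rpow_mul hN.le, Real.rpow_two]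
    have := mass_nonneg ψ
    calc _ ≤ (ω * (N : ℝ) ^ s) ^ 2 * ((2 * R + 1) ^ d * mass ψ * K ^ 2) := by gcongr
      _ = _ := by
        rw [mul_pow, e, hB]
        ring
  rw [negHam] at hvar
  set X : ℝ := (N : ℝ) ^ (2 * s) with hX
  have hX0 : 0 < X := by positivity
  have h1 : P ≤ (1 + τ) * potential p (shiftSum ψ k c') := by
    calc P ≤ (1 + τ) * ((1 - ρ) ^ p * (1 - 2 * ρ) ^ d) * P := le_mul_of_one_le_left hP0 hρ1.le
      _ = (1 + τ) * ((1 - ρ) ^ p * (1 - 2 * ρ) ^ d * P) := by ring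
      _ ≤ _ := by gcongr
  have h2 : 1 / p * P ≤ (1 + τ) * (1 / p * potential p (shiftSum ψ k c')) := by
    calc 1 / p * P ≤ 1 / p * ((1 + τ) * potential p (shiftSum ψ k c')) := by gcongr
      _ = _ := by ring
  have h3 : 1 / p * potential p (shiftSum ψ k c') ≤ ((N : ℝ) + R) ^ (2 * s) * C +
      1 / 2 * ((1 + τ) * T + (1 + 1 / τ) * (ω ^ 2 * B * X)) := by
    have : (1 + 1 / τ) * ((ω * (N : ℝ) ^ s) ^ 2 *
        ((2 * R + 1) ^ d * mass ψ * ∑ i, ‖c i‖ ^ 2)) ≤ (1 + 1 / τ) * (ω ^ 2 * B * X) := by gcongr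
    linarith
  have h4 : (1 + τ) * (1 / p * potential p (shiftSum ψ k c')) ≤ (1 + τ) *
      (((N : ℝ) + R) ^ (2 * s) * C + 1 / 2 * ((1 + τ) * T + (1 + 1 / τ) * (ω ^ 2 * B * X))) := by
    gcongr
  have h5 : 1 / 2 * ((1 + τ) ^ 2 - 1) * T ≤ ε / 4 * X := by
    have h6 : 0 ≤ 1 / 2 * ((1 + τ) ^ 2 - 1) := by nlinarith
    calc 1 / 2 * ((1 + τ) ^ 2 - 1) * T ≤ 1 / 2 * ((1 + τ) ^ 2 - 1) * (A * X) := by gcongr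
      _ = 1 / 2 * ((1 + τ) ^ 2 - 1) * A * X := by ring
      _ ≤ _ := by gcongr
  have h7 : 1 / 2 * (1 + τ) * ((1 + 1 / τ) * (ω ^ 2 * B)) * X ≤ ε / 4 * X := by gcongr
  have h8 : 0 ≤ ε * X := by positivity
  rw [torusNegHam]
  linarith

end UpperBound

/-! ### Discretizing Euclidean competitors -/

section LowerBound

variable {d : ℕ}

local notation "𝔼" => EuclideanSpace ℝ (Fin d)

/-- The integer point `⌊N ξ⌋`, taken coordinatewise. -/
def cellIndex (N : ℕ) (ξ : 𝔼) : Fin d → ℤ := fun i => ⌊(N : ℝ) * ξ i⌋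

/-- The cell of side `1/N` with lower corner `n/N`. -/
def cell (N : ℕ) (n : Fin d → ℤ) : Set 𝔼 := {ξ | cellIndex N ξ = n}

theorem measurableSet_cell (N : ℕ) (n : Fin d → ℤ) : MeasurableSet (cell (d := d) N n) := by
  have : cell N n = ⋂ i, {ξ : 𝔼 | ⌊(N : ℝ) * ξ i⌋ = n i} := by
    ext ξ
    simp [cell, cellIndex, funext_iff]
  rw [this]
  refine MeasurableSet.iInter fun i => ?_
  have hm : Measurable fun ξ : 𝔼 => ⌊(N : ℝ) * ξ i⌋ := Int.measurable_floor.comp (by fun_prop)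
  exact hm (measurableSet_singleton _)

theorem volume_cell_le {N : ℕ} (hN : 0 < N) (n : Fin d → ℤ) :
    volume (cell (d := d) N n) ≤ ENNReal.ofReal ((N : ℝ) ^ (-(d : ℝ))) := by
  have hN' : (0 : ℝ) < N := by exact_mod_cast hN
  have hsub : cell N n ⊆ (WithLp.ofLp : 𝔼 → Fin d → ℝ) ⁻¹'
      (Set.univ.pi fun i => Set.Ico ((n i : ℝ) / N) (((n i : ℝ) + 1) / N)) := by
    intro ξ hξ i _
    have : ⌊(N : ℝ) * ξ i⌋ = n i := congrFun hξ i
    rw [Int.floor_eq_iff] at this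
    constructor
    · rw [div_le_iff₀ hN']
      linarith [this.1]
    · rw [lt_div_iff₀ hN']
      linarith [this.2]
  refine (measure_mono hsub).trans (le_of_eq ?_)
  rw [(PiLp.volume_preserving_ofLp (Fin d)).measure_preimage
    (MeasurableSet.univ_pi fun _ => measurableSet_Ico).nullMeasurableSet, Real.volume_pi_Ico]
  have : ∀ i, ((n i : ℝ) + 1) / N - (n i : ℝ) / N = (N : ℝ)⁻¹ := fun i => by
    field_simp
    ring
  simp only [this, Finset.prod_const, Finset.card_univ, Fintype.card_fin]
  rw [← ENNReal.ofReal_pow (by positivity), Real.rpow_neg hN'.le, Real.rpow_natCast, inv_pow]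

theorem norm_integral_cell_sq_le {N : ℕ} (hN : 0 < N) {R : ℝ} {g : 𝔼 → ℂ} (hg : BandLimited R g)
    (n : Fin d → ℤ) :
    (N : ℝ) ^ (d : ℝ) * ‖∫ ξ in cell N n, g ξ‖ ^ 2 ≤ ∫ ξ in cell N n, ‖g ξ‖ ^ 2 := by
  have hN' : (0 : ℝ) < N := by exact_mod_cast hN
  have hvol : volume.real (cell (d := d) N n) ≤ (N : ℝ) ^ (-(d : ℝ)) :=
    ENNReal.toReal_le_of_le_ofReal (by positivity) (volume_cell_le hN n)
  have hfin : IsFiniteMeasure (volume.restrict (cell (d := d) N n)) :=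
    ⟨by simpa using (volume_cell_le hN n).trans_lt ENNReal.ofReal_lt_top⟩
  have h2 := integral_mul_le_Lp_mul_Lq_of_nonneg (μ := volume.restrict (cell (d := d) N n))
    (p := 2) (q := 2) Real.HolderConjugate.two_two
    (f := fun _ => (1 : ℝ)) (g := fun ξ => ‖g ξ‖)
    (Eventually.of_forall fun ξ => zero_le_one)
    (Eventually.of_forall fun ξ => norm_nonneg _) (by simpa using memLp_const 1)
    (by simpa using (hg.memLp.restrict (cell N n)).norm)
  simp only [one_mul, one_pow, integral_const, smul_eq_mul, mul_one,
    measureReal_restrict_apply_univ, Real.rpow_two] at h2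
  have hI : 0 ≤ ∫ ξ in cell N n, ‖g ξ‖ ^ 2 := integral_nonneg fun _ => by positivity
  have h3 : ‖∫ ξ in cell N n, g ξ‖ ^ 2 ≤ volume.real (cell (d := d) N n) *
      ∫ ξ in cell N n, ‖g ξ‖ ^ 2 := by
    have h4 : ‖∫ ξ in cell N n, g ξ‖ ≤ volume.real (cell (d := d) N n) ^ (1 / 2 : ℝ) *
        (∫ ξ in cell N n, ‖g ξ‖ ^ 2) ^ (1 / 2 : ℝ) := (norm_integral_le_integral_norm _).trans h2
    rw [← Real.sqrt_eq_rpow, ← Real.sqrt_eq_rpow, ← Real.sqrt_mul measureReal_nonneg] at h4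
    calc _ ≤ (Real.sqrt (volume.real (cell (d := d) N n) * ∫ ξ in cell N n, ‖g ξ‖ ^ 2)) ^ 2 := by
          gcongr
      _ = _ := Real.sq_sqrt (mul_nonneg measureReal_nonneg hI)
  calc _ ≤ (N : ℝ) ^ (d : ℝ) * ((N : ℝ) ^ (-(d : ℝ)) * ∫ ξ in cell N n, ‖g ξ‖ ^ 2) := by
        gcongr
        exact h3.trans (by gcongr)
    _ = _ := by
        rw [← mul_assoc, ← Real.rpow_add hN']
        simp

theorem tendsto_cellIndex (ξ : 𝔼) :
    Tendsto (fun N : ℕ => ((N : ℝ)⁻¹) • freqVec (cellIndex N ξ)) atTop (𝓝 ξ) := by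
  have h1 : Tendsto (fun N : ℕ => fun i => (N : ℝ)⁻¹ * (⌊(N : ℝ) * ξ i⌋ : ℝ)) atTop
      (𝓝 (WithLp.ofLp ξ)) := by
    rw [tendsto_pi_nhds]
    intro i
    have h0 : Tendsto (fun N : ℕ => (N : ℝ)⁻¹) atTop (𝓝 0) := tendsto_inv_atTop_nhds_zero_nat
    rw [tendsto_iff_dist_tendsto_zero]
    refine squeeze_zero' (Eventually.of_forall fun _ => dist_nonneg) ?_ h0
    filter_upwards [eventually_gt_atTop 0] with N hN
    have hN' : (0 : ℝ) < N := by exact_mod_cast hN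
    have e : (N : ℝ)⁻¹ * (⌊(N : ℝ) * ξ i⌋ : ℝ) - ξ i =
        (N : ℝ)⁻¹ * ((⌊(N : ℝ) * ξ i⌋ : ℝ) - N * ξ i) := by field_simp
    rw [Real.dist_eq, e, abs_mul, abs_of_pos (inv_pos.mpr hN')]
    refine mul_le_of_le_one_right (by positivity) ?_
    rw [abs_le]
    constructor <;> linarith [Int.floor_le ((N : ℝ) * ξ i), Int.lt_floor_add_one ((N : ℝ) * ξ i)]
  have h2 := ((PiLp.continuous_toLp 2 (fun _ : Fin d => ℝ)).tendsto (WithLp.ofLp ξ)).comp h1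
  exact h2

variable {ι : Type*} [Fintype ι] {𝕜 : Type*} [RCLike 𝕜]

/-- The function equal to `F(n) h` on the cell of index `n`, for every `n` in the range of `k`, and
to zero on the other cells. -/
def cellSum (N : ℕ) (k : ι → Fin d → ℤ) (F : (Fin d → ℤ) → 𝕜)
    (h : EuclideanSpace ℝ (Fin d) → 𝕜) (ξ : EuclideanSpace ℝ (Fin d)) : 𝕜 :=
  ∑ i, (cell N (k i)).indicator (fun ξ => F (k i) * h ξ) ξ

theorem cellSum_of_mem {N : ℕ} {k : ι → Fin d → ℤ} (hk : Function.Injective k)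
    (F : (Fin d → ℤ) → 𝕜) (h : 𝔼 → 𝕜) {ξ : 𝔼} (hξ : cellIndex N ξ ∈ Set.range k) :
    cellSum N k F h ξ = F (cellIndex N ξ) * h ξ := by
  obtain ⟨i, hi⟩ := hξ
  rw [cellSum, Finset.sum_eq_single i]
  · rw [Set.indicator_of_mem (show ξ ∈ cell N (k i) from hi.symm), hi]
  · intro j _ hj
    refine Set.indicator_of_notMem (fun hmem => hj (hk ?_)) _
    exact (show cellIndex N ξ = k j from hmem).symm.trans hi.symm
  · simp

theorem cellSum_of_notMem {N : ℕ} {k : ι → Fin d → ℤ}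
    (F : (Fin d → ℤ) → 𝕜) (h : 𝔼 → 𝕜) {ξ : 𝔼} (hξ : cellIndex N ξ ∉ Set.range k) :
    cellSum N k F h ξ = 0 :=
  Finset.sum_eq_zero fun i _ => Set.indicator_of_notMem (s := cell N (k i))
    (fun hmem => hξ ⟨i, (show cellIndex N ξ = k i from hmem).symm⟩) _

theorem norm_cellSum_le {N : ℕ} {k : ι → Fin d → ℤ} (hk : Function.Injective k)
    {F : (Fin d → ℤ) → 𝕜} {M : ℝ} (hM : ∀ i, ‖F (k i)‖ ≤ M) (hM0 : 0 ≤ M) (h : 𝔼 → 𝕜) (ξ : 𝔼) :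
    ‖cellSum N k F h ξ‖ ≤ M * ‖h ξ‖ := by
  by_cases hξ : cellIndex N ξ ∈ Set.range k
  · rw [cellSum_of_mem hk F h hξ, norm_mul]
    obtain ⟨i, hi⟩ := hξ
    have := hM i
    rw [hi] at this
    gcongr
  · rw [cellSum_of_notMem F h hξ, norm_zero]
    positivity

theorem integrable_cellSum (N : ℕ) (k : ι → Fin d → ℤ) (F : (Fin d → ℤ) → 𝕜) {h : 𝔼 → 𝕜}
    (hh : Integrable h) : Integrable (cellSum N k F h) :=
  integrable_finsetSum _ fun i _ => (hh.const_mul (F (k i))).indicator (measurableSet_cell N (k i))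

theorem integral_cellSum (N : ℕ) (k : ι → Fin d → ℤ) (F : (Fin d → ℤ) → 𝕜) {h : 𝔼 → 𝕜}
    (hh : Integrable h) :
    ∫ ξ, cellSum N k F h ξ = ∑ i, F (k i) * ∫ ξ in cell N (k i), h ξ := by
  simp only [cellSum]
  rw [integral_finsetSum _ fun i _ =>
    (hh.const_mul (F (k i))).indicator (measurableSet_cell N (k i))]
  refine Finset.sum_congr rfl fun i _ => ?_
  rw [integral_indicator (measurableSet_cell N (k i)), integral_const_mul]

/-- Riemann sums over the cells: if the frequencies `k N` exhaust the nonzero integer points of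
length at most `N`, then cell sums of functions supported in the unit ball converge. -/
theorem tendsto_integral_cellSum {ι : ℕ → Type*} [∀ N, Fintype (ι N)]
    {k : ∀ N, ι N → Fin d → ℤ} (hk : ∀ N, Function.Injective (k N)) (hd : 0 < d)
    (hrange : ∀ (N : ℕ) n, n ≠ 0 → freqNorm n ≤ N → n ∈ Set.range (k N))
    {F : ℕ → (Fin d → ℤ) → 𝕜} {F₀ : 𝔼 → 𝕜} {M : ℝ} (hM0 : 0 ≤ M)
    (hM : ∀ N i, ‖F N (k N i)‖ ≤ M)
    (hF : ∀ ξ, Tendsto (fun N => F N (cellIndex N ξ)) atTop (𝓝 (F₀ ξ)))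
    {h : 𝔼 → 𝕜} (hh : Integrable h) (hsupp : ∀ ξ, 1 < ‖ξ‖ → h ξ = 0) :
    Tendsto (fun N => ∫ ξ, cellSum N (k N) (F N) h ξ) atTop (𝓝 (∫ ξ, F₀ ξ * h ξ)) := by
  have : Nonempty (Fin d) := ⟨⟨0, hd⟩⟩
  refine tendsto_integral_of_dominated_convergence (fun ξ => M * ‖h ξ‖)
    (fun N => (integrable_cellSum N (k N) (F N) hh).1) (hh.norm.const_mul M)
    (fun N => Eventually.of_forall fun ξ => norm_cellSum_le (hk N) (hM N) hM0 h ξ) ?_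
  have h0 : ∀ᵐ ξ : 𝔼, ξ ≠ 0 := by
    rw [ae_iff]
    simp
  have h1 : ∀ᵐ ξ : 𝔼, ξ ∉ Metric.sphere (0 : 𝔼) 1 := by
    exact measure_eq_zero_iff_ae_notMem.mp (Measure.addHaar_sphere volume (0 : 𝔼) 1)
  filter_upwards [h0, h1] with ξ hξ0 hξ1
  by_cases hz : h ξ = 0
  · have : ∀ N, cellSum N (k N) (F N) h ξ = 0 := fun N => by
      have := norm_cellSum_le (N := N) (hk N) (hM N) hM0 h ξ
      rw [hz, norm_zero, mul_zero] at this
      exact norm_le_zero_iff.mp this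
    simp_rw [this, hz, mul_zero]
    exact tendsto_const_nhds
  · have hlt : ‖ξ‖ < 1 := by
      have hle : ‖ξ‖ ≤ 1 := not_lt.mp fun h' => hz (hsupp ξ h')
      exact lt_of_le_of_ne hle fun h' => hξ1 (by simpa using h')
    have hev : ∀ᶠ N : ℕ in atTop, cellIndex N ξ ∈ Set.range (k N) := by
      have hc := tendsto_cellIndex ξ
      filter_upwards [hc.eventually_ne hξ0, hc.norm.eventually (gt_mem_nhds hlt),
        eventually_gt_atTop 0] with N hN1 hN2 hN3
      have hN' : (0 : ℝ) < N := by exact_mod_cast hN3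
      refine hrange N _ (fun hcon => hN1 ?_) ?_
      · rw [hcon]
        ext i
        simp [freqVec]
      · rw [norm_smul, norm_freqVec, Real.norm_of_nonneg (by positivity), inv_mul_lt_iff₀ hN',
          mul_one] at hN2
        exact hN2.le
    refine ((hF ξ).mul_const (h ξ)).congr' ?_
    filter_upwards [hev] with N hN
    exact (cellSum_of_mem (hk N) (F N) h hN).symm

/-- Periodization of a competitor: the trigonometric polynomials whose coefficients are the
normalized integrals of `g` over the cells of side `1/N` recover the value of the Euclidean
functional. The kinetic energy converges by dominated convergence, the potential is lower
semicontinuous by Fatou's lemma. -/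
theorem eventually_exists_le_torusNegHam {ι : ℕ → Type*} [∀ N, Fintype (ι N)]
    {k : ∀ N, ι N → Fin d → ℤ} (hk : ∀ N, Function.Injective (k N)) (hd : 0 < d)
    (hkN : ∀ N i, freqNorm (k N i) ≤ N)
    (hrange : ∀ (N : ℕ) n, n ≠ 0 → freqNorm n ≤ N → n ∈ Set.range (k N))
    {s p : ℝ} (hs : 0 < s) (hp : p = 4 * s / d + 2) {g : 𝔼 → ℂ} (hg : BandLimited 1 g)
    {ε : ℝ} (hε : 0 < ε) :
    ∀ᶠ N : ℕ in atTop, ∃ c : ι N → ℂ, ∑ i, ‖c i‖ ^ 2 ≤ mass g ∧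
      (negHam s p g - ε) * (N : ℝ) ^ (2 * s) ≤ torusNegHam s p (k N) c := by
  have hd' : (0 : ℝ) < d := by positivity
  have hp2 : 2 ≤ p := by
    rw [hp]
    have : 0 < 4 * s / d := by positivity
    linarith
  have hgi := hg.integrable
  have hg2 := memLp_two_integrable_sq hg.memLp
  set b : ∀ N, ι N → ℂ := fun N i => ∫ ξ in cell N (k N i), g ξ with hb
  -- The rescaled polynomial, whose Fourier coefficients are the integrals of `g` over the cells.
  set V : ℕ → 𝔼 → ℂ := fun N y =>
    ∑ i, (Real.fourierChar (inner ℝ ((N : ℝ)⁻¹ • freqVec (k N i)) y) : ℂ) * b N i with hV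
  have hVc : ∀ N, Continuous (V N) := fun N => by
    refine continuous_finsetSum _ fun i _ => Continuous.mul ?_ continuous_const
    exact continuous_induced_dom.comp (Real.continuous_fourierChar.comp (by fun_prop))
  have hVlim : ∀ y, Tendsto (fun N => V N y) atTop (𝓝 (𝓕⁻ g y)) := fun y => by
    have h1 := tendsto_integral_cellSum (𝕜 := ℂ) hk hd hrange
      (F := fun N n => (Real.fourierChar (inner ℝ ((N : ℝ)⁻¹ • freqVec n) y) : ℂ))
      (F₀ := fun ξ => (Real.fourierChar (inner ℝ ξ y) : ℂ)) zero_le_one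
      (fun N i => (Circle.norm_coe _).le) (fun ξ => by
        have hc : Continuous fun ξ : 𝔼 => (Real.fourierChar (inner ℝ ξ y) : ℂ) :=
          continuous_induced_dom.comp (Real.continuous_fourierChar.comp (by fun_prop))
        exact (hc.tendsto ξ).comp (tendsto_cellIndex ξ)) hgi hg.zero
    rw [Real.fourierInv_eq]
    refine h1.congr fun N => ?_
    rw [integral_cellSum N (k N) _ hgi]
  -- Its potential energy density on the torus of side `N`, extended by zero.
  set f : ℕ → 𝔼 → ℝ := fun N y =>
    (unitCube d).indicator (fun _ => ‖V N y‖ ^ p) ((N : ℝ)⁻¹ • y) with hf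
  have hf0 : ∀ N y, 0 ≤ f N y := fun N y => Set.indicator_nonneg (fun _ _ => by positivity) _
  have hfm : ∀ N, Measurable (f N) := fun N => by
    have : f N = ((fun y : 𝔼 => (N : ℝ)⁻¹ • y) ⁻¹' (unitCube d)).indicator
        fun y => ‖V N y‖ ^ p := rfl
    rw [this]
    refine Measurable.indicator ?_
      (measurableSet_unitCube.preimage (measurable_const_smul ((N : ℝ)⁻¹)))
    exact ((hVc N).norm.rpow_const fun _ => Or.inr (by linarith)).measurable
  have hflim : ∀ y, Tendsto (fun N => f N y) atTop (𝓝 (‖𝓕⁻ g y‖ ^ p)) := fun y => by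
    refine ((hVlim y).norm.rpow_const (p := p) (Or.inr (by linarith))).congr' ?_
    have h1 : Tendsto (fun N : ℕ => (N : ℝ)⁻¹ * ‖y‖) atTop (𝓝 (0 * ‖y‖)) :=
      tendsto_inv_atTop_nhds_zero_nat.mul_const _
    rw [zero_mul] at h1
    filter_upwards [h1.eventually (gt_mem_nhds (show (0 : ℝ) < 1 / 2 by norm_num))] with N hN
    have hmem : (N : ℝ)⁻¹ • y ∈ unitCube d := by
      intro i
      have h2 : |((N : ℝ)⁻¹ • y) i| < 1 / 2 := by
        refine (PiLp.norm_apply_le ((N : ℝ)⁻¹ • y) i).trans_lt ?_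
        rwa [norm_smul, Real.norm_of_nonneg (by positivity)]
      rw [abs_lt] at h2
      simp only [Set.mem_Ioc]
      constructor <;> linarith [h2.1, h2.2]
    exact (Set.indicator_of_mem hmem (fun _ => ‖V N y‖ ^ p)).symm
  set c : ∀ N, ι N → ℂ := fun N i => (((N : ℝ) ^ ((d : ℝ) / 2) : ℝ) : ℂ) * b N i with hc
  have hu : ∀ N : ℕ, 0 < N → ∀ x : 𝔼, trigPoly (k N) (c N) (proj x) =
      (((N : ℝ) ^ ((d : ℝ) / 2) : ℝ) : ℂ) * V N ((N : ℝ) • x) := fun N hN x => by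
    have hN' : (N : ℝ) ≠ 0 := by positivity
    rw [trigPoly_apply, hV, Finset.mul_sum]
    refine Finset.sum_congr rfl fun i _ => ?_
    rw [mFourier_proj, inner_smul_left, inner_smul_right, RCLike.conj_to_real,
      inv_mul_cancel_left₀ hN', hc]
    ring
  have hpot : ∀ N : ℕ, 0 < N → Integrable (f N) ∧
      ∫ t, ‖trigPoly (k N) (c N) t‖ ^ p ∂torusMeasure d = (N : ℝ) ^ (2 * s) * ∫ y, f N y := by
    intro N hN
    have hN' : (0 : ℝ) < N := by positivity
    have hcont : Continuous fun t => ‖trigPoly (k N) (c N) t‖ ^ p :=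
      (map_continuous (trigPoly (k N) (c N))).norm.rpow_const fun x => Or.inr (by linarith)
    have hlin : ENNReal.ofReal (∫ t, ‖trigPoly (k N) (c N) t‖ ^ p ∂torusMeasure d) =
        ∫⁻ x in unitCube d, ENNReal.ofReal (‖trigPoly (k N) (c N) (proj x)‖ ^ p) := by
      rw [ofReal_integral_eq_lintegral_ofReal
        (hcont.integrable_of_hasCompactSupport (HasCompactSupport.of_compactSpace _))
        (Eventually.of_forall fun y => by positivity)]
      exact lintegral_torus _ _
    have hfN : ∀ x, (unitCube d).indicator (fun x => ‖trigPoly (k N) (c N) (proj x)‖ ^ p) x =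
        (N : ℝ) ^ ((d : ℝ) / 2 * p) * f N ((N : ℝ) • x) := fun x => by
      rw [hf]
      simp only
      rw [inv_smul_smul₀ hN'.ne']
      by_cases hx : x ∈ unitCube d
      · rw [Set.indicator_of_mem hx, Set.indicator_of_mem hx, hu N hN, norm_mul, Complex.norm_real,
          Real.norm_of_nonneg (by positivity), Real.mul_rpow (by positivity) (norm_nonneg _),
          ← Real.rpow_mul hN'.le]
      · rw [Set.indicator_of_notMem hx, Set.indicator_of_notMem hx, mul_zero]
    have hcube : IsFiniteMeasure (volume.restrict (unitCube d)) := isFiniteMeasure_cube _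
    have hint1 : Integrable ((unitCube d).indicator
        (fun x => ‖trigPoly (k N) (c N) (proj x)‖ ^ p)) := by
      rw [integrable_indicator_iff measurableSet_unitCube]
      obtain ⟨B, hB⟩ := (isCompact_range hcont).isBounded.exists_norm_le
      refine Integrable.of_bound (hcont.comp continuous_proj).aestronglyMeasurable B
        (Eventually.of_forall fun x => ?_)
      exact hB _ ⟨proj x, rfl⟩
    have hint2 : Integrable fun x => f N ((N : ℝ) • x) := by
      have h3 := hint1.const_mul (((N : ℝ) ^ ((d : ℝ) / 2 * p))⁻¹)
      refine h3.congr (Eventually.of_forall fun x => ?_)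
      simp only [hfN]
      rw [inv_mul_cancel_left₀ (by positivity)]
    have hint3 : Integrable (f N) := (integrable_comp_smul_iff volume (f N) hN'.ne').mp hint2
    refine ⟨hint3, ?_⟩
    have hP0 : 0 ≤ ∫ t, ‖trigPoly (k N) (c N) t‖ ^ p ∂torusMeasure d :=
      integral_nonneg fun _ => by positivity
    have h4 : ∫ t, ‖trigPoly (k N) (c N) t‖ ^ p ∂torusMeasure d =
        ∫ x in unitCube d, ‖trigPoly (k N) (c N) (proj x)‖ ^ p := by
      rw [integral_eq_lintegral_of_nonneg_ae (f := fun x => ‖trigPoly (k N) (c N) (proj x)‖ ^ p)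
        (Eventually.of_forall fun y => by positivity)
        (hcont.comp continuous_proj).aestronglyMeasurable, ← hlin, ENNReal.toReal_ofReal hP0]
    rw [h4, ← integral_indicator measurableSet_unitCube]
    simp_rw [hfN]
    rw [integral_const_mul, integral_comp_smul_pos _ hN', smul_eq_mul, ← mul_assoc,
      ← Real.rpow_add hN']
    congr 2
    rw [hp]
    field_simp
    ring
  have hpotlim : ∀ᶠ N : ℕ in atTop, potential p g - ε ≤ ∫ y, f N y := by
    by_cases hcase : potential p g - ε < 0
    · exact Eventually.of_forall fun N => hcase.le.trans (integral_nonneg (hf0 N))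
    have hfatou : ENNReal.ofReal (potential p g) ≤
        liminf (fun N => ∫⁻ y, ENNReal.ofReal (f N y)) atTop := by
      rw [potential, ofReal_integral_eq_lintegral_ofReal (hg.integrable_potential hp2).1
        (Eventually.of_forall fun y => by positivity)]
      refine le_trans (le_of_eq ?_) (lintegral_liminf_le fun N => (hfm N).ennreal_ofReal)
      refine lintegral_congr fun y => ?_
      exact ((ENNReal.continuous_ofReal.tendsto _).comp (hflim y)).liminf_eq.symm
    have hlt : ENNReal.ofReal (potential p g - ε) <
        liminf (fun N => ∫⁻ y, ENNReal.ofReal (f N y)) atTop := by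
      refine lt_of_lt_of_le ?_ hfatou
      exact (ENNReal.ofReal_lt_ofReal_iff (by linarith)).mpr (by linarith)
    filter_upwards [eventually_lt_of_lt_liminf hlt, eventually_gt_atTop 0] with N hN hN0
    rw [← ofReal_integral_eq_lintegral_ofReal (hpot N hN0).1 (Eventually.of_forall (hf0 N))] at hN
    exact ((ENNReal.ofReal_lt_ofReal_iff_of_nonneg (by linarith)).mp hN).le
  have hkinlim : Tendsto (fun N : ℕ => ∫ ξ, cellSum N (k N)
      (fun n => (2 * Real.pi * ‖(N : ℝ)⁻¹ • freqVec n‖) ^ (2 * s)) (fun ξ => ‖g ξ‖ ^ 2) ξ) atTop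
      (𝓝 (kinetic s g)) := by
    refine tendsto_integral_cellSum hk hd hrange (M := (2 * Real.pi) ^ (2 * s)) (by positivity)
      (fun N i => ?_) (fun ξ => ?_) hg2 (fun ξ h => by simp [hg.zero ξ h])
    · rw [Real.norm_of_nonneg (by positivity), norm_smul, norm_freqVec,
        Real.norm_of_nonneg (by positivity)]
      refine Real.rpow_le_rpow (by have : 0 ≤ freqNorm (k N i) := Real.sqrt_nonneg _
                                   positivity) ?_ (by linarith)
      refine mul_le_of_le_one_right (by positivity) ?_
      rcases Nat.eq_zero_or_pos N with h | h
      · simp [h]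
      · have hN' : (0 : ℝ) < N := by exact_mod_cast h
        rw [inv_mul_le_iff₀ hN', mul_one]
        exact hkN N i
    · exact ((tendsto_cellIndex ξ).norm.const_mul (2 * Real.pi)).rpow_const
        (Or.inr (by linarith))
  filter_upwards [hpotlim, hkinlim.eventually (gt_mem_nhds (show kinetic s g < kinetic s g + ε by
    linarith)), eventually_gt_atTop 0] with N hN1 hN2 hN0
  have hN' : (0 : ℝ) < N := by exact_mod_cast hN0
  have hcsq : ∀ i, ‖c N i‖ ^ 2 ≤ ∫ ξ in cell N (k N i), ‖g ξ‖ ^ 2 := fun i => by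
    refine le_trans (le_of_eq ?_) (norm_integral_cell_sq_le hN0 hg (k N i))
    rw [hc]
    simp only
    rw [sq_rpow_mul _ _ hN'.le]
    congr 2
    ring
  refine ⟨c N, ?_, ?_⟩
  · refine (Finset.sum_le_sum fun i _ => hcsq i).trans ?_
    have h1 := integral_cellSum N (k N) (fun _ => (1 : ℝ)) hg2
    simp only [one_mul] at h1
    rw [← h1, mass]
    refine integral_mono (integrable_cellSum N (k N) _ hg2) hg2 fun ξ => ?_
    have h2 := norm_cellSum_le (N := N) (hk N) (F := fun _ => (1 : ℝ)) (M := 1) (by simp)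
      zero_le_one (fun ξ => ‖g ξ‖ ^ 2) ξ
    rw [one_mul, Real.norm_of_nonneg (by positivity : (0 : ℝ) ≤ ‖g ξ‖ ^ 2)] at h2
    exact (le_abs_self _).trans h2
  · have hkin : ∑ i, (2 * Real.pi * freqNorm (k N i)) ^ (2 * s) * ‖c N i‖ ^ 2 ≤
        (N : ℝ) ^ (2 * s) * (kinetic s g + ε) := by
      rw [integral_cellSum N (k N) _ hg2] at hN2
      refine le_trans ?_ (mul_le_mul_of_nonneg_left hN2.le (by positivity))
      rw [Finset.mul_sum]
      refine Finset.sum_le_sum fun i _ => ?_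
      have hfn : 0 ≤ freqNorm (k N i) := Real.sqrt_nonneg _
      rw [← mul_assoc, norm_smul, norm_freqVec, Real.norm_of_nonneg (by positivity),
        ← Real.mul_rpow hN'.le (by positivity)]
      have e : (N : ℝ) * (2 * Real.pi * ((N : ℝ)⁻¹ * freqNorm (k N i))) =
          2 * Real.pi * freqNorm (k N i) := by field_simp
      rw [e]
      exact mul_le_mul_of_nonneg_left (hcsq i) (by positivity)
    rw [torusNegHam, (hpot N hN0).2, negHam]
    have hX : 0 < (N : ℝ) ^ (2 * s) := by positivity
    have hpp : 1 / p ≤ 1 / 2 := by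
      rw [one_div_le_one_div (by linarith) (by norm_num)]
      exact hp2
    have h1 : 1 / p * (potential p g - ε) ≤ 1 / p * ∫ y, f N y :=
      mul_le_mul_of_nonneg_left hN1 (by positivity)
    have h2 : 1 / p * ε ≤ 1 / 2 * ε := by gcongr
    have h3 : (1 / p * potential p g - 1 / 2 * kinetic s g - ε) ≤
        1 / p * (∫ y, f N y) - 1 / 2 * (kinetic s g + ε) := by linarith
    calc _ ≤ (1 / p * (∫ y, f N y) - 1 / 2 * (kinetic s g + ε)) * (N : ℝ) ^ (2 * s) := by gcongr
      _ ≤ _ := by linarith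

end LowerBound

/-! ### Fourier coefficients of the Gaussian field -/

section Field

variable {d : ℕ}
local notation "𝔼" => EuclideanSpace ℝ (Fin d)

theorem one_le_freqNorm {n : Fin d → ℤ} (hn : n ≠ 0) : 1 ≤ freqNorm n := by
  obtain ⟨i, hi⟩ := Function.ne_iff.mp hn
  have h1 : (1 : ℝ) ≤ (n i : ℝ) ^ 2 := by
    have : (1 : ℤ) ≤ n i ^ 2 := Int.one_le_abs hi |> fun h => by nlinarith [sq_abs (n i)]
    exact_mod_cast this
  refine Real.one_le_sqrt.mpr (h1.trans ?_)
  exact Finset.single_le_sum (f := fun i => (n i : ℝ) ^ 2) (fun j _ => sq_nonneg _)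
    (Finset.mem_univ i)

/-- The series `∑ₙ |n|^r` over `ℤᵈ` converges for `r < -d`. -/
theorem summable_freqNorm_rpow {r : ℝ} (hr : r < -d) :
    Summable fun n : Fin d → ℤ => freqNorm n ^ r := by
  let b : Module.Basis (Fin d) ℝ 𝔼 := (EuclideanSpace.basisFun (Fin d) ℝ).toBasis
  let L : Submodule ℤ 𝔼 := Submodule.span ℤ (Set.range b)
  have hrank : Module.finrank ℤ L = d := by
    rw [ZLattice.rank ℝ L]
    simp
  have h := ZLattice.summable_norm_rpow L r (by rw [hrank]; exact hr)
  have hmem : ∀ n : Fin d → ℤ, freqVec n ∈ L := by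
    intro n
    have : freqVec n = ∑ i, n i • b i := by
      ext j
      simp [freqVec, b, Finset.sum_apply, Pi.single_apply]
    rw [this]
    exact Submodule.sum_mem _ fun i _ => Submodule.smul_mem _ _ (Submodule.subset_span ⟨i, rfl⟩)
  have hinj : Function.Injective fun n : Fin d → ℤ => (⟨freqVec n, hmem n⟩ : L) := by
    intro n m hnm
    have h2 : freqVec n = freqVec m := congrArg Subtype.val hnm
    funext i
    have h3 := congrArg (fun v : 𝔼 => v i) h2
    simpa [freqVec] using h3
  have h4 := h.comp_injective hinj
  refine h4.congr fun n => ?_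
  simp [← norm_freqVec]

theorem lintegral_sq_gaussianReal (v : ℝ≥0) :
    ∫⁻ x, ENNReal.ofReal (x ^ 2) ∂gaussianReal 0 v = v := by
  have h1 : Integrable (fun x : ℝ => x ^ 2) (gaussianReal 0 v) :=
    (memLp_id_gaussianReal (μ := 0) (v := v) 2).integrable_sq
  rw [← ofReal_integral_eq_lintegral_ofReal h1 (ae_of_all _ fun x => sq_nonneg x)]
  have h2 := variance_of_integral_eq_zero (μ := gaussianReal 0 v) (X := id) aemeasurable_id
    (by simp)
  rw [variance_id_gaussianReal] at h2
  simp only [id] at h2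
  rw [← h2]
  simp

theorem lintegral_sq_coeffLaw (s : ℝ) (n : NonzeroFreq d) :
    ∫⁻ z, ENNReal.ofReal (‖z‖ ^ 2) ∂coeffLaw s n =
      2 * ENNReal.ofReal ((2 * Real.pi * freqNorm n.1) ^ (-(2 * s))) := by
  rw [coeffLaw, lintegral_map (by fun_prop) Complex.measurableEquivRealProd.symm.measurable]
  have h : ∀ x : ℝ × ℝ, ENNReal.ofReal (‖Complex.measurableEquivRealProd.symm x‖ ^ 2) =
      ENNReal.ofReal (x.1 ^ 2) * 1 + 1 * ENNReal.ofReal (x.2 ^ 2) := by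
    intro x
    rw [mul_one, one_mul, ← ENNReal.ofReal_add (sq_nonneg _) (sq_nonneg _),
      ← Complex.normSq_eq_norm_sq, Complex.normSq_apply]
    congr 1
    simp [Complex.measurableEquivRealProd_symm_apply]
    ring
  simp_rw [h]
  rw [lintegral_add_left (by fun_prop),
    lintegral_prod_mul (f := fun x : ℝ => ENNReal.ofReal (x ^ 2)) (g := fun _ => 1)
      (by fun_prop) (by fun_prop),
    lintegral_prod_mul (f := fun _ => 1) (g := fun x : ℝ => ENNReal.ofReal (x ^ 2))
      (by fun_prop) (by fun_prop)]
  simp only [lintegral_sq_gaussianReal]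
  simp [two_mul, ENNReal.ofReal]

/-- The Fourier coefficients are almost surely square-summable, as their expected square sum is
finite for `s > d/2`. -/
theorem ae_summable_sq {s : ℝ} (hs : (d : ℝ) / 2 < s) :
    ∀ᵐ c ∂Measure.infinitePi fun n : NonzeroFreq d => coeffLaw s n,
      Summable fun n => ‖c n‖ ^ 2 := by
  have h1 : ∫⁻ c, ∑' n : NonzeroFreq d, ENNReal.ofReal (‖c n‖ ^ 2)
      ∂(Measure.infinitePi fun n : NonzeroFreq d => coeffLaw s n) ≠ ∞ := by
    rw [lintegral_tsum fun n => Measurable.aemeasurable (by fun_prop)]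
    have h2 : ∀ n : NonzeroFreq d, ∫⁻ c, ENNReal.ofReal (‖c n‖ ^ 2)
        ∂(Measure.infinitePi fun n : NonzeroFreq d => coeffLaw s n) =
        ENNReal.ofReal (2 * (2 * Real.pi) ^ (-(2 * s)) * freqNorm n.1 ^ (-(2 * s))) := by
      intro n
      have h3 := (measurePreserving_eval_infinitePi
        (fun n : NonzeroFreq d => coeffLaw s n) n).lintegral_comp
        (f := fun z : ℂ => ENNReal.ofReal (‖z‖ ^ 2)) (by fun_prop)
      refine h3.trans ?_
      rw [lintegral_sq_coeffLaw,
        Real.mul_rpow (y := freqNorm n.1) (by positivity) (Real.sqrt_nonneg _), mul_assoc,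
        ENNReal.ofReal_mul (p := 2) zero_le_two]
      simp
    simp_rw [h2]
    have h4 : Summable fun n : NonzeroFreq d =>
        2 * (2 * Real.pi) ^ (-(2 * s)) * freqNorm n.1 ^ (-(2 * s)) :=
      ((summable_freqNorm_rpow (d := d) (r := -(2 * s)) (by linarith)).comp_injective
        Subtype.val_injective).mul_left _
    exact h4.tsum_ofReal_ne_top
  have hmeas : Measurable fun c : NonzeroFreq d → ℂ => ∑' n, ENNReal.ofReal (‖c n‖ ^ 2) :=
    Measurable.tsum fun n => by fun_prop
  filter_upwards [ae_lt_top hmeas h1] with c hc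
  have h5 := ENNReal.summable_toReal hc.ne
  refine h5.congr fun n => ?_
  rw [ENNReal.toReal_ofReal (sq_nonneg _)]

/-- Outside the zero frequency, the Fourier coefficients of a square-summable series are the given
ones; the coefficient at `0` vanishes. -/
theorem mFourierCoeff_fourierSeries {c : NonzeroFreq d → ℂ} (hc : Summable fun n => ‖c n‖ ^ 2)
    (n : Fin d → ℤ) :
    UnitAddTorus.mFourierCoeff (fourierSeries c) n = if h : n ≠ 0 then c ⟨n, h⟩ else 0 := by
  have ho : Orthonormal ℂ fun n : NonzeroFreq d =>
      UnitAddTorus.mFourierLp (d := Fin d) 2 n.1 :=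
    (UnitAddTorus.orthonormal_mFourier (d := Fin d)).comp _ Subtype.val_injective
  have hsum : Summable fun n : NonzeroFreq d =>
      c n • UnitAddTorus.mFourierLp (d := Fin d) 2 n.1 := by
    have := ho.orthogonalFamily.summable_iff_norm_sq_summable c
    exact this.mpr hc
  have hs : HasSum (fun n : NonzeroFreq d => c n • UnitAddTorus.mFourierLp (d := Fin d) 2 n.1)
    (fourierSeries c) := hsum.hasSum
  rw [← UnitAddTorus.mFourierBasis_repr, HilbertBasis.repr_apply_apply]
  have h2 := hs.mapL (innerSL ℂ (UnitAddTorus.mFourierBasis (d := Fin d) n))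
  have h3 := h2.tsum_eq
  simp only [innerSL_apply_apply] at h3
  refine h3.symm.trans ?_
  have h4 : ∀ m : NonzeroFreq d, inner ℂ (UnitAddTorus.mFourierBasis (d := Fin d) n)
      (c m • UnitAddTorus.mFourierLp (d := Fin d) 2 m.1) = if n = m.1 then c m else 0 := by
    intro m
    rw [inner_smul_right, UnitAddTorus.coe_mFourierBasis,
      orthonormal_iff_ite.mp UnitAddTorus.orthonormal_mFourier]
    simp
  simp_rw [h4]
  split_ifs with h
  · rw [tsum_eq_single ⟨n, h⟩]
    · simp
    · intro m hm
      rw [if_neg]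
      rintro rfl
      exact hm rfl
  · push Not at h
    subst h
    convert tsum_zero with m
    exact if_neg m.2.symm

end Field

/-! ### Reduction to a finite-dimensional Gaussian integral -/

section Density

variable {d : ℕ}
local notation "𝕋" => UnitAddTorus (Fin d)

/-- A finite product of measures with integrable densities has the product density. -/
theorem pi_withDensity_ofReal {ι : Type*} [Fintype ι] {g : ι → ℂ → ℝ} (hg0 : ∀ i z, 0 ≤ g i z)
    (hg : ∀ i, Integrable (g i)) :
    Measure.pi (fun i => (volume : Measure ℂ).withDensity fun z => ENNReal.ofReal (g i z)) =
      (volume : Measure (ι → ℂ)).withDensity fun c => ENNReal.ofReal (∏ i, g i (c i)) := by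
  have hsf : ∀ i, SigmaFinite
      ((volume : Measure ℂ).withDensity fun z => ENNReal.ofReal (g i z)) := fun i =>
    SigmaFinite.withDensity_of_ne_top (ae_of_all _ fun z => ENNReal.ofReal_ne_top)
  refine Measure.pi_eq fun t ht => ?_
  rw [withDensity_apply _ (MeasurableSet.univ_pi ht), volume_pi, Measure.restrict_pi_pi,
    ← ofReal_integral_eq_lintegral_ofReal
      (Integrable.fintype_prod_dep fun i => (hg i).integrableOn)
      (ae_of_all _ fun c => Finset.prod_nonneg fun i _ => hg0 i _),
    integral_fintype_prod_eq_prod,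
    ENNReal.ofReal_prod_of_nonneg fun i _ => integral_nonneg (hg0 i)]
  refine Finset.prod_congr rfl fun i _ => ?_
  rw [withDensity_apply _ (ht i), ofReal_integral_eq_lintegral_ofReal (hg i).integrableOn
    (ae_of_all _ (hg0 i))]

/-- The precision `(2π|n|)^{2s}` of the `n`-th coefficient. -/
def precision (s : ℝ) (n : Fin d → ℤ) : ℝ := (2 * Real.pi * freqNorm n) ^ (2 * s)

theorem precision_pos (s : ℝ) {n : Fin d → ℤ} (hn : n ≠ 0) : 0 < precision s n := by
  have := one_le_freqNorm hn
  unfold precision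
  positivity

theorem coeffLaw_eq_withDensity (s : ℝ) (n : NonzeroFreq d) :
    coeffLaw s n = (volume : Measure ℂ).withDensity fun z =>
      ENNReal.ofReal (precision s n.1 / (2 * Real.pi) *
        Real.exp (-(precision s n.1 * ‖z‖ ^ 2 / 2))) := by
  have hpos := precision_pos s n.2
  have hf := one_le_freqNorm n.2
  have hv : (2 * Real.pi * freqNorm n.1) ^ (-(2 * s)) = (precision s n.1)⁻¹ := by
    rw [Real.rpow_neg (by positivity), precision]
  have hv0 : Real.toNNReal ((precision s n.1)⁻¹) ≠ 0 := by
    simpa using hpos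
  have hvc : ((Real.toNNReal ((precision s n.1)⁻¹) : ℝ≥0) : ℝ) = (precision s n.1)⁻¹ :=
    Real.coe_toNNReal _ (by positivity)
  rw [coeffLaw, hv]
  set v := Real.toNNReal ((precision s n.1)⁻¹) with hvdef
  rw [gaussianReal_of_var_ne_zero _ hv0, prod_withDensity (by fun_prop) (by fun_prop)]
  refine Measure.ext fun A hA => ?_
  rw [Measure.map_apply Complex.measurableEquivRealProd.symm.measurable hA,
    withDensity_apply _ hA,
    withDensity_apply _ (Complex.measurableEquivRealProd.symm.measurable hA),
    ← (Complex.volume_preserving_equiv_real_prod.symm).setLIntegral_comp_preimage_emb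
      Complex.measurableEquivRealProd.symm.measurableEmbedding]
  refine lintegral_congr fun x => ?_
  rw [gaussianPDF_def, ← ENNReal.ofReal_mul (gaussianPDFReal_nonneg _ _ _)]
  congr 1
  rw [gaussianPDFReal_def]
  simp only [hvc, sub_zero]
  rw [mul_mul_mul_comm, ← Real.exp_add, ← mul_inv, Real.mul_self_sqrt (by positivity),
    ← Complex.normSq_eq_norm_sq, Complex.normSq_apply]
  simp only [Complex.measurableEquivRealProd_symm_apply]
  congr 1
  · field_simp
  · congr 1
    field_simp
    ring
theorem integrable_coeffDensity (s : ℝ) (n : NonzeroFreq d) :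
    Integrable fun z : ℂ => precision s n.1 / (2 * Real.pi) *
        Real.exp (-(precision s n.1 * ‖z‖ ^ 2 / 2)) := by
  have hpos := precision_pos s n.2
  refine (lintegral_ofReal_ne_top_iff_integrable (by fun_prop)
    (ae_of_all _ fun z => by positivity)).mp ?_
  have h := measure_univ (μ := coeffLaw s n)
  -- the density integrates to one, as `coeffLaw` is a probability measure
  rw [coeffLaw_eq_withDensity, withDensity_apply _ MeasurableSet.univ, setLIntegral_univ] at h
  rw [h]
  exact ENNReal.one_ne_top

/-- The integrand of the partition function, as a function of finitely many Fourier
coefficients. -/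
def gibbsWeight {d : ℕ} (p K : ℝ) {ι : Type*} [Fintype ι] (k : ι → Fin d → ℤ) (c : ι → ℂ) : ℝ :=
  Set.indicator {c : ι → ℂ | lpNorm (trigPoly k c) 2 (torusMeasure d) ≤ K}
    (fun c => Real.exp (1 / p * ∫ x, ‖trigPoly k c x‖ ^ p ∂torusMeasure d)) c

theorem gibbsWeight_nonneg (p K : ℝ) {ι : Type*} [Fintype ι] (k : ι → Fin d → ℤ) (c : ι → ℂ) :
    0 ≤ gibbsWeight p K k c :=
  Set.indicator_nonneg (fun _ _ => (Real.exp_pos _).le) c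

theorem lpNorm_trigPoly {ι : Type*} [Fintype ι] {k : ι → Fin d → ℤ} (hk : Function.Injective k)
    (c : ι → ℂ) : lpNorm (trigPoly k c) 2 (torusMeasure d) = Real.sqrt (∑ i, ‖c i‖ ^ 2) := by
  rw [← toReal_eLpNorm (trigPoly k c).continuous.aestronglyMeasurable, eLpNorm_trigPoly hk,
    ENNReal.toReal_ofReal (Real.sqrt_nonneg _)]

theorem continuous_integral_trigPoly_rpow {ι : Type*} [Fintype ι] (k : ι → Fin d → ℤ) {p : ℝ}
    (hp : 0 ≤ p) :
    Continuous fun c : ι → ℂ => ∫ x, ‖trigPoly k c x‖ ^ p ∂torusMeasure d := by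
  have h : Continuous (Function.uncurry fun (c : ι → ℂ) (x : 𝕋) => ‖trigPoly k c x‖ ^ p) := by
    have h2 : Continuous fun q : (ι → ℂ) × 𝕋 => ‖trigPoly k q.1 q.2‖ := by
      simp_rw [trigPoly_apply]
      fun_prop
    exact h2.rpow_const fun q => Or.inr hp
  have := continuous_parametric_integral_of_continuous (μ := torusMeasure d) h
    (isCompact_univ (X := 𝕋))
  simpa using this

theorem gibbsWeight_eq {ι : Type*} [Fintype ι] {k : ι → Fin d → ℤ} (hk : Function.Injective k)
    (p : ℝ) {K : ℝ} (hK : 0 ≤ K) (c : ι → ℂ) :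
    gibbsWeight p K k c = Set.indicator {c : ι → ℂ | ∑ i, ‖c i‖ ^ 2 ≤ K ^ 2}
      (fun c => Real.exp (1 / p * ∫ x, ‖trigPoly k c x‖ ^ p ∂torusMeasure d)) c := by
  unfold gibbsWeight
  simp_rw [lpNorm_trigPoly hk, Real.sqrt_le_left hK]

theorem measurableSet_mass_le {ι : Type*} [Fintype ι] (M : ℝ) :
    MeasurableSet {c : ι → ℂ | ∑ i, ‖c i‖ ^ 2 ≤ M} :=
  measurableSet_le (by fun_prop) measurable_const

theorem measurable_gibbsWeight {ι : Type*} [Fintype ι] {k : ι → Fin d → ℤ}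
    (hk : Function.Injective k) {p K : ℝ} (hp : 0 ≤ p) (hK : 0 ≤ K) :
    Measurable (gibbsWeight p K k) := by
  have h : gibbsWeight p K k = Set.indicator {c : ι → ℂ | ∑ i, ‖c i‖ ^ 2 ≤ K ^ 2}
      (fun c => Real.exp (1 / p * ∫ x, ‖trigPoly k c x‖ ^ p ∂torusMeasure d)) :=
    funext fun c => gibbsWeight_eq hk p hK c
  rw [h]
  exact (Real.continuous_exp.comp
    ((continuous_integral_trigPoly_rpow k hp).const_mul _)).measurable.indicator
      (measurableSet_mass_le _)

/-- The nonzero frequencies of length at most `N`. -/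
def freqs (d N : ℕ) : Finset (NonzeroFreq d) := (freqBall d N).subtype (· ≠ 0)

/-- The frequency attached to an index of `freqs d N`. -/
def freqOf {d N : ℕ} (i : freqs d N) : Fin d → ℤ := i.1.1

theorem freqOf_injective {d N : ℕ} : Function.Injective (freqOf (d := d) (N := N)) :=
  Subtype.val_injective.comp Subtype.val_injective

theorem mem_freqs {N : ℕ} {n : NonzeroFreq d} : n ∈ freqs d N ↔ freqNorm n.1 ≤ N := by
  simp [freqs, mem_freqBall]

theorem freqProj_eq_trigPoly (N : ℕ) (u : TorusL2 d) :
    freqProj N u = trigPoly (fun n : freqBall d N => n.1)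
      fun n => UnitAddTorus.mFourierCoeff u n.1 := by
  rw [freqProj, trigPoly, ← Finset.sum_coe_sort]

/-- The projected field is the trigonometric polynomial with the prescribed coefficients. -/
theorem freqProj_fourierSeries (N : ℕ) {c : NonzeroFreq d → ℂ}
    (hc : Summable fun n => ‖c n‖ ^ 2) :
    freqProj N (fourierSeries c) = trigPoly freqOf ((freqs d N).restrict c) := by
  simp only [freqProj, mFourierCoeff_fourierSeries hc, trigPoly, Finset.restrict, freqOf]
  rw [Finset.sum_coe_sort (freqs d N)
    fun n : NonzeroFreq d => c n • UnitAddTorus.mFourier (d := Fin d) n.1]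
  rw [freqs, ← Finset.sum_filter_add_sum_filter_not (freqBall d N) (· ≠ 0),
    ← Finset.subtype_map, Finset.sum_map]
  rw [Finset.sum_eq_zero (s := Finset.filter _ _), add_zero]
  · refine Finset.sum_congr rfl fun n _ => ?_
    simp [n.2]
  · intro n hn
    rw [dif_neg (Finset.mem_filter.mp hn).2]
    exact zero_smul ℂ (UnitAddTorus.mFourier n)

theorem continuous_mFourierCoeff (n : Fin d → ℤ) :
    Continuous fun u : TorusL2 d => UnitAddTorus.mFourierCoeff u n := by
  have h : Continuous fun u : TorusL2 d =>
      inner ℂ (UnitAddTorus.mFourierBasis (d := Fin d) n) u :=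
    (innerSL ℂ (UnitAddTorus.mFourierBasis (d := Fin d) n)).continuous
  refine h.congr fun u => ?_
  rw [← HilbertBasis.repr_apply_apply]
  exact UnitAddTorus.mFourierBasis_repr u n

/-- The partition function is a finite-dimensional Gaussian expectation. -/
theorem partitionFn_eq_integral_gibbsWeight {s p K : ℝ} (hs : (d : ℝ) / 2 < s) (hp : 0 ≤ p)
    (hK : 0 ≤ K) (N : ℕ) :
    partitionFn d s p K N = ∫ c, gibbsWeight p K (freqOf (d := d) (N := N)) c
      ∂Measure.pi fun i : freqs d N => coeffLaw s i.1 := by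
  have h1 : ∀ u : TorusL2 d,
      Set.indicator {u : TorusL2 d | lpNorm (freqProj N u) 2 (torusMeasure d) ≤ K}
        (fun u => Real.exp (1 / p * ∫ x, ‖freqProj N u x‖ ^ p ∂torusMeasure d)) u =
      gibbsWeight p K (fun n : freqBall d N => n.1)
        fun n => UnitAddTorus.mFourierCoeff u n.1 := by
    intro u
    simp only [gibbsWeight, Set.indicator, Set.mem_ofPred_eq, freqProj_eq_trigPoly]
  have hmeas : Measurable fun u : TorusL2 d => gibbsWeight p K (fun n : freqBall d N => n.1)
        fun n => UnitAddTorus.mFourierCoeff u n.1 :=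
    (measurable_gibbsWeight Subtype.val_injective hp hK).comp
      (measurable_pi_lambda _ fun n => (continuous_mFourierCoeff n.1).measurable)
  unfold partitionFn
  simp_rw [h1]
  rw [gaussianField, integral_map (measurable_fourierSeries d).aemeasurable
    hmeas.aestronglyMeasurable,
    ← integral_restrict_infinitePi (s := freqs d N) (μ := fun n => coeffLaw s n)
      (f := gibbsWeight p K freqOf)
      (measurable_gibbsWeight freqOf_injective hp hK).aestronglyMeasurable]
  -- without square-summability, `fourierSeries` is the junk value of `tsum`
  refine integral_congr_ae ?_
  filter_upwards [ae_summable_sq hs] with c hc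
  rw [← h1]
  simp only [gibbsWeight, Set.indicator, Set.mem_ofPred_eq, freqProj_fourierSeries N hc]

/-- The Gaussian density turns the weight `exp ((1/p) ∫ |u|ᵖ)` into `exp (-H(u))`. -/
theorem partitionFn_eq_toReal_lintegral {s p K : ℝ} (hs : (d : ℝ) / 2 < s) (hp : 0 ≤ p)
    (hK : 0 ≤ K) (N : ℕ) :
    partitionFn d s p K N =
      (∫⁻ c in {c : freqs d N → ℂ | ∑ i, ‖c i‖ ^ 2 ≤ K ^ 2},
        ENNReal.ofReal (Real.exp (torusNegHam s p freqOf c) *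
          ∏ i : freqs d N, precision s (freqOf i) / (2 * Real.pi))).toReal := by
  rw [partitionFn_eq_integral_gibbsWeight hs hp hK N, integral_eq_lintegral_of_nonneg_ae
    (ae_of_all _ (gibbsWeight_nonneg p K freqOf))
    (measurable_gibbsWeight freqOf_injective hp hK).aestronglyMeasurable]
  congr 1
  simp_rw [coeffLaw_eq_withDensity]
  have hdens := pi_withDensity_ofReal (ι := freqs d N)
    (g := fun i z => precision s i.1.1 / (2 * Real.pi) *
      Real.exp (-(precision s i.1.1 * ‖z‖ ^ 2 / 2)))
    (fun i z => by
      have := precision_pos s i.1.2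
      positivity) (fun i => integrable_coeffDensity s i.1)
  rw [hdens,
    lintegral_withDensity_eq_lintegral_mul _ (by fun_prop)
      (measurable_gibbsWeight freqOf_injective hp hK).ennreal_ofReal,
    ← lintegral_indicator (measurableSet_mass_le _)]
  refine lintegral_congr fun c => ?_
  rw [Pi.mul_apply, gibbsWeight_eq freqOf_injective p hK]
  by_cases hc : c ∈ {c : freqs d N → ℂ | ∑ i, ‖c i‖ ^ 2 ≤ K ^ 2}
  · rw [Set.indicator_of_mem hc, Set.indicator_of_mem hc, ← ENNReal.ofReal_mul]
    · congr 1
      rw [Finset.prod_mul_distrib, ← Real.exp_sum, torusNegHam, sub_eq_add_neg, Real.exp_add]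
      have h : ∑ i : freqs d N, -(precision s i.1.1 * ‖c i‖ ^ 2 / 2) =
          -(1 / 2 * ∑ i : freqs d N,
            (2 * Real.pi * freqNorm (freqOf i)) ^ (2 * s) * ‖c i‖ ^ 2) := by
        rw [Finset.mul_sum, ← Finset.sum_neg_distrib]
        refine Finset.sum_congr rfl fun i _ => ?_
        simp only [precision, freqOf]
        ring
      rw [h]
      simp only [freqOf]
      ring
    · refine Finset.prod_nonneg fun i _ => ?_
      have := precision_pos s i.1.2
      positivity
  · rw [Set.indicator_of_notMem hc, Set.indicator_of_notMem hc, ENNReal.ofReal_zero, mul_zero]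

end Density

/-! ### Laplace bounds for the Gaussian integral -/

section Laplace

variable {d : ℕ}

theorem volume_pi_closedBall_complex {ι : Type*} [Fintype ι] {r : ℝ} (hr : 0 ≤ r) :
    volume (Set.univ.pi fun _ : ι => Metric.closedBall (0 : ℂ) r) =
      ENNReal.ofReal (∏ _i : ι, r ^ 2 * Real.pi) := by
  rw [volume_pi_pi, ENNReal.ofReal_prod_of_nonneg fun i _ => by positivity]
  refine Finset.prod_congr rfl fun i _ => ?_
  rw [Complex.volume_closedBall, ENNReal.ofReal_mul (by positivity), ENNReal.ofReal_pow hr,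
    ← NNReal.coe_real_pi, ENNReal.ofReal_coe_nnreal]

theorem continuous_torusNegHam {ι : Type*} [Fintype ι] (s : ℝ) {p : ℝ} (hp : 0 ≤ p)
    (k : ι → Fin d → ℤ) : Continuous (torusNegHam s p k) := by
  unfold torusNegHam
  exact ((continuous_integral_trigPoly_rpow k hp).const_mul _).sub (by fun_prop)

/-- Laplace's method, upper bound: the integral over the ball of mass `K²` is at most the maximum
of the integrand times the volume of the polydisc of radius `K`. -/
theorem lintegral_exp_torusNegHam_le {ι : Type*} [Fintype ι] {s p K S : ℝ} (hK : 0 ≤ K)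
    {k : ι → Fin d → ℤ} (hk : ∀ i, k i ≠ 0)
    (hS : ∀ c : ι → ℂ, ∑ i, ‖c i‖ ^ 2 ≤ K ^ 2 → torusNegHam s p k c ≤ S) :
    ∫⁻ c in {c : ι → ℂ | ∑ i, ‖c i‖ ^ 2 ≤ K ^ 2},
        ENNReal.ofReal (Real.exp (torusNegHam s p k c) *
          ∏ i, precision s (k i) / (2 * Real.pi)) ≤
      ENNReal.ofReal (Real.exp S * ∏ i, precision s (k i) * K ^ 2 / 2) := by
  have hprod : 0 ≤ ∏ i, precision s (k i) / (2 * Real.pi) := Finset.prod_nonneg fun i _ => by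
    have := precision_pos s (hk i)
    positivity
  have hsub : {c : ι → ℂ | ∑ i, ‖c i‖ ^ 2 ≤ K ^ 2} ⊆
      Set.univ.pi fun _ : ι => Metric.closedBall (0 : ℂ) K := by
    intro c hc i _
    rw [mem_closedBall_zero_iff]
    refine (sq_le_sq₀ (norm_nonneg _) hK).mp ?_
    exact (Finset.single_le_sum (f := fun i => ‖c i‖ ^ 2) (fun j _ => sq_nonneg _)
      (Finset.mem_univ i)).trans hc
  calc _ ≤ ∫⁻ c in {c : ι → ℂ | ∑ i, ‖c i‖ ^ 2 ≤ K ^ 2},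
        ENNReal.ofReal (Real.exp S * ∏ i, precision s (k i) / (2 * Real.pi)) := by
        refine setLIntegral_mono measurable_const fun c hc => ?_
        exact ENNReal.ofReal_le_ofReal
          (mul_le_mul_of_nonneg_right (Real.exp_le_exp.mpr (hS c hc)) hprod)
    _ ≤ ENNReal.ofReal (Real.exp S * ∏ i, precision s (k i) / (2 * Real.pi)) *
        ENNReal.ofReal (∏ _i : ι, K ^ 2 * Real.pi) := by
        rw [setLIntegral_const, ← volume_pi_closedBall_complex hK]
        gcongr
    _ = _ := by
        rw [← ENNReal.ofReal_mul (by positivity), mul_assoc, ← Finset.prod_mul_distrib]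
        congr 2
        refine Finset.prod_congr rfl fun i _ => ?_
        field_simp

/-- By convexity of `|·|ᵖ` the potential energy only increases on average over `±h`, while the
kinetic energy is quadratic. -/
theorem two_mul_torusNegHam_sub_le {ι : Type*} [Fintype ι] (s : ℝ) {p : ℝ} (hp : 1 ≤ p)
    (k : ι → Fin d → ℤ) (a h : ι → ℂ) :
    2 * torusNegHam s p k a - ∑ i, precision s (k i) * ‖h i‖ ^ 2 ≤
      torusNegHam s p k (a + h) + torusNegHam s p k (a - h) := by
  have hkin : ∑ i, precision s (k i) * ‖(a + h) i‖ ^ 2 + ∑ i, precision s (k i) * ‖(a - h) i‖ ^ 2 =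
      2 * ∑ i, precision s (k i) * ‖a i‖ ^ 2 + 2 * ∑ i, precision s (k i) * ‖h i‖ ^ 2 := by
    rw [Finset.mul_sum, Finset.mul_sum, ← Finset.sum_add_distrib, ← Finset.sum_add_distrib]
    refine Finset.sum_congr rfl fun i _ => ?_
    have := parallelogram_law_with_norm ℝ (a i) (h i)
    simp only [Pi.add_apply, Pi.sub_apply]
    linear_combination precision s (k i) * this
  have hint : ∀ c : ι → ℂ, Integrable (fun x => ‖trigPoly k c x‖ ^ p) (torusMeasure d) := by
    intro c
    have hc : Continuous fun x => ‖trigPoly k c x‖ ^ p :=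
      (trigPoly k c).continuous.norm.rpow_const fun _ => Or.inr (by linarith)
    exact hc.integrable_of_hasCompactSupport (HasCompactSupport.of_compactSpace _)
  have hpot : 2 * ∫ x, ‖trigPoly k a x‖ ^ p ∂torusMeasure d ≤
      (∫ x, ‖trigPoly k (a + h) x‖ ^ p ∂torusMeasure d) +
        ∫ x, ‖trigPoly k (a - h) x‖ ^ p ∂torusMeasure d := by
    rw [← integral_add (hint _) (hint _), ← integral_const_mul]
    refine integral_mono ((hint a).const_mul 2) ((hint _).add (hint _)) fun x => ?_
    have h1 : trigPoly k a x =
        (1 / 2 : ℂ) * trigPoly k (a + h) x + (1 / 2 : ℂ) * trigPoly k (a - h) x := by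
      simp only [trigPoly_apply, Finset.mul_sum, ← Finset.sum_add_distrib]
      refine Finset.sum_congr rfl fun i _ => ?_
      simp only [Pi.add_apply, Pi.sub_apply]
      ring
    have h2 : ‖trigPoly k a x‖ ≤
        (1 / 2 : ℝ) • ‖trigPoly k (a + h) x‖ + (1 / 2 : ℝ) • ‖trigPoly k (a - h) x‖ := by
      rw [h1]
      refine (norm_add_le _ _).trans_eq ?_
      simp
    have h3 := (convexOn_rpow hp).2 (Set.mem_Ici.mpr (norm_nonneg (trigPoly k (a + h) x)))
      (Set.mem_Ici.mpr (norm_nonneg (trigPoly k (a - h) x))) (by norm_num : (0 : ℝ) ≤ 1 / 2)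
      (by norm_num : (0 : ℝ) ≤ 1 / 2) (by norm_num)
    have h4 := (Real.rpow_le_rpow (norm_nonneg _) h2 (by linarith)).trans h3
    simp only [smul_eq_mul] at h4
    simp only
    linarith
  have hp0 : 0 < 1 / p := by positivity
  have := mul_le_mul_of_nonneg_left hpot hp0.le
  simp only [torusNegHam]
  simp only [precision] at hkin ⊢
  linarith

/-- Laplace's method, lower bound: the integral over the polydisc of radius `r` around `a`.
Symmetrizing in `h ↦ -h` removes the first-order variation at `a`, so that `a` need not be a
critical point. -/
theorem le_lintegral_exp_torusNegHam {ι : Type*} [Fintype ι] {s p K r : ℝ}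
    (hp : 1 ≤ p) (hr0 : 0 ≤ r)
    {k : ι → Fin d → ℤ} (hk : ∀ i, k i ≠ 0) {a : ι → ℂ}
    (ha : ∀ h : ι → ℂ, (∀ i, ‖h i‖ ≤ r) → ∑ i, ‖a i + h i‖ ^ 2 ≤ K ^ 2) :
    ENNReal.ofReal (Real.exp (torusNegHam s p k a - 1 / 2 * ∑ i, precision s (k i) * r ^ 2) *
        ∏ i, precision s (k i) * r ^ 2 / 2) ≤
      ∫⁻ c in {c : ι → ℂ | ∑ i, ‖c i‖ ^ 2 ≤ K ^ 2},
        ENNReal.ofReal (Real.exp (torusNegHam s p k c) *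
          ∏ i, precision s (k i) / (2 * Real.pi)) := by
  set P := ∏ i, precision s (k i) / (2 * Real.pi) with hP
  have hprod : 0 ≤ P := Finset.prod_nonneg fun i _ => by
    have := precision_pos s (hk i)
    positivity
  set B : Set (ι → ℂ) := Set.univ.pi fun _ : ι => Metric.closedBall (0 : ℂ) r with hB
  have hBm : MeasurableSet B := MeasurableSet.univ_pi fun _ => measurableSet_closedBall
  set E := torusNegHam s p k a - 1 / 2 * ∑ i, precision s (k i) * r ^ 2 with hE
  rw [← lintegral_indicator (measurableSet_mass_le _)]
  set G : (ι → ℂ) → ℝ≥0∞ := Set.indicator {c : ι → ℂ | ∑ i, ‖c i‖ ^ 2 ≤ K ^ 2}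
    fun c => ENNReal.ofReal (Real.exp (torusNegHam s p k c) * P) with hG
  have hGm : Measurable G :=
    ((Real.continuous_exp.comp (continuous_torusNegHam s (by linarith) k)).measurable.mul_const
      P).ennreal_ofReal.indicator (measurableSet_mass_le _)
  have hpoint : ∀ h ∈ B, ENNReal.ofReal (2 * (Real.exp E * P)) ≤ G (a + h) + G (a - h) := by
    intro h hh
    have hr : ∀ i, ‖h i‖ ≤ r := fun i => by simpa using hh i (Set.mem_univ i)
    have h1 : a + h ∈ {c : ι → ℂ | ∑ i, ‖c i‖ ^ 2 ≤ K ^ 2} := ha h hr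
    have h2 : a - h ∈ {c : ι → ℂ | ∑ i, ‖c i‖ ^ 2 ≤ K ^ 2} := by
      have := ha (-h) (fun i => by simpa using hr i)
      simpa [sub_eq_add_neg] using this
    rw [hG, Set.indicator_of_mem h1, Set.indicator_of_mem h2,
      ← ENNReal.ofReal_add (by positivity) (by positivity)]
    refine ENNReal.ofReal_le_ofReal ?_
    have h3 := two_mul_torusNegHam_sub_le s hp k a h
    have h4 : ∑ i, precision s (k i) * ‖h i‖ ^ 2 ≤ ∑ i, precision s (k i) * r ^ 2 := by
      refine Finset.sum_le_sum fun i _ => ?_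
      have := precision_pos s (hk i)
      have := hr i
      gcongr
    -- the arithmetic-geometric mean inequality for `exp`
    have h5 : 2 * Real.exp E ≤
        Real.exp (torusNegHam s p k (a + h)) + Real.exp (torusNegHam s p k (a - h)) := by
      set x := torusNegHam s p k (a + h)
      set y := torusNegHam s p k (a - h)
      have h6 : Real.exp E ≤ Real.exp ((x + y) / 2) := Real.exp_le_exp.mpr (by rw [hE]; linarith)
      have h7 : Real.exp ((x + y) / 2) = Real.exp (x / 2) * Real.exp (y / 2) := by
        rw [← Real.exp_add]
        congr 1
        ring
      have h8 : Real.exp x = Real.exp (x / 2) ^ 2 := by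
        rw [← Real.exp_nat_mul]
        congr 1
        push_cast
        ring
      have h9 : Real.exp y = Real.exp (y / 2) ^ 2 := by
        rw [← Real.exp_nat_mul]
        congr 1
        push_cast
        ring
      nlinarith [sq_nonneg (Real.exp (x / 2) - Real.exp (y / 2))]
    have := mul_le_mul_of_nonneg_right h5 hprod
    linarith
  -- translation to `a` and reflection in `a` both preserve the integral of `G`
  have hsum : 2 * ∫⁻ c, G c = ∫⁻ h, (G (a + h) + G (a - h)) := by
    rw [lintegral_add_left (f := fun h => G (a + h)) (hGm.comp (measurable_const_add a)),
      lintegral_add_left_eq_self, lintegral_sub_left_eq_self, two_mul]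
  have hlow : ENNReal.ofReal (2 * (Real.exp E * P)) * volume B ≤ 2 * ∫⁻ c, G c := by
    rw [hsum, ← setLIntegral_const]
    exact (setLIntegral_mono' hBm hpoint).trans (setLIntegral_le_lintegral _ _)
  rw [hB, volume_pi_closedBall_complex hr0, ENNReal.ofReal_mul zero_le_two, mul_assoc,
    ENNReal.ofReal_ofNat,
    ENNReal.mul_le_mul_iff_right two_ne_zero ENNReal.ofNat_ne_top,
    ← ENNReal.ofReal_mul (by positivity), mul_assoc, hP, ← Finset.prod_mul_distrib] at hlow
  convert hlow using 4 with i
  field_simp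

end Laplace

/-! ### Asymptotics of the partition function -/

section Asymptotic

variable {d : ℕ}

theorem card_freqs_le {N : ℕ} (hN : 1 ≤ N) : ((freqs d N).card : ℝ) ≤ (3 * N : ℝ) ^ d := by
  have h1 : (freqs d N).card ≤ (freqBall d N).card := by
    rw [freqs, Finset.card_subtype]
    exact Finset.card_filter_le _ _
  have h2 : (freqBall d N).card ≤ (2 * N + 1) ^ d := by
    refine (Finset.card_filter_le _ _).trans_eq ?_
    rw [Fintype.card_piFinset]
    simp only [Int.card_Icc, Finset.prod_const, Finset.card_univ, Fintype.card_fin]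
    congr 1
    omega
  have h3 : (2 * N + 1) ^ d ≤ (3 * N) ^ d := Nat.pow_le_pow_left (by omega) d
  exact_mod_cast (h1.trans h2).trans h3

/-- There are too few frequencies for their logarithmic contributions to matter: this is where
`s > d/2` enters. -/
theorem eventually_entropy_le {s : ℝ} (hs : (d : ℝ) / 2 < s) (A B : ℝ) {ε : ℝ} (hε : 0 < ε) :
    ∀ᶠ N : ℕ in atTop,
      (3 * N : ℝ) ^ d * (A + B * Real.log N) ≤ ε * (N : ℝ) ^ (2 * s) := by
  have hδ : 0 < 2 * s - d := by linarith
  have h1 : (fun x : ℝ => A + B * Real.log x) =o[atTop] fun x => x ^ (2 * s - d) :=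
    IsLittleO.add (isLittleO_const_left.mpr (Or.inr
      (tendsto_norm_atTop_atTop.comp (tendsto_rpow_atTop hδ))))
      ((isLittleO_log_rpow_atTop hδ).const_mul_left B)
  have h2 := (h1.comp_tendsto tendsto_natCast_atTop_atTop).def
    (show 0 < ε / 3 ^ d by positivity)
  filter_upwards [h2, eventually_ge_atTop 1] with N h hN
  have hN0 : (0 : ℝ) < N := by exact_mod_cast hN
  simp only [Function.comp_apply, Real.norm_eq_abs] at h
  rw [abs_of_nonneg (Real.rpow_nonneg hN0.le (2 * s - d))] at h
  have h3 := (le_abs_self _).trans h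
  have h4 : (N : ℝ) ^ (2 * s) = (N : ℝ) ^ d * (N : ℝ) ^ (2 * s - d) := by
    rw [← Real.rpow_natCast, ← Real.rpow_add hN0]
    congr 1
    ring
  calc (3 * N : ℝ) ^ d * (A + B * Real.log N)
      ≤ (3 * N : ℝ) ^ d * (ε / 3 ^ d * (N : ℝ) ^ (2 * s - d)) := by gcongr
    _ = ε * (N : ℝ) ^ (2 * s) := by
      rw [h4, mul_pow]
      field_simp

theorem freqNorm_freqOf_le {N : ℕ} (i : freqs d N) : freqNorm (freqOf i) ≤ N :=
  mem_freqs.mp i.2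

theorem mem_range_freqOf {N : ℕ} (n : Fin d → ℤ) (hn : n ≠ 0) (hN : freqNorm n ≤ N) :
    n ∈ Set.range (freqOf (d := d) (N := N)) :=
  ⟨⟨⟨n, hn⟩, mem_freqs.mpr hN⟩, rfl⟩

theorem one_le_precision {s : ℝ} (hs : 0 ≤ s) {n : Fin d → ℤ} (hn : n ≠ 0) :
    1 ≤ precision s n := by
  refine Real.one_le_rpow ?_ (by linarith)
  nlinarith [one_le_freqNorm hn, Real.pi_gt_three]

theorem precision_le {s N : ℝ} (hs : 0 ≤ s) (hN : 0 ≤ N) {n : Fin d → ℤ} (hn : freqNorm n ≤ N) :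
    precision s n ≤ (2 * Real.pi) ^ (2 * s) * N ^ (2 * s) := by
  have h0 : 0 ≤ freqNorm n := Real.sqrt_nonneg _
  rw [precision, ← Real.mul_rpow (by positivity) hN]
  gcongr

/-- The upper bound for the Gaussian integral, on the exponential scale. -/
theorem eventually_lintegral_le {s p K : ℝ} (hd : 0 < d) (hs : (d : ℝ) / 2 < s)
    (hp : p = 4 * s / d + 2) (hK : 0 < K) (hC : 0 ≤ critConst d s p K) {ε : ℝ} (hε : 0 < ε) :
    ∀ᶠ N : ℕ in atTop,
      ∫⁻ c in {c : freqs d N → ℂ | ∑ i, ‖c i‖ ^ 2 ≤ K ^ 2},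
          ENNReal.ofReal (Real.exp (torusNegHam s p freqOf c) *
            ∏ i : freqs d N, precision s (freqOf i) / (2 * Real.pi)) ≤
        ENNReal.ofReal (Real.exp ((critConst d s p K + ε) * (N : ℝ) ^ (2 * s))) := by
  have hs0 : 0 < s := lt_of_le_of_lt (by positivity) hs
  set A := |Real.log ((2 * Real.pi) ^ (2 * s) * K ^ 2 / 2)| with hA
  filter_upwards [eventually_torusNegHam_le hd hs0 hp hK.le hC (half_pos hε),
    eventually_entropy_le hs A (2 * s) (half_pos hε), eventually_ge_atTop 1] with N h1 h2 hN
  have hN0 : (0 : ℝ) < N := by exact_mod_cast hN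
  have hlogN : 0 ≤ Real.log N := Real.log_natCast_nonneg N
  refine (lintegral_exp_torusNegHam_le hK.le (fun i => i.1.2)
    (fun c hc => h1 _ freqOf c freqOf_injective freqNorm_freqOf_le hc)).trans
      (ENNReal.ofReal_le_ofReal ?_)
  have h3 : ∀ i : freqs d N, precision s (freqOf i) * K ^ 2 / 2 ≤
      Real.exp (A + 2 * s * Real.log N) := by
    intro i
    have h4 : precision s (freqOf i) * K ^ 2 / 2 ≤
        ((2 * Real.pi) ^ (2 * s) * K ^ 2 / 2) * (N : ℝ) ^ (2 * s) := by
      have := precision_le hs0.le hN0.le (freqNorm_freqOf_le i)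
      calc _ ≤ ((2 * Real.pi) ^ (2 * s) * (N : ℝ) ^ (2 * s)) * K ^ 2 / 2 := by gcongr
        _ = _ := by ring
    refine h4.trans ?_
    rw [Real.exp_add, Real.rpow_def_of_pos hN0, mul_comm (Real.log N)]
    gcongr
    rw [← Real.log_le_iff_le_exp (by positivity)]
    exact le_abs_self _
  have h5 : ∏ i : freqs d N, precision s (freqOf i) * K ^ 2 / 2 ≤
      Real.exp (ε / 2 * (N : ℝ) ^ (2 * s)) := by
    calc _ ≤ ∏ _i : freqs d N, Real.exp (A + 2 * s * Real.log N) := by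
          refine Finset.prod_le_prod (fun i _ => ?_) fun i _ => h3 i
          have := precision_pos s i.1.2
          simp only [freqOf]
          positivity
      _ = Real.exp ((freqs d N).card * (A + 2 * s * Real.log N)) := by
          rw [Finset.prod_const, ← Real.exp_nat_mul]
          simp
      _ ≤ _ := by
          refine Real.exp_le_exp.mpr (le_trans ?_ h2)
          have := card_freqs_le (d := d) hN
          gcongr
  calc _ ≤ Real.exp ((critConst d s p K + ε / 2) * (N : ℝ) ^ (2 * s)) *
        Real.exp (ε / 2 * (N : ℝ) ^ (2 * s)) := by gcongr
    _ = _ := by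
      rw [← Real.exp_add]
      congr 1
      ring

/-- A near-maximizer of mass strictly less than `K²`; the room left is used to perturb its Fourier
coefficients. -/
theorem exists_negHam_gt_of_mass_lt {s p K : ℝ} (hs : 0 ≤ s) (hC : 0 < critConst d s p K)
    {ε : ℝ} (hε : 0 < ε) :
    ∃ g : EuclideanSpace ℝ (Fin d) → ℂ, BandLimited 1 g ∧
      ∃ κ : ℝ, 0 < κ ∧ κ < 1 ∧ mass g = (κ * K) ^ 2 ∧
      critConst d s p K - ε < negHam s p g := by
  obtain ⟨g, hg, hgm, hgH⟩ := exists_negHam_gt hs hC hε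
  have hcont : Tendsto (fun κ : ℝ => 1 / p * (κ ^ p * potential p g) -
      1 / 2 * (κ ^ 2 * kinetic s g)) (𝓝[<] 1) (𝓝 (negHam s p g)) := by
    have : ContinuousAt (fun κ : ℝ => 1 / p * (κ ^ p * potential p g) -
      1 / 2 * (κ ^ 2 * kinetic s g)) 1 := by
      have := Real.continuousAt_rpow_const (1 : ℝ) p (Or.inl one_ne_zero)
      fun_prop
    have h := this.tendsto
    simp only [Real.one_rpow, one_pow, one_mul] at h
    exact h.mono_left nhdsWithin_le_nhds
  have hev : ∀ᶠ κ : ℝ in 𝓝[<] 1, κ ∈ Set.Ioo (0 : ℝ) 1 := Ioo_mem_nhdsLT one_pos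
  obtain ⟨κ, h1, h2⟩ := ((hcont.eventually_const_lt hgH).and hev).exists
  refine ⟨fun x => (κ : ℂ) * g x, ?_, κ, h2.1, h2.2, ?_, ?_⟩
  · exact hg.const_smul κ
  · rw [mass_const_mul, hgm, Complex.norm_real, Real.norm_eq_abs, sq_abs, mul_pow]
  · rw [negHam, potential_const_mul, kinetic_const_mul]
    simpa [abs_of_pos h2.1] using h1

/-- The lower bound for the Gaussian integral, on the exponential scale. -/
theorem eventually_le_lintegral {s p K : ℝ} (hd : 0 < d) (hs : (d : ℝ) / 2 < s)
    (hp : p = 4 * s / d + 2) (hK : 0 < K) (hC : 0 < critConst d s p K) {ε : ℝ} (hε : 0 < ε) :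
    ∀ᶠ N : ℕ in atTop,
      ENNReal.ofReal (Real.exp ((critConst d s p K - ε) * (N : ℝ) ^ (2 * s))) ≤
        ∫⁻ c in {c : freqs d N → ℂ | ∑ i, ‖c i‖ ^ 2 ≤ K ^ 2},
          ENNReal.ofReal (Real.exp (torusNegHam s p freqOf c) *
            ∏ i : freqs d N, precision s (freqOf i) / (2 * Real.pi)) := by
  have hs0 : 0 < s := lt_of_le_of_lt (by positivity) hs
  have hp1 : 2 ≤ p := by
    rw [hp]
    have : 0 ≤ 4 * s / d := by positivity
    linarith
  obtain ⟨g, hg, κ, hκ0, hκ1, hgm, hgH⟩ :=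
    exists_negHam_gt_of_mass_lt (d := d) hs0.le hC (show 0 < ε / 4 by positivity)
  -- the `ℓ²` size of the perturbations: the mass stays at most `K²`, the kinetic cost is small
  set Λ := (2 * Real.pi) ^ (2 * s) with hΛ
  have hΛ0 : 0 < Λ := by positivity
  set η := min ((1 - κ) * K) (Real.sqrt (ε / (2 * Λ))) with hη
  have hη0 : 0 < η := lt_min (mul_pos (by linarith) hK) (Real.sqrt_pos.mpr (by positivity))
  have hηK : κ * K + η ≤ K := by
    have : η ≤ (1 - κ) * K := min_le_left _ _
    linarith
  have hηΛ : Λ * η ^ 2 ≤ ε / 2 := by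
    have h1 : η ^ 2 ≤ ε / (2 * Λ) := by
      calc η ^ 2 ≤ Real.sqrt (ε / (2 * Λ)) ^ 2 := by
            gcongr
            exact min_le_right _ _
        _ = _ := Real.sq_sqrt (by positivity)
    calc Λ * η ^ 2 ≤ Λ * (ε / (2 * Λ)) := by gcongr
      _ = ε / 2 := by field_simp
  set A := |Real.log (η ^ 2 / 2)| + d * Real.log 3 with hA
  filter_upwards [eventually_exists_le_torusNegHam (k := fun N => freqOf (d := d) (N := N))
      (fun N => freqOf_injective) hd (fun N i => freqNorm_freqOf_le i)
      (fun N n hn hnN => mem_range_freqOf n hn hnN) hs0 hp hg (show 0 < ε / 4 by positivity),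
    eventually_entropy_le hs A d (show 0 < ε / 4 by positivity),
    eventually_ge_atTop 1] with N h1 h2 hN
  obtain ⟨a, ham, haH⟩ := h1
  have hN0 : (0 : ℝ) < N := by exact_mod_cast hN
  have hlogN : 0 ≤ Real.log N := Real.log_natCast_nonneg N
  have hcard := card_freqs_le (d := d) hN
  have hM : (0 : ℝ) < (3 * N) ^ d := by positivity
  set r := η / Real.sqrt ((3 * N : ℝ) ^ d) with hr
  have hr0 : 0 < r := by positivity
  have hr2 : r ^ 2 = η ^ 2 / (3 * N : ℝ) ^ d := by
    rw [hr, div_pow, Real.sq_sqrt hM.le]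
  have hcr : (freqs d N).card * r ^ 2 ≤ η ^ 2 := by
    rw [hr2]
    calc _ ≤ (3 * N : ℝ) ^ d * (η ^ 2 / (3 * N : ℝ) ^ d) := by gcongr
      _ = _ := by field_simp
  have hmass : ∀ h : freqs d N → ℂ, (∀ i, ‖h i‖ ≤ r) → ∑ i, ‖a i + h i‖ ^ 2 ≤ K ^ 2 := by
    intro h hh
    have e1 : ‖WithLp.toLp 2 a‖ ≤ κ * K := by
      rw [EuclideanSpace.norm_eq, Real.sqrt_le_left (by positivity), ← hgm]
      exact ham
    have e2 : ‖WithLp.toLp 2 h‖ ≤ η := by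
      rw [EuclideanSpace.norm_eq, Real.sqrt_le_left hη0.le]
      refine le_trans ?_ hcr
      calc ∑ i, ‖h i‖ ^ 2 ≤ ∑ _i : freqs d N, r ^ 2 := by
            refine Finset.sum_le_sum fun i _ => ?_
            have := hh i
            gcongr
        _ = _ := by simp
    have e3 := (norm_add_le (WithLp.toLp 2 a) (WithLp.toLp 2 h)).trans
      ((add_le_add e1 e2).trans hηK)
    rw [EuclideanSpace.norm_eq, Real.sqrt_le_left hK.le] at e3
    exact e3
  refine (ENNReal.ofReal_le_ofReal ?_).trans (le_lintegral_exp_torusNegHam (by linarith) hr0.le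
    (fun i => i.1.2) hmass)
  have hpen : 1 / 2 * ∑ i : freqs d N, precision s (freqOf i) * r ^ 2 ≤
      ε / 4 * (N : ℝ) ^ (2 * s) := by
    have e1 : ∑ i : freqs d N, precision s (freqOf i) * r ^ 2 ≤
        (freqs d N).card * ((Λ * (N : ℝ) ^ (2 * s)) * r ^ 2) := by
      calc _ ≤ ∑ _i : freqs d N, (Λ * (N : ℝ) ^ (2 * s)) * r ^ 2 := by
            refine Finset.sum_le_sum fun i _ => ?_
            have := precision_le hs0.le hN0.le (freqNorm_freqOf_le i)
            gcongr
        _ = _ := by simp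
    have e2 : (freqs d N).card * ((Λ * (N : ℝ) ^ (2 * s)) * r ^ 2) ≤
        (Λ * η ^ 2) * (N : ℝ) ^ (2 * s) := by
      calc _ = (Λ * (N : ℝ) ^ (2 * s)) * ((freqs d N).card * r ^ 2) := by ring
        _ ≤ (Λ * (N : ℝ) ^ (2 * s)) * η ^ 2 := by gcongr
        _ = _ := by ring
    have e3 : (Λ * η ^ 2) * (N : ℝ) ^ (2 * s) ≤ ε / 2 * (N : ℝ) ^ (2 * s) := by gcongr
    linarith
  have hprod : Real.exp (-(ε / 4 * (N : ℝ) ^ (2 * s))) ≤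
      ∏ i : freqs d N, precision s (freqOf i) * r ^ 2 / 2 := by
    have e1 : ∀ i : freqs d N, Real.exp (-(A + d * Real.log N)) ≤
        precision s (freqOf i) * r ^ 2 / 2 := by
      intro i
      have e2 : r ^ 2 / 2 ≤ precision s (freqOf i) * r ^ 2 / 2 := by
        have := one_le_precision hs0.le i.1.2
        simp only [freqOf]
        nlinarith [sq_nonneg r]
      refine le_trans ?_ e2
      have e3 : r ^ 2 / 2 = (η ^ 2 / 2) / (3 * N : ℝ) ^ d := by
        rw [hr2]
        ring
      rw [← Real.le_log_iff_exp_le (by positivity), e3,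
        Real.log_div (by positivity) (by positivity), Real.log_pow,
        Real.log_mul (by norm_num) hN0.ne', hA]
      have := neg_abs_le (Real.log (η ^ 2 / 2))
      linarith
    calc _ ≤ Real.exp ((freqs d N).card * (-(A + d * Real.log N))) := by
          refine Real.exp_le_exp.mpr ?_
          rw [mul_neg]
          refine neg_le_neg (le_trans ?_ h2)
          have : 0 ≤ A + d * Real.log N := by positivity
          gcongr
      _ = ∏ _i : freqs d N, Real.exp (-(A + d * Real.log N)) := by
          rw [Finset.prod_const, ← Real.exp_nat_mul]
          simp
      _ ≤ _ := Finset.prod_le_prod (fun i _ => (Real.exp_pos _).le) fun i _ => e1 i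
  have hgH' : (critConst d s p K - ε / 2) * (N : ℝ) ^ (2 * s) ≤ torusNegHam s p freqOf a := by
    refine le_trans (mul_le_mul_of_nonneg_right ?_ (by positivity)) haH
    linarith
  calc Real.exp ((critConst d s p K - ε) * (N : ℝ) ^ (2 * s))
      = Real.exp ((critConst d s p K - ε / 2) * (N : ℝ) ^ (2 * s) - ε / 4 * (N : ℝ) ^ (2 * s)) *
        Real.exp (-(ε / 4 * (N : ℝ) ^ (2 * s))) := by
        rw [← Real.exp_add]
        congr 1
        ring
    _ ≤ _ := by
        refine mul_le_mul (Real.exp_le_exp.mpr ?_) hprod (Real.exp_pos _).le (Real.exp_pos _).le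
        linarith

/-- The free energy on the scale `N ^ (2 s)`, for every real `s > d/2`. -/
theorem tendsto_log_partitionFn {s p K : ℝ} (hd : 0 < d) (hs : (d : ℝ) / 2 < s)
    (hp : p = 4 * s / d + 2) (hK : 0 < K) (hC : 0 < critConst d s p K) :
    Tendsto (fun N : ℕ => (N : ℝ) ^ (-(2 * s)) * Real.log (partitionFn d s p K N)) atTop
      (𝓝 (critConst d s p K)) := by
  have hs0 : 0 < s := lt_of_le_of_lt (by positivity) hs
  have hp0 : 0 ≤ p := by
    rw [hp]
    positivity
  rw [Metric.tendsto_nhds]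
  intro ε hε
  filter_upwards [eventually_lintegral_le hd hs hp hK hC.le (half_pos hε),
    eventually_le_lintegral hd hs hp hK hC (half_pos hε), eventually_ge_atTop 1] with N h1 h2 hN
  have hN0 : (0 : ℝ) < N := by exact_mod_cast hN
  have h3 := ENNReal.toReal_mono ENNReal.ofReal_ne_top h1
  have h4 := ENNReal.toReal_mono (ne_top_of_le_ne_top ENNReal.ofReal_ne_top h1) h2
  rw [← partitionFn_eq_toReal_lintegral hs hp0 hK.le, ENNReal.toReal_ofReal (Real.exp_pos _).le]
    at h3 h4
  have hZ : 0 < partitionFn d s p K N := (Real.exp_pos _).trans_le h4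
  rw [← Real.log_le_iff_le_exp hZ] at h3
  rw [← Real.le_log_iff_exp_le hZ] at h4
  have hX : 0 < (N : ℝ) ^ (2 * s) := by positivity
  rw [Real.rpow_neg hN0.le, inv_mul_eq_div, Real.dist_eq, abs_lt]
  rw [← div_le_iff₀ hX] at h3
  rw [← le_div_iff₀ hX] at h4
  constructor <;> linarith

end Asymptotic

end FocusingGibbs

end

open FocusingGibbs
theorem theorem1 (d : ℕ) (hd : 0 < d) (s : ℝ) (hs : (d : ℝ) / 2 < s)
    (p : ℝ) (hp : p = 4 * s / d + 2)
    (Q : SpaceL2 d) (hQ : IsGNSOptimizer s p Q) (hQn : IsGNSNormalized s p Q)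
    (K : ℝ) (hK : ‖Q‖ < K) :
    0 < critConst d s p K ∧
    ((∃ m : ℕ, s = m) →
      ((fun N : ℕ => Real.log (partitionFn d s p K N) - critConst d s p K * (N : ℝ) ^ (2 * s))
          =o[atTop] fun N : ℕ => (N : ℝ) ^ (2 * s)) ∧
      ((fun N : ℕ => Real.log (partitionFn d s p K N) -
            critConst d s p K * (N : ℝ) ^ (d * p / 2 - d))
          =o[atTop] fun N : ℕ => (N : ℝ) ^ (d * p / 2 - d))) ∧
    ((critConst d s p K : ℝ) : EReal) ≤
      liminf (fun N : ℕ =>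
        (((N : ℝ) ^ (-(2 * s)) * Real.log (partitionFn d s p K N) : ℝ) : EReal)) atTop := by
  have hs0 : 0 < s := lt_of_le_of_lt (by positivity) hs
  have hK0 : 0 < K := (norm_nonneg Q).trans_lt hK
  have hC : 0 < critConst d s p K := critConst_pos hd hs0 hp hQ.1 hQ.2.1 hQn hK
  have hlim := tendsto_log_partitionFn hd hs hp hK0 hC
  have hexp : (d : ℝ) * p / 2 - d = 2 * s := by
    rw [hp]
    field_simp
    ring
  have ho : (fun N : ℕ => Real.log (partitionFn d s p K N) -
      critConst d s p K * (N : ℝ) ^ (2 * s)) =o[atTop] fun N : ℕ => (N : ℝ) ^ (2 * s) := by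
    refine (isLittleO_iff_tendsto' ?_).mpr ?_
    · filter_upwards [eventually_ge_atTop 1] with N hN h0
      have : (0 : ℝ) < N := by exact_mod_cast hN
      exact absurd h0 (by positivity)
    · have h1 := hlim.sub_const (critConst d s p K)
      rw [sub_self] at h1
      refine h1.congr' ?_
      filter_upwards [eventually_ge_atTop 1] with N hN
      have hN0 : (0 : ℝ) < N := by exact_mod_cast hN
      have hX : (N : ℝ) ^ (2 * s) ≠ 0 := by positivity
      rw [Real.rpow_neg hN0.le]
      field_simp
  refine ⟨hC, fun _ => ⟨ho, ?_⟩, ?_⟩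
  · rw [hexp]
    exact ho
  · exact ((continuous_coe_real_ereal.tendsto _).comp hlim).liminf_eq.ge
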